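/- Let $\mathcal H$ be a complex Hilbert space, let $p\ge 4$ be an even integer, let $\mathcal B_p(\mathcal H)$ be the $p$-Schatten class with norm $\|x\|_p=\mathrm{Tr}(|x|^p)^{1/p}$, and let $U_p(\mathcal H)$ be the group of unitary operators $u$ on $\mathcal H$ with $u-1\in\mathcal B_p(\mathcal H)$. Let $d_p$ be the rectifiable distance of $U_p(\mathcal H)$, i.e. $d_p(u,v)$ is the infimum of the lengths $\int_a^b\|\dot\gamma(t)\|_p\,dt$ over all curves $\gamma:[a,b]\to U_p(\mathcal H)$ from $u$ to $v$ that are piecewise smooth (with respect to $\|\cdot\|_p$, where smooth means $C^1$ with non-vanishing derivative). The geodesics of $U_p(\mathcal H)$ are the curves $s\mapsto v e^{sz}$, where $v\in U_p(\mathcal H)$ and $z\in\mathcal B_p(\mathcal H)$ is anti-hermitian. Let $\mathrm{sinc}(r)=\sin(r)/r$, $\mathrm{sinc}(0)=1$, and let $r_p=\frac12\,\mathrm{sinc}^{-1}\!\big(\frac1{p-1}\big)$, where $\mathrm{sinc}^{-1}:[0,1]\to[0,\pi]$ is the inverse of the decreasing bijection $\mathrm{sinc}:[0,\pi]\to[0,1]$.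 **Theorem 2.3.** Let $u\in U_p(\mathcal H)$, and let $\beta:[0,1]\to U_p(\mathcal H)$ be a non-constant geodesic contained in the ball $B_p(u,r_p)=\{w\in U_p(\mathcal H): d_p(u,w)<r_p\}$. Assume that $u$ does not belong to any prolongation of $\beta$ (as a geodesic). Then $f_p(s)=d_p(u,\beta(s))^p$ is twice differentiable on $[0,1]$ (one-sidedly at the end points). For every $s\in[0,1]$ the principal logarithm $w_s=\log(u^{*}\beta(s))$ is an anti-hermitian element of $\mathcal B_p(\mathcal H)$ with $e^{w_s}=u^{*}\beta(s)$, and $$(p-1)\,f_p'(s)^2\;\le\; p\,f_p(s)\,f_p''(s)\,\frac1{\mathrm{sinc}(2\|w_s\|_p)}\;\le\; p(p-1)\,f_p(s)\,f_p''(s).$$ Moreover, equality holds in the last inequality if and only if $f_p''(s)=0$. -/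

import Mathlib

open Set Filter Topology
open scoped ENNReal

theorem ofReal_norm_sq_eq_tsum {H : Type*} [NormedAddCommGroup H] [InnerProductSpace ℂ H]
    {ι : Type*} (b : HilbertBasis ι ℂ H) (x : H) :
    ENNReal.ofReal (‖x‖ ^ 2) = ∑' i, ENNReal.ofReal (‖inner ℂ (b i) x‖ ^ 2) := by
  have h := (b.hasSum_inner_mul_inner x x).mapL Complex.reCLM
  have h2 : ∀ i, Complex.reCLM (inner ℂ x (b i) * inner ℂ (b i) x) = ‖inner ℂ (b i) x‖ ^ 2 := by
    intro i
    rw [← inner_conj_symm x (b i), Complex.conj_mul']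
    simp [← Complex.ofReal_pow]
  simp only [h2] at h
  have h3 : Complex.reCLM (inner ℂ x x) = ‖x‖ ^ 2 := by
    rw [inner_self_eq_norm_sq_to_K]
    simp [← Complex.ofReal_pow]
  rw [h3] at h
  rw [← h.tsum_eq, ENNReal.ofReal_tsum_of_nonneg (fun _ => by positivity) h.summable]

section SchattenUnitaryGroups

variable {H : Type*} [NormedAddCommGroup H] [InnerProductSpace ℂ H] [CompleteSpace H]

/-- The trace `∑ᵢ ⟪eᵢ, T eᵢ⟫ ∈ [0, ∞]` of a positive operator `T` on a complex Hilbert space, computed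
in a fixed Hilbert basis; by `opTrace_eq` below every Hilbert basis gives the same value. -/
noncomputable def opTrace (T : H →L[ℂ] H) : ℝ≥0∞ :=
  ∑' i : (exists_hilbertBasis ℂ H).choose,
    ENNReal.ofReal (inner ℂ ((exists_hilbertBasis ℂ H).choose_spec.choose i)
      (T ((exists_hilbertBasis ℂ H).choose_spec.choose i))).re

theorem tsum_inner_eq_of_nonneg {ι κ : Type*} (b : HilbertBasis ι ℂ H) (c : HilbertBasis κ ℂ H)
    {T : H →L[ℂ] H} (hT : 0 ≤ T) :
    ∑' i, ENNReal.ofReal (inner ℂ (b i) (T (b i))).re =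
      ∑' j, ENNReal.ofReal (inner ℂ (c j) (T (c j))).re := by
  obtain ⟨S, hS, rfl⟩ : ∃ S : H →L[ℂ] H, star S = S ∧ T = S * S :=
    ⟨CFC.sqrt T, (CFC.sqrt_nonneg T).isSelfAdjoint, (CFC.sqrt_mul_sqrt_self T hT).symm⟩
  have hadj : ∀ x y : H, inner ℂ x (S y) = inner ℂ (S x) y := by
    intro x y
    rw [← ContinuousLinearMap.adjoint_inner_left, ← ContinuousLinearMap.star_eq_adjoint, hS]
  have key : ∀ x : H, (inner ℂ x ((S * S) x)).re = ‖S x‖ ^ 2 := by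
    intro x
    rw [mul_apply_eq_comp, hadj, inner_self_eq_norm_sq_to_K]
    simp [← Complex.ofReal_pow]
  simp only [key]
  simp_rw [fun i => ofReal_norm_sq_eq_tsum c (S (b i)), fun j => ofReal_norm_sq_eq_tsum b (S (c j))]
  rw [ENNReal.tsum_comm]
  refine tsum_congr fun j => tsum_congr fun i => ?_
  rw [hadj, ← inner_conj_symm, Complex.norm_conj]

theorem opTrace_eq {ι : Type*} (b : HilbertBasis ι ℂ H) {T : H →L[ℂ] H} (hT : 0 ≤ T) :
    opTrace T = ∑' i, ENNReal.ofReal (inner ℂ (b i) (T (b i))).re :=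
  tsum_inner_eq_of_nonneg _ b hT

/-- The Schatten norm `‖x‖_p = Tr(|x|^p)^{1/p}`, with value `∞` outside of the Schatten class. -/
noncomputable def eSchattenNorm (p : ℕ) (x : H →L[ℂ] H) : ℝ≥0∞ :=
  opTrace (CFC.abs x ^ p) ^ (1 / (p : ℝ))

/-- The real-valued Schatten norm, meaningful on `schattenClass p`. -/
noncomputable def schattenNorm (p : ℕ) (x : H →L[ℂ] H) : ℝ := (eSchattenNorm p x).toReal

/-- The `p`-Schatten class `𝓑_p(H)`. -/
def schattenClass (p : ℕ) : Set (H →L[ℂ] H) := {x | eSchattenNorm p x < ∞}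

/-- `U_p(H)`, the unitary operators `u` with `u - 1` in the `p`-Schatten class. -/
def schattenUnitary (p : ℕ) : Set (H →L[ℂ] H) :=
  {u | u ∈ unitary (H →L[ℂ] H) ∧ u - 1 ∈ schattenClass p}

/-- `γ` is smooth on `[a, b]`: it has there a derivative `γ'` (one-sided at the end points), which
is continuous and does not vanish; limits are taken with respect to the norm `‖·‖_p`. -/
def IsSchattenSmoothOn (p : ℕ) (γ : ℝ → H →L[ℂ] H) (a b : ℝ) : Prop :=
  ∃ γ' : ℝ → H →L[ℂ] H, ∀ t ∈ Icc a b,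
    Tendsto (fun s => eSchattenNorm p (slope γ t s - γ' t)) (𝓝[Icc a b \ {t}] t) (𝓝 0) ∧
    Tendsto (fun s => eSchattenNorm p (γ' s - γ' t)) (𝓝[Icc a b] t) (𝓝 0) ∧
    γ' t ≠ 0

/-- `γ` is a piecewise smooth curve `[a, b] → U_p(H)`. -/
def IsSchattenCurve (p : ℕ) (γ : ℝ → H →L[ℂ] H) (a b : ℝ) : Prop :=
  a < b ∧ (∀ t ∈ Icc a b, γ t ∈ schattenUnitary p) ∧
    ∃ (n : ℕ) (τ : Fin (n + 1) → ℝ), StrictMono τ ∧ τ 0 = a ∧ τ (Fin.last n) = b ∧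
      ∀ i : Fin n, IsSchattenSmoothOn p γ (τ i.castSucc) (τ i.succ)

/-- The length `∫ₐᵇ ‖γ'(t)‖_p dt` of a piecewise smooth curve (the finitely many break points,
where `deriv` may be a default value, form a null set). -/
noncomputable def schattenLength (p : ℕ) (γ : ℝ → H →L[ℂ] H) (a b : ℝ) : ℝ≥0∞ :=
  ∫⁻ t in Icc a b, eSchattenNorm p (deriv γ t)

/-- The rectifiable distance of `U_p(H)`, the infimum of the lengths of the piecewise smooth
curves in `U_p(H)` from `u` to `v` (`∞` if there is none). -/
noncomputable def eSchattenDist (p : ℕ) (u v : H →L[ℂ] H) : ℝ≥0∞ :=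
  ⨅ (γ : ℝ → H →L[ℂ] H) (a : ℝ) (b : ℝ)
    (_ : IsSchattenCurve p γ a b ∧ γ a = u ∧ γ b = v), schattenLength p γ a b

/-- The rectifiable distance `d_p(u, v)` as a real number. -/
noncomputable def schattenDist (p : ℕ) (u v : H →L[ℂ] H) : ℝ := (eSchattenDist p u v).toReal

/-- The geodesic ball `B_p(u, r)`. -/
def schattenBall (p : ℕ) (u : H →L[ℂ] H) (r : ℝ) : Set (H →L[ℂ] H) :=
  {w | w ∈ schattenUnitary p ∧ eSchattenDist p u w < ENNReal.ofReal r}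

/-- `β` is, on the parameter set `J`, a geodesic `s ↦ v e^{sz}` of `U_p(H)`, where `v ∈ U_p(H)` and
`z` is an anti-hermitian operator of the `p`-Schatten class. -/
def IsSchattenGeodesicOn (p : ℕ) (β : ℝ → H →L[ℂ] H) (J : Set ℝ) : Prop :=
  ∃ v ∈ schattenUnitary p, ∃ z ∈ schattenClass p, star z = -z ∧
    ∀ s ∈ J, β s = v * NormedSpace.exp (s • z)

/-- The logarithm of a unitary operator (without `-1` in its spectrum): the principal branch,
applied by the continuous functional calculus. -/
noncomputable def unitaryLog (v : H →L[ℂ] H) : H →L[ℂ] H := cfc Complex.log v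

end SchattenUnitaryGroups

/-- The radius `r_p = ½ g⁻¹(1 / (p - 1))`, where `g = sinc : [0, π] → [0, 1]`. -/
noncomputable def schattenRadius (p : ℕ) : ℝ :=
  1 / 2 * Function.invFunOn Real.sinc (Icc 0 Real.pi) (1 / ((p : ℝ) - 1))

/-! ### Inequalities for sums of extended nonnegative reals -/

namespace ENNReal

/-! For even p the Schatten norm is handled in variational form: ‖x‖_p^p is the supremum of ∑ ‖x
e‖^p over finite orthonormal sets (`eSchattenNorm_eq_frameNorm`). The triangle inequality, unitary
invariance and stability under operator-norm integrals are immediate in this form; Hölder's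
inequality (`frameNorm_mul_le_mul`) comes from an eigenbasis of x⋆x.

The distance is computed first. A unitary v with ‖v - 1‖ < 2 is e^{ih} with h = `unitaryArg v`. If v
and v' are close and ‖arg v'‖ < π/2, then ‖arg v‖_p ≤ ‖arg v'‖_p + K ‖v - v'‖_p, where K tends to 1
as v - v' tends to 0 (`frameNorm_unitaryArg_le_add`). Hence the norm of the argument grows along a
curve no faster than arc length. With one-parameter curves as competitors, d_p(u, v) = ‖log(u⋆v)‖_p
for u ≠ v at distance below π/2 (`eSchattenDist_eq`). Since r_p < π/2, the function f is F(s) =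
‖h_s‖_p^p = Tr h_s^{2m}, with p = 2m and h_s = arg(u⋆β(s)).

Now let β(s) = v e^{sz} and y = -iz. In an eigenbasis of h_s with eigenvalues l_i, the derivative of
h_s has entries ρ_ij y_ij. Here ρ_ij = 1 if l_i = l_j, and otherwise ρ_ij = id/(e^{id} - 1) with d =
l_j - l_i, whose real part (d/2) cot(d/2) is nonnegative because |d| < π. Only the diagonal enters
F' = 2m Tr(h^{2m-1} y). As y does not depend on s, differentiating again needs only the first
derivative of the logarithm, and F'' = 2m ∑ S(l_j, l_i) Re(ρ_ji) |y_ji|² with S(a, b) = (a^{2m-1} -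
b^{2m-1})/(a - b) ≥ 0. Dropping the off-diagonal terms leaves F'' ≥ 2m(2m-1) ∑ l_i^{2m-2} y_ii², and
Cauchy–Schwarz yields (p-1) F'² ≤ p F F''. The traces are realised as Hilbert–Schmidt pairings of
h^m with h^{m-1} y, and a product rule based on Hölder's inequality supplies the differentiability.

This is already stronger than the first inequality wanted, because 1/sinc(2‖w‖_p) ≥ 1. The second
follows from 1/sinc(2‖w‖_p) < p - 1 inside the ball; as this is strict and F > 0 (u is not on β),
equality forces F'' = 0. -/

theorem tsum_Lp_add_le {ι : Type*} (f g : ι → ℝ≥0∞) {q : ℝ} (hq : 1 ≤ q) :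
    (∑' i, (f i + g i) ^ q) ^ (1 / q) ≤ (∑' i, f i ^ q) ^ (1 / q) + (∑' i, g i ^ q) ^ (1 / q) := by
  have hq0 : 0 < q := by linarith
  have h1 : (0 : ℝ) ≤ 1 / q := by positivity
  rw [one_div, ENNReal.rpow_inv_le_iff hq0, ENNReal.tsum_eq_iSup_sum]
  refine iSup_le fun s => ?_
  rw [← ENNReal.rpow_inv_le_iff hq0, ← one_div]
  refine (ENNReal.Lp_add_le s f g hq).trans ?_
  gcongr <;> exact ENNReal.sum_le_tsum s

theorem tsum_mul_le_Lp_mul_Lq {ι : Type*} (f g : ι → ℝ≥0∞) {q r : ℝ} (h : q.HolderConjugate r) :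
    ∑' i, f i * g i ≤ (∑' i, f i ^ q) ^ (1 / q) * (∑' i, g i ^ r) ^ (1 / r) := by
  have h1 : (0 : ℝ) ≤ 1 / q := by have := h.pos; positivity
  have h2 : (0 : ℝ) ≤ 1 / r := by have := h.symm.pos; positivity
  rw [ENNReal.tsum_eq_iSup_sum]
  refine iSup_le fun s => (ENNReal.inner_le_Lp_mul_Lq s f g h).trans ?_
  gcongr <;> exact ENNReal.sum_le_tsum s

theorem tsum_mul_le_weight_mul_Lp {ι : Type*} (w f : ι → ℝ≥0∞) {q : ℝ} (hq : 1 ≤ q) :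
    ∑' i, w i * f i ≤ (∑' i, w i) ^ (1 - q⁻¹) * (∑' i, w i * f i ^ q) ^ q⁻¹ := by
  have hq0 : 0 < q := by linarith
  have h1 : (0 : ℝ) ≤ q⁻¹ := by positivity
  have h2 : (0 : ℝ) ≤ 1 - q⁻¹ := by have := inv_le_one_of_one_le₀ hq; linarith
  rw [ENNReal.tsum_eq_iSup_sum]
  refine iSup_le fun s => (ENNReal.inner_le_weight_mul_Lp_of_nonneg s hq w f).trans ?_
  gcongr <;> exact ENNReal.sum_le_tsum s

/-- Jensen's inequality for a doubly substochastic matrix: the row sums permit convexity of t^c in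
each row, and the column sums control the total. It is used with the entries |⟨b_k, e_i⟩|² of two
orthonormal families. -/
theorem tsum_rpow_tsum_mul_le {ι κ : Type*} (a : ι → κ → ℝ≥0∞) (σ : κ → ℝ≥0∞) {c : ℝ} (hc : 1 ≤ c)
    (hrow : ∀ i, ∑' k, a i k ≤ 1) (hcol : ∀ k, ∑' i, a i k ≤ 1) :
    ∑' i, (∑' k, a i k * σ k) ^ c ≤ ∑' k, σ k ^ c := by
  have hc0 : 0 < c := by linarith
  have h2 : (0 : ℝ) ≤ 1 - c⁻¹ := by have := inv_le_one_of_one_le₀ hc; linarith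
  have key : ∀ i, (∑' k, a i k * σ k) ^ c ≤ ∑' k, a i k * σ k ^ c := by
    intro i
    have := tsum_mul_le_weight_mul_Lp (a i) σ hc
    have h3 : (∑' k, a i k) ^ (1 - c⁻¹) ≤ 1 := ENNReal.rpow_le_one (hrow i) h2
    have h4 : ∑' k, a i k * σ k ≤ (∑' k, a i k * σ k ^ c) ^ c⁻¹ :=
      this.trans (mul_le_of_le_one_left' h3)
    calc (∑' k, a i k * σ k) ^ c ≤ ((∑' k, a i k * σ k ^ c) ^ c⁻¹) ^ c := by gcongr
      _ = _ := ENNReal.rpow_inv_rpow hc0.ne' _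
  calc _ ≤ ∑' i, ∑' k, a i k * σ k ^ c := ENNReal.tsum_le_tsum key
    _ = ∑' k, (∑' i, a i k) * σ k ^ c := by
      rw [ENNReal.tsum_comm]; simp_rw [ENNReal.tsum_mul_right]
    _ ≤ ∑' k, σ k ^ c := ENNReal.tsum_le_tsum fun k => mul_le_of_le_one_left' (hcol k)

theorem tsum_rpow_mul_rpow_le {ι : Type*} (f g : ι → ℝ≥0∞) {θ : ℝ} (h0 : 0 < θ) (h1 : θ ≤ 1) :
    ∑' i, f i ^ θ * g i ^ (1 - θ) ≤ (∑' i, f i) ^ θ * (∑' i, g i) ^ (1 - θ) := by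
  rcases h1.eq_or_lt with rfl | h1
  · simp
  have h2 : 0 < 1 - θ := by linarith
  have hc : (θ⁻¹).HolderConjugate (1 - θ)⁻¹ :=
    Real.holderConjugate_iff.2 ⟨(one_lt_inv₀ h0).2 h1, by simp⟩
  have := tsum_mul_le_Lp_mul_Lq (fun i => f i ^ θ) (fun i => g i ^ (1 - θ)) hc
  simpa only [ENNReal.rpow_rpow_inv h0.ne', ENNReal.rpow_rpow_inv h2.ne', one_div, inv_inv]
    using this

/-- The inequality behind Hölder's inequality for Schatten norms, phrased in terms of the row and
column sums of the matrix `a`. -/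
theorem tsum_rpow_tsum_mul_le_of_marginals {ι κ : Type*} (a : ι → κ → ℝ≥0∞) (σ : κ → ℝ≥0∞)
    {x y c : ℝ} (hc : 1 ≤ c) (hx : 0 < x) (hy : 0 < y) (h : c⁻¹ = x + y) {X Y : ℝ≥0∞}
    (hX : ∑' k, σ k ^ x⁻¹ ≤ X) (hrow : ∑' i, (∑' k, a i k) ^ y⁻¹ ≤ Y)
    (hcol : ∑' k, (∑' i, a i k) ^ y⁻¹ ≤ Y) :
    ∑' i, (∑' k, a i k * σ k) ^ c ≤ X ^ (c * x) * Y ^ (c * y) := by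
  have hc0 : 0 < c := by linarith
  have hc1 : x + y ≤ 1 := h ▸ inv_le_one_of_one_le₀ hc
  obtain rfl : c = (x + y)⁻¹ := by rw [← h, inv_inv]
  have hxy : 0 < x + y := by positivity
  have hy1 : 0 < 1 - y := by linarith
  -- The choice of α makes σ^α = (σ^{1/x})^{1-y}, so Hölder over the columns with exponents 1/y and
  -- 1/(1-y) bounds ∑ Q i. Then θ = 1/(α(x+y)) is the power of Q i produced by the weighted row
  -- inequality, and the complementary power of the row sum is (1-θ)/y.
  set α : ℝ := (1 - y) / x with hα
  have hα1 : 1 ≤ α := by rw [hα, one_le_div hx]; linarith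
  have hα0 : 0 < α := by linarith
  set θ : ℝ := x / ((x + y) * (1 - y)) with hθ
  have hθ0 : 0 < θ := by positivity
  have hθ1 : θ ≤ 1 := by
    rw [hθ, div_le_one (by positivity)]
    nlinarith
  set Q : ι → ℝ≥0∞ := fun i => ∑' k, a i k * σ k ^ α with hQ
  have hS : ∀ i, (∑' k, a i k * σ k) ^ (x + y)⁻¹ ≤
      Q i ^ θ * ((∑' k, a i k) ^ y⁻¹) ^ (1 - θ) := by
    intro i
    calc (∑' k, a i k * σ k) ^ (x + y)⁻¹
        ≤ ((∑' k, a i k) ^ (1 - α⁻¹) * Q i ^ α⁻¹) ^ (x + y)⁻¹ := by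
          gcongr; exact tsum_mul_le_weight_mul_Lp _ _ hα1
      _ = _ := by
          rw [ENNReal.mul_rpow_of_nonneg _ _ hc0.le, ← ENNReal.rpow_mul, ← ENNReal.rpow_mul,
            ← ENNReal.rpow_mul, mul_comm]
          congr 2
          · rw [hα, hθ]; field_simp
          · rw [hα, hθ]; field_simp; ring
  have hsumQ : ∑' i, Q i ≤ Y ^ y * X ^ (1 - y) := by
    calc ∑' i, Q i = ∑' k, ((∑' i, a i k) ^ y⁻¹) ^ y * (σ k ^ x⁻¹) ^ (1 - y) := by
          simp only [hQ]; rw [ENNReal.tsum_comm]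
          simp_rw [ENNReal.tsum_mul_right, ENNReal.rpow_inv_rpow hy.ne', ← ENNReal.rpow_mul]
          congr! 4
          rw [hα]; field_simp
      _ ≤ _ := tsum_rpow_mul_rpow_le _ _ hy (by linarith)
      _ ≤ Y ^ y * X ^ (1 - y) := by gcongr
  have h1θ : 0 ≤ 1 - θ := by linarith
  calc _ ≤ ∑' i, Q i ^ θ * ((∑' k, a i k) ^ y⁻¹) ^ (1 - θ) := ENNReal.tsum_le_tsum hS
    _ ≤ _ := tsum_rpow_mul_rpow_le _ _ hθ0 hθ1
    _ ≤ (Y ^ y * X ^ (1 - y)) ^ θ * Y ^ (1 - θ) := by gcongr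
    _ = _ := by
      rw [ENNReal.mul_rpow_of_nonneg _ _ hθ0.le, ← ENNReal.rpow_mul, ← ENNReal.rpow_mul,
        mul_right_comm, ← ENNReal.rpow_add_of_nonneg _ _ (by positivity) h1θ, mul_comm]
      congr 2
      · rw [hθ]; field_simp
      · rw [hθ]; field_simp; ring

end ENNReal

/-! ### The frame norm -/

section FrameNorm

variable {H : Type*} [NormedAddCommGroup H] [InnerProductSpace ℂ H]

/-- The supremum of `∑ ‖x e‖ ^ q` over the finite orthonormal sets of vectors `e`. -/
noncomputable def frameSum (q : ℝ) (x : H →L[ℂ] H) : ℝ≥0∞ :=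
  ⨆ (s : Finset H) (_ : Orthonormal ℂ ((↑) : s → H)), ∑ e ∈ s, ‖x e‖ₑ ^ q

/-- For `q ≥ 2` this is the `q`-Schatten norm in its variational description. -/
noncomputable def frameNorm (q : ℝ) (x : H →L[ℂ] H) : ℝ≥0∞ := frameSum q x ^ q⁻¹

variable {q : ℝ} {x y : H →L[ℂ] H}

theorem sum_le_frameSum {s : Finset H} (hs : Orthonormal ℂ ((↑) : s → H)) :
    ∑ e ∈ s, ‖x e‖ₑ ^ q ≤ frameSum q x :=
  le_iSup₂_of_le (f := fun (s : Finset H) (_ : Orthonormal ℂ ((↑) : s → H)) =>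
    ∑ e ∈ s, ‖x e‖ₑ ^ q) s hs le_rfl

theorem Orthonormal.sum_le_frameSum {ι : Type*} {v : ι → H} (hv : Orthonormal ℂ v)
    (s : Finset ι) : ∑ i ∈ s, ‖x (v i)‖ₑ ^ q ≤ frameSum q x := by
  have hinj : Function.Injective v := hv.linearIndependent.injective
  have h : Orthonormal ℂ ((↑) : (s.map ⟨v, hinj⟩ : Finset H) → H) := by
    have h2 : Orthonormal ℂ ((↑) : range v → H) := (orthonormal_subtype_range hinj).2 hv
    have h3 : ∀ e : (s.map ⟨v, hinj⟩ : Finset H), (e : H) ∈ range v := fun e => by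
      obtain ⟨i, -, hi⟩ := Finset.mem_map.1 e.2
      exact ⟨i, hi⟩
    exact h2.comp (fun e : (s.map ⟨v, hinj⟩ : Finset H) => (⟨e.1, h3 e⟩ : range v))
      fun a b hab => Subtype.ext (by simpa using hab)
  simpa using _root_.sum_le_frameSum (x := x) (q := q) h

theorem Orthonormal.tsum_le_frameSum {ι : Type*} {v : ι → H} (hv : Orthonormal ℂ v) :
    ∑' i, ‖x (v i)‖ₑ ^ q ≤ frameSum q x := by
  rw [ENNReal.tsum_eq_iSup_sum]
  exact iSup_le fun s => hv.sum_le_frameSum s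

theorem frameSum_le {C : ℝ≥0∞}
    (h : ∀ s : Finset H, Orthonormal ℂ ((↑) : s → H) → ∑ e ∈ s, ‖x e‖ₑ ^ q ≤ C) :
    frameSum q x ≤ C := iSup₂_le h

theorem frameNorm_rpow (hq : 0 < q) : frameNorm q x ^ q = frameSum q x :=
  ENNReal.rpow_inv_rpow hq.ne' _

theorem Orthonormal.tsum_rpow_le_frameNorm {ι : Type*} {v : ι → H} (hv : Orthonormal ℂ v)
    (hq : 0 < q) : (∑' i, ‖x (v i)‖ₑ ^ q) ^ q⁻¹ ≤ frameNorm q x :=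
  ENNReal.rpow_le_rpow hv.tsum_le_frameSum (by positivity)

/-- The frame norm sees an operator only through the function v ↦ ‖x v‖; unitary invariance and the
ideal property follow from this. -/
theorem frameNorm_mono (hq : 0 < q) (h : ∀ v, ‖x v‖ ≤ ‖y v‖) : frameNorm q x ≤ frameNorm q y := by
  refine ENNReal.rpow_le_rpow (frameSum_le fun s hs => ?_) (by positivity)
  calc ∑ e ∈ s, ‖x e‖ₑ ^ q ≤ ∑ e ∈ s, ‖y e‖ₑ ^ q := by
        gcongr with e he; exact enorm_le_iff_norm_le.2 (h e)
    _ ≤ frameSum q y := sum_le_frameSum hs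

theorem frameNorm_congr (hq : 0 < q) (h : ∀ v, ‖x v‖ = ‖y v‖) : frameNorm q x = frameNorm q y :=
  le_antisymm (frameNorm_mono hq fun v => (h v).le) (frameNorm_mono hq fun v => (h v).ge)

theorem frameNorm_zero (hq : 0 < q) : frameNorm q (0 : H →L[ℂ] H) = 0 := by
  have : frameSum q (0 : H →L[ℂ] H) = 0 := by
    refine le_antisymm (frameSum_le fun s _ => ?_) bot_le
    simp [hq]
  rw [frameNorm, this, ENNReal.zero_rpow_of_pos (by positivity)]

theorem frameNorm_neg (hq : 0 < q) : frameNorm q (-x) = frameNorm q x :=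
  frameNorm_congr hq fun v => by simp

theorem frameNorm_sub_comm (hq : 0 < q) : frameNorm q (x - y) = frameNorm q (y - x) := by
  rw [← frameNorm_neg hq, neg_sub]

theorem frameNorm_smul_le (hq : 0 < q) (c : ℂ) : frameNorm q (c • x) ≤ ‖c‖ₑ * frameNorm q x := by
  have : ‖c‖ₑ * frameNorm q x = (‖c‖ₑ ^ q * frameSum q x) ^ q⁻¹ := by
    rw [frameNorm, ENNReal.mul_rpow_of_nonneg _ _ (by positivity), ENNReal.rpow_rpow_inv hq.ne']
  rw [this]
  refine ENNReal.rpow_le_rpow (frameSum_le fun s hs => ?_) (by positivity)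
  have h2 := sum_le_frameSum (x := x) (q := q) hs
  calc ∑ e ∈ s, ‖(c • x) e‖ₑ ^ q = ‖c‖ₑ ^ q * ∑ e ∈ s, ‖x e‖ₑ ^ q := by
        rw [Finset.mul_sum]
        refine Finset.sum_congr rfl fun e _ => ?_
        rw [smul_apply, enorm_smul, ENNReal.mul_rpow_of_nonneg _ _ hq.le]
    _ ≤ _ := by gcongr

theorem frameNorm_le_of_norm_le (hq : 0 < q) {C : ℝ} (hC : 0 ≤ C) (h : ∀ v, ‖x v‖ ≤ C * ‖y v‖) :
    frameNorm q x ≤ ENNReal.ofReal C * frameNorm q y := by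
  calc frameNorm q x ≤ frameNorm q ((C : ℂ) • y) :=
        frameNorm_mono hq fun v => by
          simpa [norm_smul, abs_of_nonneg hC] using h v
    _ ≤ _ := (frameNorm_smul_le hq _).trans (by simp [← ofReal_norm, abs_of_nonneg hC])

theorem frameNorm_mul_le (hq : 0 < q) : frameNorm q (x * y) ≤ ‖x‖ₑ * frameNorm q y := by
  rw [← ofReal_norm]
  exact frameNorm_le_of_norm_le hq (norm_nonneg x) fun v => x.le_opNorm (y v)

theorem frameNorm_real_smul_le (hq : 0 < q) (c : ℝ) :
    frameNorm q (c • x) ≤ ‖c‖ₑ * frameNorm q x := by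
  rw [← ofReal_norm]
  exact frameNorm_le_of_norm_le hq (norm_nonneg c) fun v => by simp [norm_smul]

theorem frameNorm_add_le (hq : 1 ≤ q) : frameNorm q (x + y) ≤ frameNorm q x + frameNorm q y := by
  have hq0 : 0 < q := by linarith
  rw [frameNorm, ENNReal.rpow_inv_le_iff hq0]
  refine frameSum_le fun s hs => ?_
  rw [← ENNReal.rpow_inv_le_iff hq0, ← one_div]
  have hx := sum_le_frameSum (x := x) (q := q) hs
  have hy := sum_le_frameSum (x := y) (q := q) hs
  calc (∑ e ∈ s, ‖(x + y) e‖ₑ ^ q) ^ (1 / q) ≤ (∑ e ∈ s, (‖x e‖ₑ + ‖y e‖ₑ) ^ q) ^ (1 / q) := by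
        gcongr with e he; exact enorm_add_le _ _
    _ ≤ _ := ENNReal.Lp_add_le s _ _ hq
    _ ≤ _ := by rw [frameNorm, frameNorm, one_div]; gcongr

theorem frameNorm_sub_le (hq : 1 ≤ q) : frameNorm q (x - y) ≤ frameNorm q x + frameNorm q y := by
  rw [sub_eq_add_neg, ← frameNorm_neg (x := y) (by linarith)]
  exact frameNorm_add_le hq

theorem enorm_le_frameNorm (hq : 0 < q) : ‖x‖ₑ ≤ frameNorm q x := by
  have h1 : ∀ v : H, ‖v‖ = 1 → ‖x v‖ₑ ≤ frameNorm q x := by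
    intro v hv
    have ho : Orthonormal ℂ (fun _ : Unit => v) :=
      ⟨fun _ => hv, fun i j hij => absurd (Subsingleton.elim i j) hij⟩
    have := ho.sum_le_frameSum (x := x) (q := q) Finset.univ
    rw [frameNorm, ENNReal.le_rpow_inv_iff hq]
    simpa using this
  by_cases htop : frameNorm q x = ∞
  · simp [htop]
  rw [← ENNReal.ofReal_toReal htop, ← ofReal_norm]
  refine ENNReal.ofReal_le_ofReal (x.opNorm_le_of_unit_norm ENNReal.toReal_nonneg fun v hv => ?_)
  have := ENNReal.toReal_mono htop (h1 v hv)
  simpa using this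

theorem norm_le_toReal_frameNorm (hq : 0 < q) (hx : frameNorm q x ≠ ∞) :
    ‖x‖ ≤ (frameNorm q x).toReal := by
  simpa using ENNReal.toReal_mono hx (enorm_le_frameNorm hq)

theorem frameSum_lt_top_iff (hq : 0 < q) : frameSum q x < ∞ ↔ frameNorm q x < ∞ := by
  rw [frameNorm, ENNReal.rpow_lt_top_iff_of_pos (by positivity)]

/-- An operator of finite frame norm is compact. -/
theorem isCompactOperator_of_frameNorm_lt_top [CompleteSpace H] (hq : 0 < q)
    (hx : frameNorm q x < ∞) : IsCompactOperator x := by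
  have hx' : frameSum q x < ∞ := (frameSum_lt_top_iff hq).2 hx
  -- finite-dimensional subspaces on whose complement `x` is small
  have key : ∀ ε : ℝ, 0 < ε → ∃ K : Submodule ℂ H, FiniteDimensional ℂ K ∧
      ∀ v ∈ Kᗮ, ‖x v‖ ≤ ε * ‖v‖ := by
    intro ε hε
    by_contra! hcon
    -- If no such subspace exists, orthonormal sets of every size on which ‖x e‖ ≥ ε are built
    -- greedily, each new vector being orthogonal to the span of the previous ones. The frame sum
    -- would then exceed every multiple of ε^q.
    have hbig : ∀ n : ℕ, ∃ s : Finset H, Orthonormal ℂ ((↑) : s → H) ∧ s.card = n ∧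
        ∀ e ∈ s, ε ≤ ‖x e‖ := by
      classical
      intro n
      induction n with
      | zero => exact ⟨∅, ⟨fun e => absurd e.2 (Finset.notMem_empty _),
          fun e => absurd e.2 (Finset.notMem_empty _)⟩, rfl, by simp⟩
      | succ n ih =>
        obtain ⟨s, hs, hcard, hse⟩ := ih
        obtain ⟨v, hv, hxv⟩ := hcon (Submodule.span ℂ (s : Set H)) inferInstance
        have hv0 : v ≠ 0 := by rintro rfl; simp at hxv
        set e : H := ((‖v‖ : ℂ)⁻¹) • v with he
        have hen : ‖e‖ = 1 := by rw [he, norm_smul]; simp [hv0]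
        have hes : ∀ f ∈ s, inner ℂ f e = 0 := fun f hf => by
          rw [he, inner_smul_right, (Submodule.mem_orthogonal _ _).1 hv f
            (Submodule.subset_span hf), mul_zero]
        have hnot : e ∉ s := fun hmem => by
          have := hes e hmem
          rw [inner_self_eq_zero] at this
          rw [this] at hen; simp at hen
        refine ⟨insert e s, ?_, by simp [hnot, hcard], ?_⟩
        · refine ⟨?_, ?_⟩
          · rintro ⟨f, hf⟩
            rcases Finset.mem_insert.1 hf with rfl | hf
            · exact hen
            · exact hs.1 ⟨f, hf⟩
          · rintro ⟨f, hf⟩ ⟨g, hg⟩ hfg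
            rcases Finset.mem_insert.1 hf with rfl | hf <;>
              rcases Finset.mem_insert.1 hg with rfl | hg
            · exact absurd rfl hfg
            · exact inner_eq_zero_symm.1 (hes g hg)
            · exact hes f hf
            · exact hs.2 (i := ⟨f, hf⟩) (j := ⟨g, hg⟩) (fun h => hfg (by simpa using h))
        · intro f hf
          rcases Finset.mem_insert.1 hf with rfl | hf
          · rw [he, map_smul, norm_smul, norm_inv, Complex.norm_real, norm_norm,
              le_inv_mul_iff₀ (norm_pos_iff.2 hv0), mul_comm]
            exact hxv.le
          · exact hse f hf
    obtain ⟨n, hn⟩ := ENNReal.exists_nat_mul_gt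
      (ENNReal.rpow_pos (ENNReal.ofReal_pos.2 hε) ENNReal.ofReal_ne_top : 0 < ENNReal.ofReal ε ^ q).ne'
      hx'.ne
    obtain ⟨s, hs, hcard, hse⟩ := hbig n
    refine absurd hn (not_lt.2 ?_)
    have h2 := sum_le_frameSum (x := x) (q := q) hs
    refine le_trans ?_ h2
    rw [← hcard, ← nsmul_eq_mul]
    refine Finset.card_nsmul_le_sum _ _ _ fun e he => ?_
    gcongr
    rw [← ofReal_norm]
    exact ENNReal.ofReal_le_ofReal (hse e he)
  -- Composing x with the projection onto K gives a finite-rank operator, close to x in operator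
  -- norm because x is small on the complement of K.
  have key2 : ∀ n : ℕ, ∃ F : H →L[ℂ] H, IsCompactOperator F ∧ ‖F - x‖ ≤ 1 / ((n : ℝ) + 1) := by
    intro n
    obtain ⟨K, hK, hKx⟩ := key (1 / ((n : ℝ) + 1)) (by positivity)
    refine ⟨x ∘L K.starProjection, ?_, ?_⟩
    · have : ProperSpace K := FiniteDimensional.proper ℂ K
      have h1 : IsCompactOperator (x ∘L K.subtypeL) :=
        isCompactOperator_of_locallyCompactSpace_rng _
      exact h1.comp_clm K.orthogonalProjectionOnto
    · refine ContinuousLinearMap.opNorm_le_bound _ (by positivity) fun v => ?_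
      have h3 : (x ∘L K.starProjection - x) v = - x (v - K.starProjection v) := by simp
      rw [h3, norm_neg]
      refine (hKx _ (Submodule.sub_starProjection_mem_orthogonal v)).trans ?_
      gcongr
      have : v - K.starProjection v = Kᗮ.starProjection v := by
        rw [Submodule.starProjection_orthogonal]; simp
      rw [this]
      exact Submodule.norm_starProjection_apply_le _ _
  choose F hF hFx using key2
  refine isCompactOperator_of_tendsto (l := atTop) (F := F) ?_ (Eventually.of_forall hF)
  rw [tendsto_iff_norm_sub_tendsto_zero]
  exact squeeze_zero (fun n => norm_nonneg _) hFx tendsto_one_div_add_atTop_nhds_zero_nat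

end FrameNorm

/-! ### Singular bases -/

section SingularBasis

universe u

variable {H : Type u} [NormedAddCommGroup H] [InnerProductSpace ℂ H]

theorem enorm_rpow_eq_sq_rpow {E : Type*} [NormedAddCommGroup E] (v : E) (q : ℝ) :
    ‖v‖ₑ ^ q = (‖v‖ₑ ^ 2) ^ (q / 2) := by
  rw [← ENNReal.rpow_natCast, ← ENNReal.rpow_mul]
  congr 1; push_cast; ring

theorem Orthonormal.tsum_enorm_inner_sq_le {ι : Type*} {v : ι → H} (hv : Orthonormal ℂ v) (w : H) :
    ∑' i, ‖inner ℂ (v i) w‖ₑ ^ 2 ≤ ‖w‖ₑ ^ 2 := by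
  rw [ENNReal.tsum_eq_iSup_sum]
  refine iSup_le fun s => ?_
  have := ENNReal.ofReal_le_ofReal (hv.sum_inner_products_le w (s := s))
  rw [ENNReal.ofReal_sum_of_nonneg (fun _ _ => by positivity)] at this
  simpa only [ENNReal.ofReal_pow (norm_nonneg _), ofReal_norm] using this

theorem HilbertBasis.tsum_enorm_inner_sq {ι : Type*} (b : HilbertBasis ι ℂ H) (w : H) :
    ∑' i, ‖inner ℂ (b i) w‖ₑ ^ 2 = ‖w‖ₑ ^ 2 := by
  have := ofReal_norm_sq_eq_tsum b w
  simpa only [ENNReal.ofReal_pow (norm_nonneg _), ofReal_norm] using this.symm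

theorem enorm_inner_comm (v w : H) : ‖inner ℂ v w‖ₑ = ‖inner ℂ w v‖ₑ := by
  rw [← ofReal_norm, ← ofReal_norm, norm_inner_symm]

variable [CompleteSpace H]

/-- Hilbert bases of all eigenspaces, the kernel included, are put together. They are mutually
orthogonal by symmetry and total by compactness. The index runs over all complex μ, most of which
contribute nothing. -/
theorem IsSelfAdjoint.exists_eigenbasis {T : H →L[ℂ] H} (hT : IsSelfAdjoint T)
    (hc : IsCompactOperator T) :
    ∃ (ι : Type u) (b : HilbertBasis ι ℂ H) (l : ι → ℝ), ∀ i, T (b i) = (l i : ℂ) • b i := by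
  have hsym : (T : H →ₗ[ℂ] H).IsSymmetric :=
    ContinuousLinearMap.isSelfAdjoint_iff_isSymmetric.1 hT
  let E : ℂ → Submodule ℂ H := fun μ => Module.End.eigenspace (T : Module.End ℂ H) μ
  have hE : ∀ μ, IsClosed (E μ : Set H) := fun μ => by
    have : (E μ : Set H) = {v | T v = μ • v} := by
      ext v; exact Module.End.mem_eigenspace_iff
    rw [this]
    exact isClosed_eq T.continuous (continuous_const_smul μ)
  have hcE : ∀ μ, CompleteSpace (E μ) := fun μ => (hE μ).completeSpace_coe
  choose w b hb using fun μ => exists_hilbertBasis ℂ (E μ)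
  let v : (Σ μ, w μ) → H := fun a => ((b a.1 a.2 : E a.1) : H)
  have hv : Orthonormal ℂ v :=
    hsym.orthogonalFamily_eigenspaces.orthonormal_sigma_orthonormal (fun μ => (b μ).orthonormal)
  have hperp : (Submodule.span ℂ (range v))ᗮ = ⊥ := by
    rw [eq_bot_iff, ← ContinuousLinearMap.orthogonalComplement_iSup_eigenspaces_eq_bot hc hsym]
    intro x hx
    rw [← Submodule.iInf_orthogonal, Submodule.mem_iInf]
    intro μ
    rw [Submodule.mem_orthogonal]
    intro y hy
    have h1 : ∀ i, inner ℂ ((b μ i : E μ) : H) x = 0 := fun i =>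
      (Submodule.mem_orthogonal _ _).1 hx _ (Submodule.subset_span ⟨⟨μ, i⟩, rfl⟩)
    have h2 : HasSum (fun i => (b μ).repr ⟨y, hy⟩ i • b μ i) (⟨y, hy⟩ : E μ) :=
      (b μ).hasSum_repr ⟨y, hy⟩
    have h3 := (h2.mapL (E μ).subtypeL).mapL (innerSL ℂ x)
    have h4 : ∀ i, (innerSL ℂ x) ((E μ).subtypeL ((b μ).repr ⟨y, hy⟩ i • b μ i)) = 0 := fun i => by
      simp [inner_eq_zero_symm.1 (h1 i)]
    simp only [h4] at h3
    exact inner_eq_zero_symm.1 (h3.unique hasSum_zero)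
  refine ⟨_, HilbertBasis.mkOfOrthogonalEqBot hv hperp, fun a => a.1.re, fun a => ?_⟩
  rw [HilbertBasis.coe_mkOfOrthogonalEqBot]
  have h1 : T (v a) = a.1 • v a := Module.End.mem_eigenspace_iff.1 (b a.1 a.2).2
  have h2 : a.1 = (a.1.re : ℂ) := by
    have h3 := hsym (v a) (v a)
    change inner ℂ (T (v a)) (v a) = inner ℂ (v a) (T (v a)) at h3
    rw [h1, inner_smul_left, inner_smul_right, inner_self_eq_norm_sq_to_K, hv.1 a] at h3
    simp at h3
    exact (Complex.conj_eq_iff_real.1 h3).elim fun r hr => by rw [hr]; simp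
  rw [h1, ← h2]

/-- A Hilbert basis of eigenvectors of `x⋆ x`. -/
def IsSingularBasis {ι : Type*} (x : H →L[ℂ] H) (b : HilbertBasis ι ℂ H) : Prop :=
  ∀ i, star x (x (b i)) = ((‖x (b i)‖ ^ 2 : ℝ) : ℂ) • b i

theorem inner_star_apply_left (x : H →L[ℂ] H) (v w : H) :
    inner ℂ (star x v) w = inner ℂ v (x w) := by
  rw [ContinuousLinearMap.star_eq_adjoint, ContinuousLinearMap.adjoint_inner_left]

theorem inner_star_apply_right (x : H →L[ℂ] H) (v w : H) :
    inner ℂ v (star x w) = inner ℂ (x v) w := by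
  rw [ContinuousLinearMap.star_eq_adjoint, ContinuousLinearMap.adjoint_inner_right]

theorem exists_singularBasis {q : ℝ} (hq : 0 < q) {x : H →L[ℂ] H} (hx : frameNorm q x < ∞) :
    ∃ (ι : Type u) (b : HilbertBasis ι ℂ H), IsSingularBasis x b := by
  have hc := isCompactOperator_of_frameNorm_lt_top hq hx
  have hc2 : IsCompactOperator (star x * x) := hc.clm_comp (star x)
  obtain ⟨ι, b, l, hl⟩ := (IsSelfAdjoint.star_mul_self x).exists_eigenbasis hc2
  refine ⟨ι, b, fun i => ?_⟩
  have h1 : star x (x (b i)) = (l i : ℂ) • b i := hl i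
  have h2 : ((‖x (b i)‖ ^ 2 : ℝ) : ℂ) = l i := by
    have h3 := inner_star_apply_right x (b i) (x (b i))
    rw [h1, inner_smul_right, inner_self_eq_norm_sq_to_K, inner_self_eq_norm_sq_to_K,
      b.orthonormal.1 i] at h3
    simpa using h3.symm
  rw [h1, h2]

theorem IsSelfAdjoint.isSingularBasis {T : H →L[ℂ] H} (hT : IsSelfAdjoint T) {ι : Type*}
    {b : HilbertBasis ι ℂ H} {l : ι → ℝ} (hl : ∀ i, T (b i) = (l i : ℂ) • b i) :
    IsSingularBasis T b := fun i => by
  rw [hT.star_eq, hl, map_smul, hl, norm_smul, b.orthonormal.1 i, smul_smul]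
  simp [← sq, ← Complex.ofReal_pow]

namespace IsSingularBasis

variable {ι : Type*} {x : H →L[ℂ] H} {b : HilbertBasis ι ℂ H}

theorem enorm_apply_sq (h : IsSingularBasis x b) (v : H) :
    ‖x v‖ₑ ^ 2 = ∑' i, ‖inner ℂ (b i) v‖ₑ ^ 2 * ‖x (b i)‖ₑ ^ 2 := by
  have h1 := (b.hasSum_inner_mul_inner v (star x (x v))).mapL Complex.reCLM
  rw [inner_star_apply_right] at h1
  have h2 : ∀ i, Complex.reCLM (inner ℂ v (b i) * inner ℂ (b i) (star x (x v))) =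
      ‖inner ℂ (b i) v‖ ^ 2 * ‖x (b i)‖ ^ 2 := by
    intro i
    rw [inner_star_apply_right, ← inner_star_apply_left, h i, inner_smul_left,
      Complex.conj_ofReal, ← inner_conj_symm v (b i), mul_left_comm, Complex.conj_mul',
      ← Complex.ofReal_pow, ← Complex.ofReal_mul]
    exact (Complex.ofReal_re _).trans (mul_comm _ _)
  simp only [h2] at h1
  have h3 : Complex.reCLM (inner ℂ (x v) (x v)) = ‖x v‖ ^ 2 := by
    rw [inner_self_eq_norm_sq_to_K]; simp [← Complex.ofReal_pow]
  rw [h3] at h1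
  have h4 : ENNReal.ofReal (‖x v‖ ^ 2) =
      ∑' i, ENNReal.ofReal (‖inner ℂ (b i) v‖ ^ 2 * ‖x (b i)‖ ^ 2) := by
    rw [← h1.tsum_eq, ENNReal.ofReal_tsum_of_nonneg (fun _ => by positivity) h1.summable]
  simpa only [ENNReal.ofReal_mul (sq_nonneg _), ENNReal.ofReal_pow (norm_nonneg _),
    ofReal_norm] using h4

/-- For any orthonormal set, ‖x e‖² is a combination of the ‖x bᵢ‖² with weights |⟨bᵢ, e⟩|², which
form a doubly substochastic matrix. Convexity of t^{q/2}, hence q ≥ 2, shows that the singular basis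
realises the supremum. -/
theorem frameSum_eq (h : IsSingularBasis x b) {q : ℝ} (hq : 2 ≤ q) :
    frameSum q x = ∑' i, ‖x (b i)‖ₑ ^ q := by
  refine le_antisymm (frameSum_le fun s hs => ?_) b.orthonormal.tsum_le_frameSum
  have h1 := ENNReal.tsum_rpow_tsum_mul_le (fun (e : s) i => ‖inner ℂ (b i) (e : H)‖ₑ ^ 2)
    (fun i => ‖x (b i)‖ₑ ^ 2) (c := q / 2) (by linarith)
    (fun e => by rw [b.tsum_enorm_inner_sq, ← ofReal_norm, hs.1 e]; simp)
    (fun i => by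
      simp_rw [enorm_inner_comm (b i)]
      refine (hs.tsum_enorm_inner_sq_le _).trans ?_
      rw [← ofReal_norm, b.orthonormal.1 i]; simp)
  simp only [← h.enorm_apply_sq, ← enorm_rpow_eq_sq_rpow] at h1
  rwa [tsum_fintype, Finset.univ_eq_attach, Finset.sum_attach s (fun e => ‖x e‖ₑ ^ q)] at h1

/-- The nonzero vectors among x bᵢ, once normalised, form an orthonormal family gᵢ with ‖x⋆v‖² = ∑
|⟨gᵢ, v⟩|² ‖x bᵢ‖², so the Jensen argument applies to x⋆ with the same singular values. -/
theorem frameSum_star_le (h : IsSingularBasis x b) {q : ℝ} (hq : 2 ≤ q) :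
    frameSum q (star x) ≤ ∑' i, ‖x (b i)‖ₑ ^ q := by
  refine frameSum_le fun s hs => ?_
  -- When x bᵢ = 0 the inverse is 0 and gᵢ = 0; such indices contribute nothing to the sums.
  let g : ι → H := fun i => ((‖x (b i)‖⁻¹ : ℝ) : ℂ) • x (b i)
  have hg0 : ∀ i, x (b i) = (‖x (b i)‖ : ℂ) • g i := fun i => by
    by_cases h0 : x (b i) = 0
    · simp [h0]
    · simp [g, smul_smul, h0]
  have hg1 : ∀ i, x (b i) ≠ 0 → ‖g i‖ = 1 := fun i hi => by simp [g, norm_smul, hi]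
  have hgo : Orthonormal ℂ (fun i : {i // x (b i) ≠ 0} => g i) := by
    refine ⟨fun i => hg1 i i.2, fun i j hij => ?_⟩
    have hij' : (i : ι) ≠ j := fun h => hij (Subtype.ext h)
    simp only [g, inner_smul_left, inner_smul_right]
    rw [← inner_star_apply_left, h i, inner_smul_left, b.orthonormal.2 hij']
    simp
  have hgle : ∀ i, ‖g i‖ₑ ^ 2 ≤ 1 := fun i => by
    by_cases h0 : x (b i) = 0
    · simp [g, h0]
    · rw [← ofReal_norm, hg1 i h0]; simp
  have h1 := ENNReal.tsum_rpow_tsum_mul_le (fun (e : s) i => ‖inner ℂ (g i) (e : H)‖ₑ ^ 2)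
    (fun i => ‖x (b i)‖ₑ ^ 2) (c := q / 2) (by linarith)
    (fun e => by
      have h2 : Function.support (fun i => ‖inner ℂ (g i) (e : H)‖ₑ ^ 2) ⊆ {i | x (b i) ≠ 0} := by
        intro i hi h0
        exact hi (by simp [g, h0])
      rw [← tsum_subtype_eq_of_support_subset h2]
      refine (hgo.tsum_enorm_inner_sq_le (e : H)).trans ?_
      rw [← ofReal_norm, hs.1 e]; simp)
    (fun i => by
      simp_rw [enorm_inner_comm (g i)]
      exact (hs.tsum_enorm_inner_sq_le _).trans (hgle i))
  have h3 : ∀ v : H, ‖star x v‖ₑ ^ 2 = ∑' i, ‖inner ℂ (g i) v‖ₑ ^ 2 * ‖x (b i)‖ₑ ^ 2 := fun v => by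
    rw [← b.tsum_enorm_inner_sq]
    refine tsum_congr fun i => ?_
    rw [inner_star_apply_right, hg0 i, inner_smul_left, enorm_mul, mul_pow, mul_comm, ← hg0 i]
    congr 2
    simp [← ofReal_norm]
  simp only [← h3, ← enorm_rpow_eq_sq_rpow] at h1
  rwa [tsum_fintype, Finset.univ_eq_attach, Finset.sum_attach s (fun e => ‖star x e‖ₑ ^ q)] at h1

end IsSingularBasis

variable {q : ℝ} {x y : H →L[ℂ] H}

theorem frameSum_star (hq : 2 ≤ q) : frameSum q (star x) = frameSum q x := by
  have key : ∀ x : H →L[ℂ] H, frameSum q (star x) ≤ frameSum q x := fun x => by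
    by_cases hx : frameSum q x < ∞
    · obtain ⟨ι, b, hb⟩ := exists_singularBasis (by linarith)
        ((frameSum_lt_top_iff (by linarith)).1 hx)
      rw [hb.frameSum_eq hq]
      exact hb.frameSum_star_le hq
    · rw [not_lt_top_iff.1 hx]; exact le_top
  exact le_antisymm (key x) (by simpa using key (star x))

theorem frameNorm_star (hq : 2 ≤ q) : frameNorm q (star x) = frameNorm q x := by
  rw [frameNorm, frameSum_star hq, frameNorm]

theorem frameNorm_mul_le' (hq : 2 ≤ q) : frameNorm q (x * y) ≤ frameNorm q x * ‖y‖ₑ := by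
  rw [← frameNorm_star hq, star_mul, ← frameNorm_star hq (x := x), mul_comm]
  refine (frameNorm_mul_le (by linarith)).trans (le_of_eq ?_)
  rw [← ofReal_norm, norm_star, ofReal_norm]

/-- **Hölder's inequality** for Schatten norms. -/
theorem frameNorm_mul_le_mul {q₁ q₂ r : ℝ} (hr : 2 ≤ r) (hq₁ : 0 < q₁) (hq₂ : 0 < q₂)
    (h : r⁻¹ = q₁⁻¹ + q₂⁻¹) (hx : frameNorm q₁ x < ∞) :
    frameNorm r (x * y) ≤ frameNorm q₁ x * frameNorm q₂ y := by
  have hr0 : 0 < r := by linarith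
  have hi1 : 0 < q₁⁻¹ := by positivity
  have hi2 : 0 < q₂⁻¹ := by positivity
  have hq2' : 2 ≤ q₂ := by
    have : q₂⁻¹ ≤ r⁻¹ := by linarith
    exact hr.trans ((inv_le_inv₀ hq₂ hr0).1 this)
  have hq1' : 2 ≤ q₁ := by
    have : q₁⁻¹ ≤ r⁻¹ := by linarith
    exact hr.trans ((inv_le_inv₀ hq₁ hr0).1 this)
  obtain ⟨ι, f, hf⟩ := exists_singularBasis hq₁ hx
  have key : frameSum r (x * y) ≤ frameSum q₁ x ^ (r / q₁) * frameSum q₂ y ^ (r / q₂) := by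
    refine frameSum_le fun s hs => ?_
    -- The matrix |⟨f_k, y e⟩|² has row sums ‖y e‖² and column sums at most ‖y⋆f_k‖². Invariance of
    -- the frame sum under the adjoint bounds both by the frame sum of y.
    have h1 := ENNReal.tsum_rpow_tsum_mul_le_of_marginals
      (fun (e : s) k => ‖inner ℂ (f k) (y (e : H))‖ₑ ^ 2) (fun k => ‖x (f k)‖ₑ ^ 2)
      (x := 2 / q₁) (y := 2 / q₂) (c := r / 2) (X := frameSum q₁ x) (Y := frameSum q₂ y)
      (by linarith) (by positivity) (by positivity)
      (by rw [inv_div, div_eq_mul_inv, h]; ring)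
      (by
        simp only [inv_div, ← enorm_rpow_eq_sq_rpow]
        exact f.orthonormal.tsum_le_frameSum)
      (by
        simp only [inv_div, f.tsum_enorm_inner_sq, ← enorm_rpow_eq_sq_rpow]
        exact hs.tsum_le_frameSum)
      (by
        rw [← frameSum_star hq2']
        refine le_trans (ENNReal.tsum_le_tsum fun k => ?_) f.orthonormal.tsum_le_frameSum
        rw [enorm_rpow_eq_sq_rpow, inv_div]
        gcongr
        refine le_trans (le_of_eq ?_) (hs.tsum_enorm_inner_sq_le (star y (f k)))
        refine tsum_congr fun e => ?_
        rw [inner_star_apply_right, enorm_inner_comm])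
    simp only [← hf.enorm_apply_sq, ← enorm_rpow_eq_sq_rpow] at h1
    rw [tsum_fintype, Finset.univ_eq_attach, Finset.sum_attach s (fun e => ‖x (y e)‖ₑ ^ r)] at h1
    refine h1.trans (le_of_eq ?_)
    congr 2 <;> ring
  calc frameNorm r (x * y) ≤ (frameSum q₁ x ^ (r / q₁) * frameSum q₂ y ^ (r / q₂)) ^ r⁻¹ :=
        ENNReal.rpow_le_rpow key (by positivity)
    _ = _ := by
      rw [ENNReal.mul_rpow_of_nonneg _ _ (by positivity), ← ENNReal.rpow_mul, ← ENNReal.rpow_mul,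
        frameNorm, frameNorm]
      congr 2 <;> field_simp

end SingularBasis

/-! ### The Schatten norm as a frame norm -/

section SchattenFrame

universe u

variable {H : Type u} [NormedAddCommGroup H] [InnerProductSpace ℂ H] [CompleteSpace H]

theorem pow_tangent_le {x t : ℝ} (hx : 0 ≤ x) (ht : 0 ≤ t) (n : ℕ) :
    t ^ (n + 1) + (n + 1) * t ^ n * (x - t) ≤ x ^ (n + 1) := by
  induction n with
  | zero => simp
  | succ n ih =>
    have h1 := mul_le_mul_of_nonneg_left ih hx
    have h2 : 0 ≤ (n + 1) * t ^ n * (x - t) ^ 2 := by positivity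
    push_cast
    calc _ = x * (t ^ (n + 1) + (n + 1) * t ^ n * (x - t)) - (n + 1) * t ^ n * (x - t) ^ 2 := by
          ring
      _ ≤ x * x ^ (n + 1) := by linarith
      _ = _ := by ring

/-- Jensen's inequality for the spectral measure of T at e: the tangent line of x^{n+1} at t = ⟨e, T
e⟩ is carried to operators by the functional calculus, and its linear part has expectation zero. -/
theorem re_inner_pow_le {T : H →L[ℂ] H} (hT : 0 ≤ T) {e : H} (he : ‖e‖ = 1) (n : ℕ) :
    (inner ℂ e (T e)).re ^ (n + 1) ≤ (inner ℂ e ((T ^ (n + 1)) e)).re := by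
  set t : ℝ := (inner ℂ e (T e)).re with ht
  have hsa : IsSelfAdjoint T := IsSelfAdjoint.of_nonneg hT
  have ht0 : 0 ≤ t := by
    have := (ContinuousLinearMap.nonneg_iff_isPositive T).1 hT
    have := this.re_inner_nonneg_right e
    simpa using this
  have h1 : (0 : H →L[ℂ] H) ≤ cfc (fun x : ℝ => x ^ (n + 1) -
      (t ^ (n + 1) + (n + 1) * t ^ n * (x - t))) T := by
    refine cfc_nonneg fun x hx => ?_
    have hx0 : 0 ≤ x := spectrum_nonneg_of_nonneg hT hx
    linarith [pow_tangent_le hx0 ht0 n]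
  have h2 : cfc (fun x : ℝ => x ^ (n + 1) - (t ^ (n + 1) + (n + 1) * t ^ n * (x - t))) T =
      T ^ (n + 1) - (algebraMap ℝ _ (t ^ (n + 1)) +
        ((n + 1) * t ^ n : ℝ) • (T - algebraMap ℝ _ t)) := by
    rw [cfc_sub (fun x : ℝ => x ^ (n + 1)) _ T, cfc_pow_id T (n + 1), cfc_add .., cfc_const ..,
      cfc_const_mul .., cfc_sub .., cfc_id' ℝ T, cfc_const ..]
  rw [h2, ContinuousLinearMap.nonneg_iff_isPositive] at h1
  have h3 := h1.re_inner_nonneg_right e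
  have h4 : ∀ c : ℝ, (algebraMap ℝ (H →L[ℂ] H) c) e = (c : ℂ) • e := fun c => by
    rw [Algebra.algebraMap_eq_smul_one]; simp
  have h5 : inner ℂ e e = (1 : ℂ) := by rw [inner_self_eq_norm_sq_to_K, he]; simp
  have h6 : (inner ℂ e ((T ^ (n + 1) - (algebraMap ℝ _ (t ^ (n + 1)) +
        ((n + 1) * t ^ n : ℝ) • (T - algebraMap ℝ _ t))) e)).re =
      (inner ℂ e ((T ^ (n + 1)) e)).re - t ^ (n + 1) := by
    have h7 : ∀ (S : H →L[ℂ] H) (c d : ℝ), (S - (algebraMap ℝ _ c +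
        d • (T - algebraMap ℝ _ t))) e = S e -
        ((c : ℂ) • e + (d : ℂ) • (T e - (t : ℂ) • e)) := fun S c d => by
      simp [h4]
    rw [h7, inner_sub_right, inner_add_right, inner_smul_right, inner_smul_right,
      inner_sub_right, inner_smul_right, h5, Complex.sub_re, Complex.add_re, Complex.re_ofReal_mul,
      Complex.re_ofReal_mul, Complex.sub_re, Complex.re_ofReal_mul, ← ht]
    simp
  have h8 : 0 ≤ (inner ℂ e ((T ^ (n + 1)) e)).re - t ^ (n + 1) := by
    rw [← h6]; exact h3
  linarith

theorem cfcAbs_pow_two_mul (x : H →L[ℂ] H) (m : ℕ) :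
    CFC.abs x ^ (2 * m) = (star x * x) ^ m := by
  rw [pow_mul, sq, CFC.abs_mul_abs]

theorem re_inner_star_mul_self (x : H →L[ℂ] H) (e : H) :
    (inner ℂ e ((star x * x) e)).re = ‖x e‖ ^ 2 := by
  have : (star x * x) e = star x (x e) := rfl
  rw [this, inner_star_apply_right, inner_self_eq_norm_sq_to_K]
  simp [← Complex.ofReal_pow]

/-- Evenness of the exponent makes |x|^{2(m+1)} a power of x⋆x. If the frame sum is finite, a
singular basis diagonalises that power and bounds the trace from above. Conversely, a finite
orthonormal set extends to a Hilbert basis, where `re_inner_pow_le` bounds each summand. -/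
theorem opTrace_cfcAbs_pow (x : H →L[ℂ] H) (m : ℕ) :
    opTrace (CFC.abs x ^ (2 * (m + 1))) = frameSum (2 * (m + 1) : ℕ) x := by
  have hT : 0 ≤ star x * x := star_mul_self_nonneg x
  have hTm : 0 ≤ (star x * x) ^ (m + 1) := by
    rw [← cfcAbs_pow_two_mul, pow_mul', sq]
    exact (IsSelfAdjoint.of_nonneg (CFC.abs_nonneg x)).pow (m + 1) |>.mul_self_nonneg
  rw [cfcAbs_pow_two_mul]
  have hcoe : ∀ r : ℝ, 0 ≤ r → ENNReal.ofReal ((r ^ 2) ^ (m + 1)) =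
      ENNReal.ofReal r ^ ((2 * (m + 1) : ℕ) : ℝ) := fun r hr => by
    rw [← pow_mul, ENNReal.ofReal_pow hr, ENNReal.rpow_natCast]
  refine le_antisymm ?_ (frameSum_le fun s hs => ?_)
  · by_cases hx : frameSum (2 * (m + 1) : ℕ) x < ∞
    · obtain ⟨ι, b, hb⟩ := exists_singularBasis (by positivity)
        ((frameSum_lt_top_iff (by positivity)).1 hx)
      rw [opTrace_eq b hTm]
      refine le_trans (le_of_eq (tsum_congr fun i => ?_)) b.orthonormal.tsum_le_frameSum
      have h1 : ∀ k : ℕ, ((star x * x) ^ k) (b i) = ((((‖x (b i)‖ ^ 2) ^ k : ℝ)) : ℂ) • b i := by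
        intro k
        induction k with
        | zero => simp
        | succ k ih =>
          have : ((star x * x) ^ (k + 1)) (b i) = ((star x * x) ^ k) (star x (x (b i))) := by
            rw [pow_succ]; rfl
          rw [this, hb i, map_smul, ih, smul_smul, ← Complex.ofReal_mul, mul_comm,
            ← pow_succ]
      have h2 : inner ℂ (b i) (b i) = (1 : ℂ) := by
        rw [inner_self_eq_norm_sq_to_K, b.orthonormal.1 i]; simp
      rw [h1, inner_smul_right, h2, mul_one, Complex.ofReal_re, ← ofReal_norm,
        ← hcoe _ (norm_nonneg _)]
    · rw [not_lt_top_iff.1 hx]; exact le_top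
  · obtain ⟨w, b, hsw, hb⟩ := Orthonormal.exists_hilbertBasis_extension (s := (s : Set H)) hs
    rw [opTrace_eq b hTm]
    calc ∑ e ∈ s, ‖x e‖ₑ ^ ((2 * (m + 1) : ℕ) : ℝ)
        ≤ ∑ e ∈ s, ENNReal.ofReal (inner ℂ e (((star x * x) ^ (m + 1)) e)).re := by
          refine Finset.sum_le_sum fun e he => ?_
          rw [← ofReal_norm, ← hcoe _ (norm_nonneg _), ← re_inner_star_mul_self]
          exact ENNReal.ofReal_le_ofReal (re_inner_pow_le hT (hs.1 ⟨e, he⟩) m)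
      _ = ∑ e ∈ s.attach, ENNReal.ofReal (inner ℂ (b ⟨e, hsw e.2⟩)
            (((star x * x) ^ (m + 1)) (b ⟨e, hsw e.2⟩))).re := by
          rw [← Finset.sum_attach]
          refine Finset.sum_congr rfl fun e _ => ?_
          rw [hb]
      _ ≤ _ := by
          have hinj : Function.Injective (fun e : s => (⟨e, hsw e.2⟩ : w)) :=
            fun a c h => Subtype.ext (by simpa using h)
          have := ENNReal.sum_le_tsum (f := fun i => ENNReal.ofReal (inner ℂ (b i)
            (((star x * x) ^ (m + 1)) (b i))).re) (s.attach.map ⟨_, hinj⟩)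
          simpa using this

theorem eSchattenNorm_eq_frameNorm {p : ℕ} (hp : Even p) (hp0 : 0 < p) (x : H →L[ℂ] H) :
    eSchattenNorm p x = frameNorm p x := by
  obtain ⟨k, hk⟩ := hp
  obtain ⟨m, rfl⟩ : ∃ m, p = 2 * (m + 1) := ⟨k - 1, by omega⟩
  rw [eSchattenNorm, opTrace_cfcAbs_pow, frameNorm, one_div]

end SchattenFrame

/-! ### The logarithm of a unitary operator -/

section UnitaryLog

universe u

variable {H : Type u} [NormedAddCommGroup H] [InnerProductSpace ℂ H]

theorem isClosed_frameNorm_le {q : ℝ} (hq : 0 < q) (C : ℝ≥0∞) :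
    IsClosed {x : H →L[ℂ] H | frameNorm q x ≤ C} := by
  have : {x : H →L[ℂ] H | frameNorm q x ≤ C} =
      ⋂ (s : Finset H) (_ : Orthonormal ℂ ((↑) : s → H)),
        {x : H →L[ℂ] H | ∑ e ∈ s, ‖x e‖ₑ ^ q ≤ C ^ q} := by
    ext x
    simp only [mem_ofPred_eq, mem_iInter, frameNorm, ENNReal.rpow_inv_le_iff hq, frameSum,
      iSup_le_iff]
  rw [this]
  refine isClosed_iInter fun s => isClosed_iInter fun _ => ?_
  refine isClosed_le ?_ continuous_const
  refine continuous_finsetSum _ fun e _ => ?_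
  exact ENNReal.continuous_rpow_const.comp (ContinuousLinearMap.apply ℂ H e).continuous.enorm

theorem convex_frameNorm_le {q : ℝ} (hq : 1 ≤ q) (C : ℝ≥0∞) :
    Convex ℝ {x : H →L[ℂ] H | frameNorm q x ≤ C} := by
  have hq0 : 0 < q := by linarith
  intro x hx y hy a b ha hb hab
  have h1 : ‖a‖ₑ + ‖b‖ₑ = 1 := by
    rw [Real.enorm_of_nonneg ha, Real.enorm_of_nonneg hb, ← ENNReal.ofReal_add ha hb, hab]; simp
  calc frameNorm q (a • x + b • y) ≤ ‖a‖ₑ * frameNorm q x + ‖b‖ₑ * frameNorm q y :=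
        (frameNorm_add_le hq).trans (add_le_add (frameNorm_real_smul_le hq0 a)
          (frameNorm_real_smul_le hq0 b))
    _ ≤ ‖a‖ₑ * C + ‖b‖ₑ * C := by gcongr <;> assumption
    _ = C := by rw [← add_mul, h1, one_mul]

theorem Convex.intervalIntegral_mem {E : Type*} [NormedAddCommGroup E] [NormedSpace ℝ E]
    [CompleteSpace E] {s : Set E} (hs : Convex ℝ s) (hc : IsClosed s) {F : ℝ → E}
    (hF : ContinuousOn F (Icc 0 1)) (h : ∀ t ∈ Icc (0 : ℝ) 1, F t ∈ s) :
    ∫ t in (0 : ℝ)..1, F t ∈ s := by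
  have : MeasureTheory.IsProbabilityMeasure
      ((MeasureTheory.volume : MeasureTheory.Measure ℝ).restrict (Ioc 0 1)) := ⟨by simp⟩
  rw [intervalIntegral.integral_of_le zero_le_one]
  exact hs.integral_mem hc (MeasureTheory.ae_restrict_of_forall_mem measurableSet_Ioc
    fun t ht => h t (Ioc_subset_Icc_self ht)) (hF.integrableOn_Icc.mono_set Ioc_subset_Icc_self)

/-- Frame-norm balls are convex and closed in operator norm, the frame norm being a supremum of
operator-norm continuous functions. So an operator-norm integral stays in the ball, with no
continuity of the integrand in the frame norm. -/
theorem frameNorm_integral_le [CompleteSpace H] {q : ℝ} (hq : 1 ≤ q) {C : ℝ≥0∞}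
    {F : ℝ → H →L[ℂ] H} (hF : ContinuousOn F (Icc 0 1))
    (h : ∀ t ∈ Icc (0 : ℝ) 1, frameNorm q (F t) ≤ C) :
    frameNorm q (∫ t in (0 : ℝ)..1, F t) ≤ C := by
  have h1 := (convex_frameNorm_le (H := H) hq C).intervalIntegral_mem
    (isClosed_frameNorm_le (by linarith) C) hF h
  exact h1

theorem exp_apply_of_apply_eq_smul [CompleteSpace H] {T : H →L[ℂ] H} {μ : ℂ} {x : H}
    (h : T x = μ • x) : NormedSpace.exp T x = Complex.exp μ • x := by
  have h1 : ∀ n : ℕ, (T ^ n) x = μ ^ n • x := by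
    intro n
    induction n with
    | zero => simp
    | succ n ih =>
      have : (T ^ (n + 1)) x = (T ^ n) (T x) := by rw [pow_succ]; rfl
      rw [this, h, map_smul, ih, smul_smul, pow_succ']
  have h2 := (NormedSpace.exp_series_hasSum_exp' (𝕂 := ℂ) T).mapL (ContinuousLinearMap.apply ℂ H x)
  have h3 := (NormedSpace.exp_series_hasSum_exp' (𝕂 := ℂ) μ).smul_const x
  rw [Complex.exp_eq_exp_ℂ]
  refine h2.unique ?_
  convert h3 using 2 with n
  simp [h1, smul_smul]

variable [CompleteSpace H]

/-- The resolvent `(1 + t (v - 1))⁻¹`. -/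
noncomputable def segmentResolvent (v : H →L[ℂ] H) (t : ℝ) : H →L[ℂ] H :=
  cfc (fun z : ℂ => (1 + (t : ℂ) * (z - 1))⁻¹) v

/-- The self-adjoint operator `h` with `unitaryLog v = i h`. -/
noncomputable def unitaryArg (v : H →L[ℂ] H) : H →L[ℂ] H := cfc (fun z : ℂ => (z.arg : ℂ)) v

variable {v v' : H →L[ℂ] H}

theorem one_add_mul_ne_zero_of_mem_slitPlane {z : ℂ} (hz : z ∈ Complex.slitPlane) {t : ℝ}
    (ht : t ∈ Icc (0 : ℝ) 1) : 1 + (t : ℂ) * (z - 1) ≠ 0 := by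
  refine Complex.slitPlane_ne_zero ?_
  have := StarConvex.add_smul_mem Complex.starConvex_one_slitPlane (y := z - 1)
    (by simpa using hz) ht.1 ht.2
  simpa using this

theorem spectrum_subset_slitPlane (hv : v ∈ unitary (H →L[ℂ] H)) (h2 : ‖v - 1‖ < 2) :
    spectrum ℂ v ⊆ Complex.slitPlane :=
  (Unitary.spectrum_subset_slitPlane_iff_norm_lt_two hv).2 h2

theorem isStarNormal_of_unitary (hv : v ∈ unitary (H →L[ℂ] H)) : IsStarNormal v :=
  ⟨by rw [commute_iff_eq, (Unitary.mem_iff.1 hv).1, (Unitary.mem_iff.1 hv).2]⟩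

theorem continuousOn_segmentResolvent_aux (hv : v ∈ unitary (H →L[ℂ] H)) (h2 : ‖v - 1‖ < 2) {t : ℝ}
    (ht : t ∈ Icc (0 : ℝ) 1) :
    ContinuousOn (fun z : ℂ => (1 + (t : ℂ) * (z - 1))⁻¹) (spectrum ℂ v) :=
  ContinuousOn.inv₀ (by fun_prop) fun z hz =>
    one_add_mul_ne_zero_of_mem_slitPlane (spectrum_subset_slitPlane hv h2 hz) ht

theorem cfc_one_add_mul (hv : v ∈ unitary (H →L[ℂ] H)) (t : ℝ) :
    cfc (fun z : ℂ => 1 + (t : ℂ) * (z - 1)) v = 1 + (t : ℂ) • (v - 1) := by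
  have := isStarNormal_of_unitary hv
  rw [cfc_add .., cfc_const_mul .., cfc_sub .., cfc_id' ℂ v, cfc_const ..]
  simp

theorem segmentResolvent_mul (hv : v ∈ unitary (H →L[ℂ] H)) (h2 : ‖v - 1‖ < 2) {t : ℝ}
    (ht : t ∈ Icc (0 : ℝ) 1) : segmentResolvent v t * (1 + (t : ℂ) • (v - 1)) = 1 := by
  have := isStarNormal_of_unitary hv
  rw [← cfc_one_add_mul hv, segmentResolvent,
    ← cfc_mul _ _ v (continuousOn_segmentResolvent_aux hv h2 ht) (by fun_prop), ← cfc_one ℂ v]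
  refine cfc_congr fun z hz => ?_
  exact inv_mul_cancel₀ (one_add_mul_ne_zero_of_mem_slitPlane (spectrum_subset_slitPlane hv h2 hz) ht)

theorem mul_segmentResolvent (hv : v ∈ unitary (H →L[ℂ] H)) (h2 : ‖v - 1‖ < 2) {t : ℝ}
    (ht : t ∈ Icc (0 : ℝ) 1) : (1 + (t : ℂ) • (v - 1)) * segmentResolvent v t = 1 := by
  have := isStarNormal_of_unitary hv
  rw [← cfc_one_add_mul hv, segmentResolvent,
    ← cfc_mul _ _ v (by fun_prop) (continuousOn_segmentResolvent_aux hv h2 ht), ← cfc_one ℂ v]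
  refine cfc_congr fun z hz => ?_
  exact mul_inv_cancel₀ (one_add_mul_ne_zero_of_mem_slitPlane (spectrum_subset_slitPlane hv h2 hz) ht)

/-- The bound `(1 - (r / 2)²)^(-1/2)` of the resolvents, where `r = ‖v - 1‖`. -/
noncomputable def segmentBound (r : ℝ) : ℝ := (Real.sqrt (1 - (r / 2) ^ 2))⁻¹

theorem segmentBound_nonneg (r : ℝ) : 0 ≤ segmentBound r := by unfold segmentBound; positivity

/-- On the chord from 1 to z with |z| = 1 one has |1 + t(z-1)|² = 1 - 2t(1-t)(1 - Re z). The bound 1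
- r²/4 follows from t(1-t) ≤ 1/4 and 2(1 - Re z) ≤ ‖v - 1‖². -/
theorem norm_segmentResolvent_le (hv : v ∈ unitary (H →L[ℂ] H)) {r : ℝ} (hr : ‖v - 1‖ ≤ r)
    (h2 : r < 2) {t : ℝ} (ht : t ∈ Icc (0 : ℝ) 1) :
    ‖segmentResolvent v t‖ ≤ segmentBound r := by
  have hr0 : 0 ≤ r := (norm_nonneg _).trans hr
  refine norm_cfc_le (segmentBound_nonneg r) fun z hz => ?_
  have h1 := Unitary.two_mul_one_sub_le_norm_sub_one_sq hv hz
  have hz1 : ‖z‖ = 1 := spectrum.norm_eq_one_of_unitary hv hz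
  have hz2 : z.re ^ 2 + z.im ^ 2 = 1 := by
    have := Complex.sq_norm z
    rw [hz1, Complex.normSq_apply] at this
    nlinarith
  have h3 : ‖v - 1‖ ^ 2 ≤ r ^ 2 := by gcongr
  rw [norm_inv, segmentBound]
  have h4 : 0 < 1 - (r / 2) ^ 2 := by nlinarith
  have h5 : 0 < Real.sqrt (1 - (r / 2) ^ 2) := Real.sqrt_pos.2 h4
  gcongr
  refine Real.sqrt_le_iff.2 ⟨norm_nonneg _, ?_⟩
  rw [Complex.sq_norm, Complex.normSq_apply]
  simp only [Complex.add_re, Complex.one_re, Complex.mul_re, Complex.ofReal_re, Complex.sub_re,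
    Complex.ofReal_im, Complex.sub_im, Complex.one_im, Complex.add_im, Complex.mul_im]
  have h6 : t * (1 - t) * (2 * (1 - z.re)) ≤ 1 / 4 * r ^ 2 := by
    have h7 : 0 ≤ t * (1 - t) := mul_nonneg ht.1 (sub_nonneg.2 ht.2)
    have h8 : t * (1 - t) ≤ 1 / 4 := by nlinarith [sq_nonneg (t - 1 / 2)]
    have h9 : 0 ≤ r ^ 2 := sq_nonneg r
    calc _ ≤ t * (1 - t) * r ^ 2 := by gcongr; exact h1.trans h3
      _ ≤ _ := by gcongr
  linear_combination h6 - t ^ 2 * hz2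

theorem segmentResolvent_sub (hv : v ∈ unitary (H →L[ℂ] H)) (h2 : ‖v - 1‖ < 2) {s t : ℝ}
    (hs : s ∈ Icc (0 : ℝ) 1) (ht : t ∈ Icc (0 : ℝ) 1) :
    segmentResolvent v t - segmentResolvent v s =
      ((s - t : ℝ) : ℂ) • (segmentResolvent v t * (v - 1) * segmentResolvent v s) := by
  have h3 := segmentResolvent_mul hv h2 ht
  have h4 := mul_segmentResolvent hv h2 hs
  calc segmentResolvent v t - segmentResolvent v s
      = segmentResolvent v t * ((1 + (s : ℂ) • (v - 1)) * segmentResolvent v s) -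
        (segmentResolvent v t * (1 + (t : ℂ) • (v - 1))) * segmentResolvent v s := by
        rw [h3, h4, mul_one, one_mul]
    _ = segmentResolvent v t * ((((s - t : ℝ) : ℂ) • (v - 1))) * segmentResolvent v s := by
        rw [mul_assoc, ← mul_sub, ← sub_mul, ← mul_assoc]
        congr 2
        push_cast
        rw [sub_smul]; abel
    _ = _ := by rw [mul_smul_comm, smul_mul_assoc]

theorem continuousOn_segmentResolvent (hv : v ∈ unitary (H →L[ℂ] H)) (h2 : ‖v - 1‖ < 2) :
    ContinuousOn (segmentResolvent v) (Icc 0 1) := by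
  have : LipschitzOnWith (Real.toNNReal (segmentBound ‖v - 1‖ * ‖v - 1‖ * segmentBound ‖v - 1‖))
      (segmentResolvent v) (Icc 0 1) := by
    refine LipschitzOnWith.of_dist_le_mul fun t ht s hs => ?_
    have hb := segmentBound_nonneg ‖v - 1‖
    rw [dist_eq_norm, segmentResolvent_sub hv h2 hs ht, norm_smul, Real.coe_toNNReal _ (by positivity),
      Complex.norm_real, dist_comm, Real.dist_eq, Real.norm_eq_abs, mul_comm]
    gcongr
    refine (norm_mul_le _ _).trans ?_
    gcongr
    · refine (norm_mul_le _ _).trans ?_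
      gcongr
      exact norm_segmentResolvent_le hv le_rfl h2 ht
    · exact norm_segmentResolvent_le hv le_rfl h2 hs
  exact this.continuousOn

/-- The formula log(1+w) = ∫₀¹ w/(1+tw) dt is passed through the functional calculus. It reduces
perturbation of the logarithm to the resolvent identity. -/
theorem unitaryLog_eq_integral (hv : v ∈ unitary (H →L[ℂ] H)) (h2 : ‖v - 1‖ < 2) :
    unitaryLog v = ∫ t in (0 : ℝ)..1, (v - 1) * segmentResolvent v t := by
  have := isStarNormal_of_unitary hv
  have hsp := spectrum_subset_slitPlane hv h2
  have h1 : ∀ t ∈ Icc (0 : ℝ) 1, (v - 1) * segmentResolvent v t =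
      cfc (fun z : ℂ => (z - 1) * (1 + (t : ℂ) * (z - 1))⁻¹) v := fun t ht => by
    rw [cfc_mul _ _ v (by fun_prop) (continuousOn_segmentResolvent_aux hv h2 ht), cfc_sub ..,
      cfc_id' ℂ v, cfc_const .., segmentResolvent]
    simp
  have hcont : ContinuousOn (Function.uncurry fun (t : ℝ) (z : ℂ) =>
      (z - 1) * (1 + (t : ℂ) * (z - 1))⁻¹) (Icc 0 1 ×ˢ spectrum ℂ v) := by
    refine ContinuousOn.mul (by fun_prop) (ContinuousOn.inv₀ (by fun_prop) ?_)
    rintro ⟨t, z⟩ ⟨ht, hz⟩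
    exact one_add_mul_ne_zero_of_mem_slitPlane (hsp hz) ht
  obtain ⟨C, hC⟩ := ((isCompact_Icc.prod (spectrum.isCompact v)).exists_bound_of_continuousOn hcont)
  rw [intervalIntegral.integral_of_le zero_le_one, ← MeasureTheory.integral_Icc_eq_integral_Ioc,
    MeasureTheory.setIntegral_congr_fun measurableSet_Icc h1,
    ← cfc_setIntegral measurableSet_Icc _ (fun _ => C) v hcont]
  · refine cfc_congr fun z hz => ?_
    have h3 := Complex.log_eq_integral (z := z - 1) (by simpa using hsp hz)
    rw [add_sub_cancel] at h3
    rw [h3, MeasureTheory.integral_const_mul, MeasureTheory.integral_Icc_eq_integral_Ioc,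
      intervalIntegral.integral_of_le zero_le_one]
    simp
  · exact MeasureTheory.ae_restrict_of_forall_mem measurableSet_Icc fun t ht z hz => hC (t, z) ⟨ht, hz⟩
  · exact (MeasureTheory.integrable_const C).2

/-- Under the integral, (v'-1)R' - (v-1)R = R'(v'-v)R because R and R' invert 1 + t(v-1) and 1 +
t(v'-1). The difference v' - v appears once, between bounded factors, so Schatten norms can be
estimated. -/
theorem unitaryLog_sub_unitaryLog (hv : v ∈ unitary (H →L[ℂ] H)) (h2 : ‖v - 1‖ < 2)
    (hv' : v' ∈ unitary (H →L[ℂ] H)) (h2' : ‖v' - 1‖ < 2) :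
    unitaryLog v' - unitaryLog v =
      ∫ t in (0 : ℝ)..1, segmentResolvent v' t * (v' - v) * segmentResolvent v t := by
  have hi : ∀ {v : H →L[ℂ] H}, v ∈ unitary (H →L[ℂ] H) → ‖v - 1‖ < 2 →
      IntervalIntegrable (fun t => (v - 1) * segmentResolvent v t) MeasureTheory.volume 0 1 :=
    fun hv h2 => by
      refine ContinuousOn.intervalIntegrable ?_
      rw [uIcc_of_le zero_le_one]
      exact continuousOn_const.mul (continuousOn_segmentResolvent hv h2)
  rw [unitaryLog_eq_integral hv h2, unitaryLog_eq_integral hv' h2',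
    ← intervalIntegral.integral_sub (hi hv' h2') (hi hv h2)]
  refine intervalIntegral.integral_congr fun t ht => ?_
  rw [uIcc_of_le zero_le_one] at ht
  have h3 := segmentResolvent_mul hv' h2' ht
  have h3' := mul_segmentResolvent hv' h2' ht
  have h4 := mul_segmentResolvent hv h2 ht
  have hcomm : (v' - 1) * segmentResolvent v' t = segmentResolvent v' t * (v' - 1) := by
    calc (v' - 1) * segmentResolvent v' t
        = segmentResolvent v' t * ((1 + (t : ℂ) • (v' - 1)) * (v' - 1)) * segmentResolvent v' t := by
          rw [← mul_assoc, h3, one_mul]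
      _ = segmentResolvent v' t * (v' - 1) * ((1 + (t : ℂ) • (v' - 1)) * segmentResolvent v' t) := by
          have : (1 + (t : ℂ) • (v' - 1)) * (v' - 1) = (v' - 1) * (1 + (t : ℂ) • (v' - 1)) := by
            rw [add_mul, mul_add, smul_mul_assoc, mul_smul_comm, one_mul, mul_one]
          rw [this]; simp only [mul_assoc]
      _ = _ := by rw [h3', mul_one]
  have h5 : v' - v = (v' - 1) * (1 + (t : ℂ) • (v - 1)) - (1 + (t : ℂ) • (v' - 1)) * (v - 1) := by
    simp only [mul_add, add_mul, mul_one, one_mul, mul_smul_comm, smul_mul_assoc]; abel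
  have h6 : ∀ a b c d e f : H →L[ℂ] H, a * (b * c - d * e) * f = a * b * (c * f) - a * d * (e * f) :=
    fun a b c d e f => by simp only [mul_sub, sub_mul, mul_assoc]
  change (v' - 1) * segmentResolvent v' t - (v - 1) * segmentResolvent v t = _
  rw [h5, h6, h3, h4, hcomm, mul_one, one_mul]

theorem unitaryLog_one : unitaryLog (1 : H →L[ℂ] H) = 0 := by
  have h0 : ‖(1 : H →L[ℂ] H) - 1‖ < 2 := by simp
  rw [unitaryLog_eq_integral (one_mem _) h0]
  simp

/-- The logarithm is compared with log 1 = 0 in the difference formula, whose resolvents at 1 are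
trivial. -/
theorem frameNorm_unitaryLog_lt_top {q : ℝ} (hq : 1 ≤ q) (hv : v ∈ unitary (H →L[ℂ] H))
    (h2 : ‖v - 1‖ < 2) (hf : frameNorm q (v - 1) < ∞) : frameNorm q (unitaryLog v) < ∞ := by
  have h0 : ‖(1 : H →L[ℂ] H) - 1‖ < 2 := by simp
  have h1 := unitaryLog_sub_unitaryLog (one_mem _) h0 hv h2
  have h3 : ∀ t ∈ Icc (0 : ℝ) 1, segmentResolvent (1 : H →L[ℂ] H) t = 1 := fun t ht => by
    simpa using segmentResolvent_mul (one_mem _) h0 ht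
  rw [unitaryLog_one, sub_zero] at h1
  rw [h1]
  have hb : frameNorm q (∫ t in (0 : ℝ)..1, segmentResolvent v t * (v - 1) *
      segmentResolvent (1 : H →L[ℂ] H) t) ≤
      ENNReal.ofReal (segmentBound ‖v - 1‖) * frameNorm q (v - 1) := by
    refine frameNorm_integral_le hq (((continuousOn_segmentResolvent hv h2).mul
      continuousOn_const).mul (continuousOn_segmentResolvent (one_mem _) h0)) fun t ht => ?_
    rw [h3 t ht, mul_one]
    refine (frameNorm_mul_le (by linarith)).trans ?_
    gcongr
    rw [← ofReal_norm]
    exact ENNReal.ofReal_le_ofReal (norm_segmentResolvent_le hv le_rfl h2 ht)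
  exact hb.trans_lt (ENNReal.mul_lt_top ENNReal.ofReal_lt_top hf)

theorem isSelfAdjoint_unitaryArg (v : H →L[ℂ] H) : IsSelfAdjoint (unitaryArg v) :=
  IsSelfAdjoint.cfc_arg v

theorem unitaryLog_eq_I_smul (hv : v ∈ unitary (H →L[ℂ] H)) (h2 : ‖v - 1‖ < 2) :
    unitaryLog v = Complex.I • unitaryArg v := by
  have := isStarNormal_of_unitary hv
  have hsp := spectrum_subset_slitPlane hv h2
  have hc : ContinuousOn (fun z : ℂ => (z.arg : ℂ)) (spectrum ℂ v) :=
    Complex.continuous_ofReal.comp_continuousOn (Complex.continuousOn_arg.mono hsp)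
  rw [unitaryArg, ← cfc_smul _ _ v hc]
  refine cfc_congr fun z hz => ?_
  have hz1 : ‖z‖ = 1 := spectrum.norm_eq_one_of_unitary hv hz
  exact Complex.ext (by simp [Complex.log_re, hz1]) (by simp [Complex.log_im])

theorem star_unitaryLog (hv : v ∈ unitary (H →L[ℂ] H)) (h2 : ‖v - 1‖ < 2) :
    star (unitaryLog v) = -unitaryLog v := by
  rw [unitaryLog_eq_I_smul hv h2, star_smul, (isSelfAdjoint_unitaryArg v).star_eq]
  simp

theorem exp_unitaryLog (hv : v ∈ unitary (H →L[ℂ] H)) (h2 : ‖v - 1‖ < 2) :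
    NormedSpace.exp (unitaryLog v) = v := by
  have h := congrArg Subtype.val (expUnitary_argSelfAdjoint (u := (⟨v, hv⟩ : unitary (H →L[ℂ] H))) h2)
  rw [unitaryLog_eq_I_smul hv h2]
  simpa [selfAdjoint.expUnitary_coe, unitaryArg] using h

theorem norm_unitaryArg_le_pi (hv : v ∈ unitary (H →L[ℂ] H)) : ‖unitaryArg v‖ ≤ Real.pi :=
  Unitary.norm_argSelfAdjoint_le_pi (⟨v, hv⟩ : unitary (H →L[ℂ] H))

theorem norm_sub_one_le_norm_unitaryArg (hv : v ∈ unitary (H →L[ℂ] H)) (h2 : ‖v - 1‖ < 2) :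
    ‖v - 1‖ ≤ ‖unitaryArg v‖ := by
  have h := Unitary.two_mul_one_sub_cos_norm_argSelfAdjoint (u := (⟨v, hv⟩ : unitary (H →L[ℂ] H))) h2
  have h3 : ‖Unitary.argSelfAdjoint (⟨v, hv⟩ : unitary (H →L[ℂ] H))‖ = ‖unitaryArg v‖ := rfl
  rw [h3] at h
  have h4 := Real.one_sub_sq_div_two_le_cos (x := ‖unitaryArg v‖)
  refine (sq_le_sq₀ (norm_nonneg _) (norm_nonneg _)).1 ?_
  rw [← h]; linarith

theorem frameNorm_unitaryLog {q : ℝ} (hq : 0 < q) (hv : v ∈ unitary (H →L[ℂ] H))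
    (h2 : ‖v - 1‖ < 2) : frameNorm q (unitaryLog v) = frameNorm q (unitaryArg v) :=
  frameNorm_congr hq fun x => by rw [unitaryLog_eq_I_smul hv h2]; simp [norm_smul]

theorem exists_eigenbasis_unitaryArg {q : ℝ} (hq : 1 ≤ q) (hv : v ∈ unitary (H →L[ℂ] H))
    (h2 : ‖v - 1‖ < 2) (hf : frameNorm q (v - 1) < ∞) :
    ∃ (ι : Type u) (b : HilbertBasis ι ℂ H) (l : ι → ℝ),
      (∀ i, unitaryArg v (b i) = (l i : ℂ) • b i) ∧
      (∀ i, v (b i) = Complex.exp (l i * Complex.I) • b i) ∧ ∀ i, |l i| ≤ ‖unitaryArg v‖ := by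
  have hq0 : 0 < q := by linarith
  have hfin := frameNorm_unitaryLog_lt_top hq hv h2 hf
  rw [frameNorm_unitaryLog hq0 hv h2] at hfin
  obtain ⟨ι, b, l, hl⟩ := (isSelfAdjoint_unitaryArg v).exists_eigenbasis
    (isCompactOperator_of_frameNorm_lt_top hq0 hfin)
  refine ⟨ι, b, l, hl, fun i => ?_, fun i => ?_⟩
  · have : unitaryLog v (b i) = ((l i : ℂ) * Complex.I) • b i := by
      rw [unitaryLog_eq_I_smul hv h2, smul_apply, hl, smul_smul, mul_comm]
    have h3 := exp_apply_of_apply_eq_smul this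
    rwa [exp_unitaryLog hv h2] at h3
  · have := (unitaryArg v).le_opNorm (b i)
    rw [hl, norm_smul, b.orthonormal.1 i] at this
    simpa using this

end UnitaryLog

/-! ### Comparison of the logarithms of nearby unitary operators -/

section Scalar

/-- On [0, π/2] the derivatives compare by 1 - 2y/π ≤ cos y. The rest of the interval follows from
the symmetry x ↦ π - x of both sides. -/
theorem Real.sub_sq_div_pi_le_sin {x : ℝ} (h0 : 0 ≤ x) (h1 : x ≤ Real.pi) :
    x - x ^ 2 / Real.pi ≤ Real.sin x := by
  have hpi := Real.pi_pos
  have key : ∀ y : ℝ, 0 ≤ y → y ≤ Real.pi / 2 → y - y ^ 2 / Real.pi ≤ Real.sin y := by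
    intro y hy0 hy1
    have hmono : MonotoneOn (fun y => Real.sin y - (y - y ^ 2 / Real.pi)) (Icc 0 (Real.pi / 2)) := by
      have hd : ∀ y, HasDerivAt (fun y => Real.sin y - (y - y ^ 2 / Real.pi))
          (Real.cos y - (1 - 2 * y / Real.pi)) y := fun y => by
        refine HasDerivAt.congr_deriv ((Real.hasDerivAt_sin y).sub ((hasDerivAt_id' y).sub
          (((hasDerivAt_id' y).pow 2).div_const Real.pi))) ?_
        simp
      refine monotoneOn_of_deriv_nonneg (convex_Icc _ _)
        (fun y _ => (hd y).continuousAt.continuousWithinAt)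
        (fun y _ => (hd y).differentiableAt.differentiableWithinAt) fun y hy => ?_
      rw [interior_Icc] at hy
      rw [(hd y).deriv]
      have := Real.one_sub_mul_le_cos hy.1.le hy.2.le
      have h3 : 2 / Real.pi * y = 2 * y / Real.pi := by ring
      linarith
    have := hmono (left_mem_Icc.2 (by positivity)) ⟨hy0, hy1⟩ hy0
    simp only [Real.sin_zero] at this
    simp at this
    linarith
  rcases le_total x (Real.pi / 2) with h | h
  · exact key x h0 h
  · have := key (Real.pi - x) (by linarith) (by linarith)
    rw [Real.sin_pi_sub] at this
    refine le_trans (le_of_eq ?_) this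
    field_simp
    ring

/-- Made to be averaged over μ: if θ is the argument of an average of the points e^{iμ}, the sine
terms cancel, and θ² is at most the average of μ². -/
theorem Real.sq_add_two_mul_sin_le {θ μ : ℝ} (hθ : |θ| ≤ Real.pi / 2) (hμ : |μ| ≤ Real.pi / 2) :
    θ ^ 2 + 2 * θ * Real.sin (μ - θ) ≤ μ ^ 2 := by
  have key : ∀ θ μ : ℝ, 0 ≤ θ → |θ| ≤ Real.pi / 2 → |μ| ≤ Real.pi / 2 →
      θ ^ 2 + 2 * θ * Real.sin (μ - θ) ≤ μ ^ 2 := by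
    intro θ μ h0 hθ hμ
    rw [abs_le] at hθ hμ
    rcases le_total θ μ with h | h
    · have h1 := Real.sin_le (sub_nonneg.2 h)
      have h2 := mul_le_mul_of_nonneg_left h1 h0
      nlinarith [sq_nonneg (μ - θ)]
    · have h1 := Real.sub_sq_div_pi_le_sin (x := θ - μ) (by linarith) (by linarith)
      have h2 : Real.sin (μ - θ) = - Real.sin (θ - μ) := by rw [← Real.sin_neg]; ring_nf
      have h3 := mul_le_mul_of_nonneg_left h1 h0
      have h4 : θ * ((θ - μ) ^ 2 / Real.pi) ≤ (θ - μ) ^ 2 / 2 := by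
        have : θ * ((θ - μ) ^ 2 / Real.pi) = (θ / Real.pi) * (θ - μ) ^ 2 := by ring
        rw [this]
        have h5 : θ / Real.pi ≤ 1 / 2 := by rw [div_le_iff₀ Real.pi_pos]; linarith
        nlinarith [sq_nonneg (θ - μ)]
      rw [h2]
      nlinarith
  rcases le_total 0 θ with h | h
  · exact key θ μ h hθ hμ
  · have := key (-θ) (-μ) (by linarith) (by rwa [abs_neg]) (by rwa [abs_neg])
    have h2 : Real.sin (-μ - -θ) = - Real.sin (μ - θ) := by rw [← Real.sin_neg]; ring_nf
    rw [h2] at this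
    linarith

/-- Rotating z to the positive axis turns the chord into e^{iα} - |z| with α = l - arg z, so |sin α|
is at most its length. Both |z| and cos α are near 1 or |z| respectively, so cos α > 0 and |α| <
π/2, where the sine can be inverted. -/
theorem abs_sub_arg_mul_le {l η : ℝ} (hl : |l| ≤ Real.pi) (hη : η ≤ 1 / 4) {z : ℂ} (hz : 0 < z.re)
    (h : ‖Complex.exp (l * Complex.I) - z‖ ≤ η) :
    |l - z.arg| * (1 - η ^ 2) ≤ ‖Complex.exp (l * Complex.I) - z‖ := by
  set d := ‖Complex.exp (l * Complex.I) - z‖ with hd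
  have hd0 : 0 ≤ d := norm_nonneg _
  set α := l - z.arg with hα
  have harg : |z.arg| < Real.pi / 2 := Complex.abs_arg_lt_pi_div_two_iff.2 (Or.inl hz)
  have hrot : d = ‖Complex.exp (α * Complex.I) - ‖z‖‖ := by
    have h1 : Complex.exp (l * Complex.I) - z =
        Complex.exp (z.arg * Complex.I) * (Complex.exp (α * Complex.I) - ‖z‖) := by
      rw [mul_sub, ← Complex.exp_add, mul_comm _ (‖z‖ : ℂ), Complex.norm_mul_exp_arg_mul_I]
      congr 2
      rw [hα]; push_cast; ring
    rw [hd, h1, norm_mul, Complex.norm_exp_ofReal_mul_I, one_mul]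
  have hsin : |Real.sin α| ≤ d := by
    rw [hrot]
    refine le_trans (le_of_eq ?_) (Complex.abs_im_le_norm _)
    simp [Complex.exp_ofReal_mul_I_im]
  have hcos : |Real.cos α - ‖z‖| ≤ d := by
    rw [hrot]
    refine le_trans (le_of_eq ?_) (Complex.abs_re_le_norm _)
    simp [Complex.exp_ofReal_mul_I_re]
  have hnorm : |1 - ‖z‖| ≤ d := by
    have := abs_norm_sub_norm_le (Complex.exp (l * Complex.I)) z
    rwa [Complex.norm_exp_ofReal_mul_I] at this
  have hcos0 : 0 < Real.cos α := by
    have h1 := abs_le.1 hcos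
    have h2 := abs_le.1 hnorm
    linarith
  have hα2 : |α| < Real.pi / 2 := by
    by_contra hcon
    have h1 : |α| ≤ Real.pi + Real.pi / 2 := (abs_sub _ _).trans (by linarith)
    have h2 := Real.cos_nonpos_of_pi_div_two_le_of_le (not_lt.1 hcon) h1
    rw [Real.cos_abs] at h2
    linarith
  have hsinabs : Real.sin |α| = |Real.sin α| := by
    rcases abs_cases α with ⟨h1, h2⟩ | ⟨h1, h2⟩
    · rw [h1, abs_of_nonneg (Real.sin_nonneg_of_nonneg_of_le_pi h2 (by linarith [abs_le.1 hα2.le]))]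
    · rw [h1, Real.sin_neg, abs_of_nonpos (Real.sin_nonpos_of_nonpos_of_neg_pi_le h2.le
        (by linarith [abs_le.1 hα2.le]))]
  have hjordan := Real.mul_le_sin (abs_nonneg α) hα2.le
  have hpi := Real.pi_pos
  have hpi4 := Real.pi_lt_d2
  have h4 : |α| ≤ Real.pi / 2 * η := by
    have : 2 / Real.pi * |α| ≤ η := by linarith
    calc |α| = Real.pi / 2 * (2 / Real.pi * |α|) := by field_simp
      _ ≤ _ := by gcongr
  rcases (abs_nonneg α).eq_or_lt with h0 | h0
  · rw [← h0, zero_mul]; exact hd0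
  have hη0 : 0 ≤ η := hd0.trans h
  -- Jordan's bound gives |α| ≤ (π/2)η ≤ 2η. In α - α³/4 < sin α the cubic term is therefore at most
  -- |α|η², whence the factor 1 - η².
  have h5 : |α| ≤ 2 * η := h4.trans (by nlinarith)
  have h6 := Real.sin_gt_sub_cube h0
  have h7 : |α| ^ 2 ≤ (2 * η) ^ 2 := by gcongr
  have h8 : |α| * |α| ^ 2 ≤ |α| * (2 * η) ^ 2 := by gcongr
  have h9 : 0 ≤ |α| * η ^ 2 := by positivity
  have h10 : |α| ^ 3 = |α| * |α| ^ 2 := by ring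
  linarith

end Scalar

/-! ### Diagonal matrix coefficients and the chord estimate for the logarithm -/

section Chord

universe u

variable {H : Type u} [NormedAddCommGroup H] [InnerProductSpace ℂ H]

theorem HilbertBasis.hasSum_inner_of_apply_eq_smul {ι : Type*} (b : HilbertBasis ι ℂ H)
    {T : H →L[ℂ] H} {t : ι → ℂ} (hT : ∀ i, T (b i) = t i • b i) (e : H) :
    HasSum (fun i => ((‖inner ℂ (b i) e‖ ^ 2 : ℝ) : ℂ) * t i) (inner ℂ e (T e)) := by
  have h1 := ((b.hasSum_repr e).mapL T).mapL (innerSL ℂ e)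
  rw [innerSL_apply_apply] at h1
  refine h1.congr_fun fun i => ?_
  rw [innerSL_apply_apply, map_smul, hT, inner_smul_right, inner_smul_right, b.repr_apply_apply,
    ← inner_conj_symm e (b i), mul_left_comm, Complex.mul_conj']
  push_cast
  ring

variable [CompleteSpace H] {v v' : H →L[ℂ] H}

/-- In an eigenbasis, ⟨e, v e⟩ is the average of e^{il_i} with weights |⟨bᵢ, e⟩|², which has
positive real part since |l_i| < π/2. Its argument θ makes the average of sin(l_i - θ) vanish, and
averaging `Real.sq_add_two_mul_sin_le` gives θ² ≤ ∑ |⟨bᵢ, e⟩|² l_i² = ‖h e‖², h being the argument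
of v. -/
theorem abs_arg_inner_le {q : ℝ} (hq : 1 ≤ q) (hv : v ∈ unitary (H →L[ℂ] H))
    (h2 : ‖v - 1‖ < 2) (hf : frameNorm q (v - 1) < ∞) (hpi : ‖unitaryArg v‖ < Real.pi / 2) {e : H}
    (he : ‖e‖ = 1) :
    0 < (inner ℂ e (v e)).re ∧ |(inner ℂ e (v e)).arg| ≤ ‖unitaryArg v e‖ := by
  obtain ⟨ι, b, l, hl, hvl, hle⟩ := exists_eigenbasis_unitaryArg hq hv h2 hf
  have hS := b.hasSum_inner_of_apply_eq_smul hvl e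
  have hsq : ∀ i, (unitaryArg v * unitaryArg v) (b i) = ((l i ^ 2 : ℝ) : ℂ) • b i := fun i => by
    have : (unitaryArg v * unitaryArg v) (b i) = unitaryArg v (unitaryArg v (b i)) := rfl
    rw [this, hl, map_smul, hl, smul_smul]
    push_cast; rw [sq]
  have hS2 := (b.hasSum_inner_of_apply_eq_smul hsq e).mapL Complex.reCLM
  have hS1 := (b.hasSum_inner_of_apply_eq_smul (T := 1) (t := fun _ => 1) (by simp) e).mapL
    Complex.reCLM
  set z := inner ℂ e (v e) with hz
  have e1 : Complex.reCLM (inner ℂ e ((1 : H →L[ℂ] H) e)) = 1 := by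
    have : inner ℂ e ((1 : H →L[ℂ] H) e) = (1 : ℂ) := by
      change inner ℂ e e = (1 : ℂ)
      rw [inner_self_eq_norm_sq_to_K, he]; simp
    rw [this]; simp
  have e2 : Complex.reCLM (inner ℂ e ((unitaryArg v * unitaryArg v) e)) = ‖unitaryArg v e‖ ^ 2 := by
    have : (unitaryArg v * unitaryArg v) e = star (unitaryArg v) (unitaryArg v e) := by
      rw [(isSelfAdjoint_unitaryArg v).star_eq]; rfl
    rw [this, inner_star_apply_right, inner_self_eq_norm_sq_to_K]
    simp [← Complex.ofReal_pow]
  rw [e1] at hS1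
  rw [e2] at hS2
  have e3 : ∀ i, Complex.reCLM (((‖inner ℂ (b i) e‖ ^ 2 : ℝ) : ℂ) * 1) = ‖inner ℂ (b i) e‖ ^ 2 :=
    fun i => by rw [mul_one, Complex.reCLM_apply, Complex.ofReal_re]
  have e4 : ∀ i, Complex.reCLM (((‖inner ℂ (b i) e‖ ^ 2 : ℝ) : ℂ) * ((l i ^ 2 : ℝ) : ℂ)) =
      ‖inner ℂ (b i) e‖ ^ 2 * l i ^ 2 := fun i => by
    rw [← Complex.ofReal_mul, Complex.reCLM_apply, Complex.ofReal_re]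
  simp only [e3] at hS1
  simp only [e4] at hS2
  have hre : 0 < z.re := by
    have h3 := hS.mapL Complex.reCLM
    simp only [Complex.reCLM_apply, Complex.re_ofReal_mul, Complex.exp_ofReal_mul_I_re] at h3
    have h4 : Real.cos ‖unitaryArg v‖ * 1 ≤ z.re := by
      refine hasSum_le (fun i => ?_) (hS1.mul_left (Real.cos ‖unitaryArg v‖)) h3
      rw [mul_comm]
      gcongr
      rw [← Real.cos_abs (l i)]
      exact Real.cos_le_cos_of_nonneg_of_le_pi (abs_nonneg _) (by linarith [Real.pi_pos]) (hle i)
    have h5 := Real.cos_pos_of_mem_Ioo (x := ‖unitaryArg v‖)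
      ⟨by linarith [norm_nonneg (unitaryArg v), Real.pi_pos], hpi⟩
    linarith
  refine ⟨hre, ?_⟩
  set θ := z.arg with hθ
  have hθ2 : |θ| < Real.pi / 2 := Complex.abs_arg_lt_pi_div_two_iff.2 (Or.inl hre)
  have hIm := (hS.mul_left (Complex.exp (-(θ : ℂ) * Complex.I))).mapL Complex.imCLM
  have e5 : Complex.imCLM (Complex.exp (-(θ : ℂ) * Complex.I) * z) = 0 := by
    have : Complex.exp (-(θ : ℂ) * Complex.I) * z = ‖z‖ := by
      conv_lhs => rw [← Complex.norm_mul_exp_arg_mul_I z]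
      rw [mul_left_comm, ← Complex.exp_add, ← hθ]
      simp
    rw [this]; simp
  have e6 : ∀ i, Complex.imCLM (Complex.exp (-(θ : ℂ) * Complex.I) *
      (((‖inner ℂ (b i) e‖ ^ 2 : ℝ) : ℂ) * Complex.exp (l i * Complex.I))) =
      ‖inner ℂ (b i) e‖ ^ 2 * Real.sin (l i - θ) := fun i => by
    rw [mul_left_comm, ← Complex.exp_add, Complex.imCLM_apply, Complex.im_ofReal_mul]
    have : -(θ : ℂ) * Complex.I + l i * Complex.I = ((l i - θ : ℝ) : ℂ) * Complex.I := by
      push_cast; ring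
    rw [this, Complex.exp_ofReal_mul_I_im]
  rw [e5] at hIm
  simp only [e6] at hIm
  have h6 := hasSum_le (fun i => ?_) ((hS1.mul_left (θ ^ 2)).add (hIm.mul_left (2 * θ))) hS2
  · exact abs_le_of_sq_le_sq (by linarith) (norm_nonneg _)
  · have h7 := Real.sq_add_two_mul_sin_le hθ2.le ((hle i).trans hpi.le)
    have h8 := mul_le_mul_of_nonneg_left h7 (sq_nonneg ‖inner ℂ (b i) e‖)
    linarith

/-- In an eigenbasis of v, each l_i is compared with the argument of ⟨bᵢ, v' bᵢ⟩, which is at most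
‖arg(v') bᵢ‖; Minkowski's inequality does the rest. That the constant tends to 1 with η is what
makes the length estimate sharp. -/
theorem frameNorm_unitaryArg_le_add {q : ℝ} (hq : 2 ≤ q) (hv : v ∈ unitary (H →L[ℂ] H))
    (h2 : ‖v - 1‖ < 2) (hf : frameNorm q (v - 1) < ∞) (hv' : v' ∈ unitary (H →L[ℂ] H))
    (h2' : ‖v' - 1‖ < 2) (hf' : frameNorm q (v' - 1) < ∞) (hpi : ‖unitaryArg v'‖ < Real.pi / 2)
    {η : ℝ} (hη : η ≤ 1 / 4) (hd : ‖v - v'‖ ≤ η) :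
    frameNorm q (unitaryArg v) ≤
      frameNorm q (unitaryArg v') + ENNReal.ofReal (1 - η ^ 2)⁻¹ * frameNorm q (v - v') := by
  have hq0 : 0 < q := by linarith
  have hη0 : 0 ≤ η := (norm_nonneg _).trans hd
  have hη2 : 0 < 1 - η ^ 2 := by nlinarith
  obtain ⟨ι, b, l, hl, hvl, hle⟩ := exists_eigenbasis_unitaryArg (by linarith) hv h2 hf
  have hsing := (isSelfAdjoint_unitaryArg v).isSingularBasis hl
  have key : ∀ i, ‖unitaryArg v (b i)‖ ≤ ‖unitaryArg v' (b i)‖ +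
      ‖(((1 - η ^ 2)⁻¹ : ℝ) • (v - v')) (b i)‖ := by
    intro i
    have hb := b.orthonormal.1 i
    obtain ⟨hre, harg⟩ := abs_arg_inner_le (by linarith : 1 ≤ q) hv' h2' hf' hpi hb
    have h3 : Complex.exp (l i * Complex.I) - inner ℂ (b i) (v' (b i)) =
        inner ℂ (b i) ((v - v') (b i)) := by
      rw [sub_apply, inner_sub_right, hvl, inner_smul_right, inner_self_eq_norm_sq_to_K, hb]
      simp
    have h4 : ‖Complex.exp (l i * Complex.I) - inner ℂ (b i) (v' (b i))‖ ≤ ‖(v - v') (b i)‖ := by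
      rw [h3]
      refine (norm_inner_le_norm _ _).trans ?_
      rw [hb, one_mul]
    have h5 : ‖(v - v') (b i)‖ ≤ η := by
      have := (v - v').le_opNorm (b i)
      rw [hb, mul_one] at this
      exact this.trans hd
    have h6 := abs_sub_arg_mul_le ((hle i).trans (norm_unitaryArg_le_pi hv)) hη hre (h4.trans h5)
    have h7 : ‖unitaryArg v (b i)‖ = |l i| := by rw [hl, norm_smul, hb]; simp
    have h8 : |l i| ≤ |(inner ℂ (b i) (v' (b i))).arg| + |l i - (inner ℂ (b i) (v' (b i))).arg| := by
      have := abs_add_le (inner ℂ (b i) (v' (b i))).arg (l i - (inner ℂ (b i) (v' (b i))).arg)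
      rwa [add_sub_cancel] at this
    rw [h7, smul_apply, norm_smul, Real.norm_of_nonneg (by positivity)]
    refine h8.trans (add_le_add harg ?_)
    rw [le_inv_mul_iff₀ hη2, mul_comm]
    exact h6.trans h4
  have h9 : frameNorm q (unitaryArg v) = (∑' i, ‖unitaryArg v (b i)‖ₑ ^ q) ^ (1 / q) := by
    rw [frameNorm, hsing.frameSum_eq hq, one_div]
  rw [h9]
  calc (∑' i, ‖unitaryArg v (b i)‖ₑ ^ q) ^ (1 / q)
      ≤ (∑' i, (‖unitaryArg v' (b i)‖ₑ + ‖(((1 - η ^ 2)⁻¹ : ℝ) • (v - v')) (b i)‖ₑ) ^ q) ^ (1 / q) := by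
        gcongr with i
        simp only [← ofReal_norm]
        rw [← ENNReal.ofReal_add (norm_nonneg _) (norm_nonneg _)]
        exact ENNReal.ofReal_le_ofReal (key i)
    _ ≤ _ := ENNReal.tsum_Lp_add_le _ _ (by linarith)
    _ ≤ frameNorm q (unitaryArg v') + frameNorm q (((1 - η ^ 2)⁻¹ : ℝ) • (v - v')) := by
        rw [one_div]
        exact add_le_add (b.orthonormal.tsum_rpow_le_frameNorm hq0)
          (b.orthonormal.tsum_rpow_le_frameNorm hq0)
    _ ≤ _ := by
        gcongr
        refine (frameNorm_real_smul_le hq0 _).trans (le_of_eq ?_)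
        rw [Real.enorm_of_nonneg (by positivity)]

end Chord

/-! ### Derivatives with respect to the frame norm -/

section FrameDeriv

universe u

variable {H : Type u} [NormedAddCommGroup H] [InnerProductSpace ℂ H]

/-- `A` has at `s` the derivative `A'` within `S`, with respect to the frame norm. -/
def HasFrameDerivWithin (q : ℝ) (A : ℝ → H →L[ℂ] H) (A' : H →L[ℂ] H) (S : Set ℝ) (s : ℝ) : Prop :=
  Tendsto (fun t => frameNorm q (slope A s t - A')) (𝓝[S \ {s}] s) (𝓝 0)

theorem tendsto_zero_of_frameNorm {ι : Type*} {l : Filter ι} {q : ℝ} (hq : 0 < q)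
    {F : ι → H →L[ℂ] H} (h : Tendsto (fun i => frameNorm q (F i)) l (𝓝 0)) :
    Tendsto F l (𝓝 0) := by
  rw [tendsto_zero_iff_enorm_tendsto_zero]
  exact tendsto_of_tendsto_of_tendsto_of_le_of_le tendsto_const_nhds h (fun _ => bot_le)
    fun i => enorm_le_frameNorm hq

variable {q : ℝ} {A B : ℝ → H →L[ℂ] H} {A' B' : H →L[ℂ] H} {S : Set ℝ} {s : ℝ}

theorem HasFrameDerivWithin.hasDerivWithinAt (hq : 0 < q) (h : HasFrameDerivWithin q A A' S s) :
    HasDerivWithinAt A A' S s := by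
  rw [hasDerivWithinAt_iff_tendsto_slope, tendsto_iff_norm_sub_tendsto_zero,
    ← tendsto_zero_iff_norm_tendsto_zero]
  exact tendsto_zero_of_frameNorm hq h

theorem frameNorm_lt_top_of_sub (hq : 1 ≤ q) {x y : H →L[ℂ] H} (hx : frameNorm q x < ∞)
    (hy : frameNorm q (x - y) < ∞) : frameNorm q y < ∞ := by
  have : y = x - (x - y) := by abel
  rw [this]
  exact (frameNorm_sub_le hq).trans_lt (ENNReal.add_lt_top.2 ⟨hx, hy⟩)

theorem frameNorm_slope_le (hq : 0 < q) (t : ℝ) :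
    frameNorm q (slope A s t) ≤ ‖(t - s)⁻¹‖ₑ * frameNorm q (A t - A s) := by
  rw [slope_def_module]
  exact frameNorm_real_smul_le hq _

theorem HasFrameDerivWithin.frameNorm_lt_top (hq : 1 ≤ q) [(𝓝[S \ {s}] s).NeBot]
    (h : HasFrameDerivWithin q A A' S s) (hA : ∀ t ∈ S, frameNorm q (A t - A s) < ∞) :
    frameNorm q A' < ∞ := by
  have hq0 : 0 < q := by linarith
  obtain ⟨t, ht, htS⟩ := ((h.eventually (gt_mem_nhds one_pos)).and self_mem_nhdsWithin).exists
  refine frameNorm_lt_top_of_sub hq ?_ (ht.trans ENNReal.one_lt_top)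
  exact (frameNorm_slope_le hq0 t).trans_lt
    (ENNReal.mul_lt_top (by simp [enorm]) (hA t htS.1))

theorem frameNorm_sub_le_slope (hq : 0 < q) (t : ℝ) :
    frameNorm q (A t - A s) ≤ ‖t - s‖ₑ * frameNorm q (slope A s t) := by
  have : A t - A s = (t - s) • slope A s t := (sub_smul_slope A s t).symm
  rw [this]
  exact frameNorm_real_smul_le hq _

theorem HasFrameDerivWithin.tendsto_frameNorm_sub (hq : 1 ≤ q) (h : HasFrameDerivWithin q A A' S s)
    (hA' : frameNorm q A' < ∞) :
    Tendsto (fun t => frameNorm q (A t - A s)) (𝓝[S] s) (𝓝 0) := by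
  have hq0 : 0 < q := by linarith
  have h1 : Tendsto (fun t => ‖t - s‖ₑ * (frameNorm q (slope A s t - A') + frameNorm q A'))
      (𝓝[S \ {s}] s) (𝓝 0) := by
    have e1 : Tendsto (fun t : ℝ => ‖t - s‖ₑ) (𝓝[S \ {s}] s) (𝓝 0) := by
      rw [← tendsto_zero_iff_enorm_tendsto_zero]
      have : Tendsto (fun t : ℝ => t - s) (𝓝 s) (𝓝 (s - s)) := tendsto_id.sub_const s
      rw [sub_self] at this
      exact this.mono_left nhdsWithin_le_nhds
    have e2 : Tendsto (fun t => frameNorm q (slope A s t - A') + frameNorm q A')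
        (𝓝[S \ {s}] s) (𝓝 (0 + frameNorm q A')) := h.add tendsto_const_nhds
    have := ENNReal.Tendsto.mul e1 (Or.inr (by simpa using hA'.ne)) e2 (Or.inr (by simp))
    simpa using this
  have h2 : Tendsto (fun t => frameNorm q (A t - A s)) (𝓝[S \ {s}] s) (𝓝 0) := by
    refine tendsto_of_tendsto_of_tendsto_of_le_of_le tendsto_const_nhds h1 (fun _ => bot_le)
      fun t => (frameNorm_sub_le_slope hq0 t).trans ?_
    change ‖t - s‖ₑ * frameNorm q (slope A s t) ≤ _
    gcongr
    refine le_trans (le_of_eq ?_) (frameNorm_add_le hq)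
    rw [sub_add_cancel]
  have h3 : Tendsto (fun t => frameNorm q (A t - A s)) (𝓝[insert s (S \ {s})] s) (𝓝 0) := by
    rw [nhdsWithin_insert, tendsto_sup]
    refine ⟨?_, h2⟩
    have : frameNorm q (A s - A s) = 0 := by rw [sub_self, frameNorm_zero hq0]
    rw [tendsto_pure_left]
    intro U hU
    rw [this]
    exact mem_of_mem_nhds hU
  refine h3.mono_left (nhdsWithin_mono _ ?_)
  rw [insert_sdiff_singleton]
  exact subset_insert _ _

variable [CompleteSpace H]

/-- The mean value inequality is applied at a fixed vector so as to keep ‖z x‖ instead of ‖z‖ ‖x‖;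
such a pointwise bound transfers to the frame norm. -/
theorem norm_exp_smul_slope_apply_le (z : H →L[ℂ] H) (x : H) {s t ε : ℝ}
    (h : ∀ τ ∈ uIcc s t, ‖NormedSpace.exp (τ • z) - NormedSpace.exp (s • z)‖ ≤ ε) :
    ‖(NormedSpace.exp (t • z) - NormedSpace.exp (s • z) -
      (t - s) • (NormedSpace.exp (s • z) * z)) x‖ ≤ ε * ‖z x‖ * |t - s| := by
  have hd : ∀ τ : ℝ, HasDerivAt (fun τ : ℝ => (NormedSpace.exp (τ • z) -
      τ • (NormedSpace.exp (s • z) * z)) x)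
      ((NormedSpace.exp (τ • z) * z - NormedSpace.exp (s • z) * z) x) τ := by
    intro τ
    have h1 := (hasDerivAt_exp_smul_const (𝕂 := ℝ) z τ).sub
      ((hasDerivAt_id τ).smul_const (NormedSpace.exp (s • z) * z))
    rw [one_smul] at h1
    exact ((ContinuousLinearMap.apply ℂ H x).restrictScalars ℝ).hasFDerivAt.comp_hasDerivAt τ h1
  have h2 := Convex.norm_image_sub_le_of_norm_hasDerivWithin_le (s := uIcc s t) (C := ε * ‖z x‖)
    (fun τ _ => (hd τ).hasDerivWithinAt) (fun τ hτ => ?_) (convex_uIcc s t) left_mem_uIcc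
    right_mem_uIcc
  · rw [Real.norm_eq_abs] at h2
    refine le_trans (le_of_eq ?_) h2
    congr 1
    simp only [sub_apply, smul_apply, sub_smul]
    abel
  · rw [← sub_mul]
    exact ((NormedSpace.exp (τ • z) - NormedSpace.exp (s • z)).le_opNorm (z x)).trans
      (by gcongr; exact h τ hτ)

theorem continuous_exp_smul (z : H →L[ℂ] H) : Continuous fun t : ℝ => NormedSpace.exp (t • z) :=
  continuous_iff_continuousAt.2 fun t => (hasDerivAt_exp_smul_const (𝕂 := ℝ) z t).continuousAt

theorem hasFrameDerivWithin_mul_exp_smul (hq : 0 < q) (v : H →L[ℂ] H) {z : H →L[ℂ] H}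
    (hz : frameNorm q z < ∞) (S : Set ℝ) (s : ℝ) :
    HasFrameDerivWithin q (fun t => v * NormedSpace.exp (t • z))
      (v * NormedSpace.exp (s • z) * z) S s := by
  have hc := (continuous_exp_smul z).continuousAt (x := s)
  have key : ∀ ε : ℝ, 0 < ε → ∀ᶠ t in 𝓝[S \ {s}] s,
      frameNorm q (slope (fun t : ℝ => v * NormedSpace.exp (t • z)) s t -
        v * NormedSpace.exp (s • z) * z) ≤ ‖v‖ₑ * (ENNReal.ofReal ε * frameNorm q z) := by
    intro ε hε
    obtain ⟨δ, hδ, hδ2⟩ := Metric.continuousAt_iff.1 hc ε hε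
    have hball : ∀ᶠ t in 𝓝[S \ {s}] s, t ∈ Metric.ball s δ :=
      mem_nhdsWithin_of_mem_nhds (Metric.ball_mem_nhds s hδ)
    filter_upwards [hball, self_mem_nhdsWithin] with t ht hts
    have hts' : t - s ≠ 0 := sub_ne_zero.2 hts.2
    have h1 : slope (fun t : ℝ => v * NormedSpace.exp (t • z)) s t -
        v * NormedSpace.exp (s • z) * z = v * ((t - s)⁻¹ • (NormedSpace.exp (t • z) -
          NormedSpace.exp (s • z) - (t - s) • (NormedSpace.exp (s • z) * z))) := by
      rw [slope_def_module, smul_sub _ _ ((t - s) • _), smul_smul, inv_mul_cancel₀ hts', one_smul,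
        mul_sub, ← mul_assoc, ← mul_sub, mul_smul_comm]
    rw [h1]
    refine (frameNorm_mul_le hq).trans ?_
    gcongr
    refine frameNorm_le_of_norm_le hq hε.le fun x => ?_
    have h2 := norm_exp_smul_slope_apply_le z x (s := s) (t := t) (ε := ε) fun τ hτ => by
      have h3 : τ ∈ Metric.ball s δ :=
        (convex_ball s δ).ordConnected.uIcc_subset (Metric.mem_ball_self hδ) ht hτ
      have := (hδ2 h3).le
      rwa [dist_eq_norm] at this
    rw [smul_apply, norm_smul, norm_inv, Real.norm_eq_abs, inv_mul_le_iff₀ (abs_pos.2 hts')]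
    linarith
  have hlim : Tendsto (fun ε : ℝ => ‖v‖ₑ * (ENNReal.ofReal ε * frameNorm q z)) (𝓝[>] 0) (𝓝 0) := by
    have h1 : Tendsto (fun ε : ℝ => ENNReal.ofReal ε) (𝓝[>] 0) (𝓝 0) := by
      have := ENNReal.continuous_ofReal.tendsto 0
      rw [ENNReal.ofReal_zero] at this
      exact this.mono_left nhdsWithin_le_nhds
    have h2 := ENNReal.Tendsto.const_mul (a := ‖v‖ₑ)
      (ENNReal.Tendsto.mul_const (b := frameNorm q z) h1 (Or.inr hz.ne)) (Or.inr (by simp))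
    simpa using h2
  refine ENNReal.tendsto_nhds_zero.2 fun c hc => ?_
  obtain ⟨ε, hε, hε0⟩ := ((ENNReal.tendsto_nhds_zero.1 hlim c hc).and self_mem_nhdsWithin).exists
  filter_upwards [key ε hε0] with t ht using ht.trans hε

end FrameDeriv

/-! ### Lengths of curves in `U_p(H)` -/

section Length

universe u

variable {H : Type u} [NormedAddCommGroup H] [InnerProductSpace ℂ H] [CompleteSpace H]

theorem norm_unitary_apply {u : H →L[ℂ] H} (hu : u ∈ unitary (H →L[ℂ] H)) (x : H) :
    ‖u x‖ = ‖x‖ := by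
  have h1 : inner ℂ (u x) (u x) = inner ℂ x x := by
    rw [← inner_star_apply_right]
    have : star u (u x) = (star u * u) x := rfl
    rw [this, (Unitary.mem_iff.1 hu).1]; rfl
  rw [inner_self_eq_norm_sq_to_K, inner_self_eq_norm_sq_to_K] at h1
  have h2 : ‖u x‖ ^ 2 = ‖x‖ ^ 2 := by exact_mod_cast h1
  exact (sq_eq_sq₀ (norm_nonneg _) (norm_nonneg _)).1 h2

theorem frameNorm_unitary_mul {q : ℝ} (hq : 0 < q) {u : H →L[ℂ] H}
    (hu : u ∈ unitary (H →L[ℂ] H)) (x : H →L[ℂ] H) : frameNorm q (u * x) = frameNorm q x :=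
  frameNorm_congr hq fun v => norm_unitary_apply hu (x v)

theorem norm_unitary_mul {u : H →L[ℂ] H} (hu : u ∈ unitary (H →L[ℂ] H)) (x : H →L[ℂ] H) :
    ‖u * x‖ = ‖x‖ :=
  le_antisymm (ContinuousLinearMap.opNorm_le_bound _ (norm_nonneg x) fun v => by
      have := norm_unitary_apply hu (x v)
      exact this.le.trans (x.le_opNorm v))
    (ContinuousLinearMap.opNorm_le_bound _ (norm_nonneg _) fun v => by
      have := norm_unitary_apply hu (x v)
      exact this.ge.trans ((u * x).le_opNorm v))

/-- The unitary operators `v` for which `v - 1` has finite frame norm. -/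
def frameUnitary (q : ℝ) : Set (H →L[ℂ] H) :=
  {v | v ∈ unitary (H →L[ℂ] H) ∧ frameNorm q (v - 1) < ∞}

theorem schattenUnitary_eq {p : ℕ} (hp : Even p) (hp0 : 0 < p) :
    (schattenUnitary p : Set (H →L[ℂ] H)) = frameUnitary p := by
  ext v
  simp [schattenUnitary, frameUnitary, schattenClass, eSchattenNorm_eq_frameNorm hp hp0]

theorem frameNorm_sub_lt_top {q : ℝ} (hq : 1 ≤ q) {u v : H →L[ℂ] H} (hu : u ∈ frameUnitary q)
    (hv : v ∈ frameUnitary q) : frameNorm q (v - u) < ∞ := by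
  have : v - u = (v - 1) - (u - 1) := by abel
  rw [this]
  exact (frameNorm_sub_le hq).trans_lt (ENNReal.add_lt_top.2 ⟨hv.2, hu.2⟩)

theorem star_mul_mem_frameUnitary {q : ℝ} (hq : 1 ≤ q) {u v : H →L[ℂ] H} (hu : u ∈ frameUnitary q)
    (hv : v ∈ frameUnitary q) : star u * v ∈ frameUnitary q := by
  have hsu := Unitary.star_mem hu.1
  refine ⟨mul_mem hsu hv.1, ?_⟩
  have : star u * v - 1 = star u * (v - u) := by
    rw [mul_sub, (Unitary.mem_iff.1 hu.1).1]
  rw [this, frameNorm_unitary_mul (by linarith) hsu]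
  exact frameNorm_sub_lt_top hq hu hv

variable {q : ℝ} {u v v' : H →L[ℂ] H}

theorem frameNorm_unitaryArg_lt_top (hq : 1 ≤ q) (hv : v ∈ frameUnitary q) (h2 : ‖v - 1‖ < 2) :
    frameNorm q (unitaryArg v) < ∞ := by
  rw [← frameNorm_unitaryLog (by linarith) hv.1 h2]
  exact frameNorm_unitaryLog_lt_top hq hv.1 h2 hv.2

open Classical in
/-- The frame norm of the logarithm of `v`, truncated at `c`. -/
noncomputable def truncAngle (q c : ℝ) (v : H →L[ℂ] H) : ℝ :=
  if ‖v - 1‖ < 2 then min c (frameNorm q (unitaryArg v)).toReal else c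

theorem truncAngle_le (q c : ℝ) (v : H →L[ℂ] H) : truncAngle q c v ≤ c := by
  unfold truncAngle
  split_ifs
  · exact min_le_left _ _
  · exact le_rfl

theorem truncAngle_of_lt {c : ℝ} (h : truncAngle q c v < c) :
    ‖v - 1‖ < 2 ∧ truncAngle q c v = (frameNorm q (unitaryArg v)).toReal := by
  unfold truncAngle at h ⊢
  split_ifs at h ⊢ with h2
  · exact ⟨h2, min_eq_right (by
      by_contra hcon
      rw [min_eq_left (not_le.1 hcon).le] at h
      exact lt_irrefl _ h)⟩
  · exact absurd h (lt_irrefl _)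

/-- A curve may leave the domain of the logarithm; truncation makes the estimate global. If v' is at
level c, nothing is to be shown. Otherwise arg v' has norm below π/2, and ‖v - 1‖ ≤ 1/8 + π/2 < 2
puts v in the domain of the logarithm too. -/
theorem truncAngle_le_add (hq : 2 ≤ q) {c : ℝ} (hc : c < Real.pi / 2) (hv : v ∈ frameUnitary q)
    (hv' : v' ∈ frameUnitary q) {η : ℝ} (hη : η ≤ 1 / 8) (hd : ‖v - v'‖ ≤ η) :
    truncAngle q c v ≤ truncAngle q c v' + (1 - η ^ 2)⁻¹ * (frameNorm q (v - v')).toReal := by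
  have hq0 : 0 < q := by linarith
  have hη0 : 0 ≤ η := (norm_nonneg _).trans hd
  have hη2 : 0 < 1 - η ^ 2 := by nlinarith
  by_cases h : truncAngle q c v' < c
  · obtain ⟨h1, h2⟩ := truncAngle_of_lt h
    have hfin' := frameNorm_unitaryArg_lt_top (by linarith) hv' h1
    have hle := norm_le_toReal_frameNorm hq0 hfin'.ne
    have h3 : ‖v - 1‖ < 2 := by
      have h4 : v - 1 = (v - v') + (v' - 1) := by abel
      have h5 := norm_sub_one_le_norm_unitaryArg hv'.1 h1
      rw [h4]
      refine (norm_add_le _ _).trans_lt ?_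
      linarith [Real.pi_lt_d2]
    have h6 := frameNorm_unitaryArg_le_add hq hv.1 h3 hv.2 hv'.1 h1 hv'.2 (by linarith)
      (by linarith) hd
    have h7 := frameNorm_sub_lt_top (by linarith) hv' hv
    have h8 := ENNReal.toReal_mono (ENNReal.add_lt_top.2 ⟨hfin',
      ENNReal.mul_lt_top ENNReal.ofReal_lt_top h7⟩).ne h6
    rw [ENNReal.toReal_add hfin'.ne (ENNReal.mul_lt_top ENNReal.ofReal_lt_top h7).ne,
      ENNReal.toReal_mul, ENNReal.toReal_ofReal (by positivity)] at h8
    rw [h2]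
    refine le_trans ?_ h8
    unfold truncAngle
    rw [if_pos h3]
    exact min_le_right _ _
  · have := truncAngle_le q c v
    have h2 : 0 ≤ (1 - η ^ 2)⁻¹ * (frameNorm q (v - v')).toReal := by positivity
    linarith [not_lt.1 h]

/-- The truncated angle Φ need not be differentiable. By the chord estimate its right slopes at x
are eventually below any number larger than ‖γ'(x)‖_p, which suffices to bound its increase by the
integral of the speed. -/
theorem ofReal_truncAngle_le_of_smooth {p : ℕ} (hp : Even p) (hp2 : 2 ≤ p) {c : ℝ}
    (hc : c < Real.pi / 2) (hu : u ∈ frameUnitary (p : ℝ)) {γ : ℝ → H →L[ℂ] H} {a b : ℝ}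
    (hab : a < b) (hγ : ∀ t ∈ Icc a b, γ t ∈ frameUnitary (p : ℝ))
    (hs : IsSchattenSmoothOn p γ a b) :
    ENNReal.ofReal (truncAngle p c (star u * γ b)) ≤
      ENNReal.ofReal (truncAngle p c (star u * γ a)) +
        ∫⁻ t in Ioc a b, eSchattenNorm p (deriv γ t) := by
  have hq : (2 : ℝ) ≤ p := by exact_mod_cast hp2
  have hq1 : (1 : ℝ) ≤ p := by linarith
  have hq0 : (0 : ℝ) < p := by linarith
  set q : ℝ := (p : ℝ) with hqp
  obtain ⟨γ', hγ'⟩ := hs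
  have hE : ∀ x : H →L[ℂ] H, eSchattenNorm p x = frameNorm q x :=
    eSchattenNorm_eq_frameNorm hp (by omega)
  simp only [hE] at hγ' ⊢
  have hD : ∀ t ∈ Icc a b, HasFrameDerivWithin q γ (γ' t) (Icc a b) t := fun t ht => (hγ' t ht).1
  have hne : ∀ t ∈ Icc a b, (𝓝[Icc a b \ {t}] t).NeBot := fun t ht =>
    accPt_principal_iff_nhdsWithin.1 (uniqueDiffOn_Icc hab t ht).accPt
  have hfin : ∀ t ∈ Icc a b, frameNorm q (γ' t) < ∞ := fun t ht => by
    have := hne t ht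
    exact (hD t ht).frameNorm_lt_top hq1 fun s hs => frameNorm_sub_lt_top hq1 (hγ t ht) (hγ s hs)
  set N : ℝ → ℝ := fun t => (frameNorm q (γ' t)).toReal with hN
  have hNc : ContinuousOn N (Icc a b) := by
    intro t ht
    have h1 : Tendsto (fun s => (frameNorm q (γ' s - γ' t)).toReal) (𝓝[Icc a b] t) (𝓝 0) := by
      have := (ENNReal.tendsto_toReal ENNReal.zero_ne_top).comp (hγ' t ht).2.1
      simpa [Function.comp_def] using this
    refine tendsto_iff_norm_sub_tendsto_zero.2 (squeeze_zero' (Eventually.of_forall fun _ =>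
      norm_nonneg _) ?_ h1)
    filter_upwards [self_mem_nhdsWithin] with s hs
    have hf : frameNorm q (γ' s - γ' t) < ∞ :=
      (frameNorm_sub_le hq1).trans_lt (ENNReal.add_lt_top.2 ⟨hfin s hs, hfin t ht⟩)
    have e1 : frameNorm q (γ' s) ≤ frameNorm q (γ' s - γ' t) + frameNorm q (γ' t) := by
      simpa using frameNorm_add_le (x := γ' s - γ' t) (y := γ' t) hq1
    have e2 : frameNorm q (γ' t) ≤ frameNorm q (γ' s - γ' t) + frameNorm q (γ' s) := by
      rw [frameNorm_sub_comm hq0]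
      simpa using frameNorm_add_le (x := γ' t - γ' s) (y := γ' s) hq1
    have e1' := ENNReal.toReal_mono (ENNReal.add_lt_top.2 ⟨hf, hfin t ht⟩).ne e1
    have e2' := ENNReal.toReal_mono (ENNReal.add_lt_top.2 ⟨hf, hfin s hs⟩).ne e2
    rw [ENNReal.toReal_add hf.ne (hfin t ht).ne] at e1'
    rw [ENNReal.toReal_add hf.ne (hfin s hs).ne] at e2'
    rw [Real.norm_eq_abs, abs_le]
    constructor <;> simp only [hN] <;> linarith
  have hsu := Unitary.star_mem hu.1
  set Φ : ℝ → ℝ := fun t => truncAngle q c (star u * γ t) with hΦ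
  have hmem : ∀ t ∈ Icc a b, star u * γ t ∈ frameUnitary q := fun t ht =>
    star_mul_mem_frameUnitary hq1 hu (hγ t ht)
  have hnorm : ∀ s t, ‖star u * γ s - star u * γ t‖ = ‖γ s - γ t‖ := fun s t => by
    rw [← mul_sub, norm_unitary_mul hsu]
  have hfr : ∀ s t, frameNorm q (star u * γ s - star u * γ t) = frameNorm q (γ s - γ t) :=
    fun s t => by rw [← mul_sub, frameNorm_unitary_mul hq0 hsu]
  have hΦle : ∀ s ∈ Icc a b, ∀ t ∈ Icc a b, ‖γ s - γ t‖ ≤ 1 / 8 →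
      Φ s ≤ Φ t + (1 - ‖γ s - γ t‖ ^ 2)⁻¹ * (frameNorm q (γ s - γ t)).toReal := by
    intro s hs t ht hst
    have := truncAngle_le_add hq hc (hmem s hs) (hmem t ht) hst (hnorm s t).le
    rwa [hfr] at this
  have hcont : ∀ t ∈ Icc a b, Tendsto (fun s => frameNorm q (γ s - γ t)) (𝓝[Icc a b] t) (𝓝 0) :=
    fun t ht => (hD t ht).tendsto_frameNorm_sub hq1 (hfin t ht)
  have hcontn : ∀ t ∈ Icc a b, Tendsto (fun s => ‖γ s - γ t‖) (𝓝[Icc a b] t) (𝓝 0) :=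
    fun t ht => tendsto_zero_iff_norm_tendsto_zero.1 (tendsto_zero_of_frameNorm hq0 (hcont t ht))
  have hK : ∀ t ∈ Icc a b, Tendsto (fun s => (1 - ‖γ s - γ t‖ ^ 2)⁻¹) (𝓝[Icc a b] t) (𝓝 1) := by
    intro t ht
    have : ContinuousAt (fun r : ℝ => (1 - r ^ 2)⁻¹) 0 :=
      ContinuousAt.inv₀ (by fun_prop) (by norm_num)
    have h2 := this.tendsto.comp (hcontn t ht)
    simpa [Function.comp_def] using h2
  have hΦc : ContinuousOn Φ (Icc a b) := by
    intro t ht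
    have h1 : Tendsto (fun s => (1 - ‖γ s - γ t‖ ^ 2)⁻¹ * (frameNorm q (γ s - γ t)).toReal)
        (𝓝[Icc a b] t) (𝓝 0) := by
      have h2 := (ENNReal.tendsto_toReal ENNReal.zero_ne_top).comp (hcont t ht)
      have h3 := (hK t ht).mul h2
      simpa using h3
    refine tendsto_iff_norm_sub_tendsto_zero.2 (squeeze_zero' (Eventually.of_forall fun _ =>
      norm_nonneg _) ?_ h1)
    filter_upwards [self_mem_nhdsWithin, (hcontn t ht).eventually (gt_mem_nhds (by norm_num :
      (0 : ℝ) < 1 / 8))] with s hs hst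
    have e1 := hΦle s hs t ht hst.le
    have e2 := hΦle t ht s hs (by rw [norm_sub_rev]; exact hst.le)
    rw [norm_sub_rev (γ t), frameNorm_sub_comm hq0 (x := γ t)] at e2
    rw [Real.norm_eq_abs, abs_le]
    constructor <;> linarith
  have hslope : ∀ x ∈ Ico a b, ∀ r, N x < r → ∃ᶠ z in 𝓝[>] x, slope Φ x z < r := by
    intro x hx r hr
    have hxI := Ico_subset_Icc_self hx
    have hle : 𝓝[>] x ≤ 𝓝[Icc a b \ {x}] x := by
      rw [← nhdsWithin_Ioo_eq_nhdsGT hx.2]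
      exact nhdsWithin_mono _ fun z hz => ⟨⟨hx.1.trans hz.1.le, hz.2.le⟩, hz.1.ne'⟩
    have hle2 : 𝓝[>] x ≤ 𝓝[Icc a b] x := hle.trans (nhdsWithin_mono _ sdiff_subset)
    have h1 : Tendsto (fun z => (frameNorm q (slope γ x z)).toReal) (𝓝[>] x) (𝓝 (N x)) := by
      have h2 : Tendsto (fun z => frameNorm q (slope γ x z - γ' x)) (𝓝[>] x) (𝓝 0) :=
        (hD x hxI).mono_left hle
      have h3 : Tendsto (fun z => (frameNorm q (slope γ x z - γ' x)).toReal) (𝓝[>] x) (𝓝 0) := by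
        have := (ENNReal.tendsto_toReal ENNReal.zero_ne_top).comp h2
        simpa [Function.comp_def] using this
      refine tendsto_iff_norm_sub_tendsto_zero.2 (squeeze_zero' (Eventually.of_forall fun _ =>
        norm_nonneg _) ?_ h3)
      filter_upwards [h2.eventually (gt_mem_nhds one_pos)] with z hz
      have hf := hz.trans ENNReal.one_lt_top
      have e1 : frameNorm q (slope γ x z) ≤ frameNorm q (slope γ x z - γ' x) + frameNorm q (γ' x) := by
        simpa using frameNorm_add_le (x := slope γ x z - γ' x) (y := γ' x) hq1
      have hfs := e1.trans_lt (ENNReal.add_lt_top.2 ⟨hf, hfin x hxI⟩)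
      have e2 : frameNorm q (γ' x) ≤ frameNorm q (slope γ x z - γ' x) + frameNorm q (slope γ x z) := by
        rw [frameNorm_sub_comm hq0]
        simpa using frameNorm_add_le (x := γ' x - slope γ x z) (y := slope γ x z) hq1
      have e1' := ENNReal.toReal_mono (ENNReal.add_lt_top.2 ⟨hf, hfin x hxI⟩).ne e1
      have e2' := ENNReal.toReal_mono (ENNReal.add_lt_top.2 ⟨hf, hfs⟩).ne e2
      rw [ENNReal.toReal_add hf.ne (hfin x hxI).ne] at e1'
      rw [ENNReal.toReal_add hf.ne hfs.ne] at e2'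
      rw [Real.norm_eq_abs, abs_le]
      constructor <;> simp only [hN] <;> linarith
    have h4 : Tendsto (fun z => (1 - ‖γ z - γ x‖ ^ 2)⁻¹ * (frameNorm q (slope γ x z)).toReal)
        (𝓝[>] x) (𝓝 (N x)) := by
      simpa using ((hK x hxI).mono_left hle2).mul h1
    refine Eventually.frequently ?_
    filter_upwards [h4.eventually (gt_mem_nhds hr), hle2 self_mem_nhdsWithin, self_mem_nhdsWithin,
      ((hcontn x hxI).mono_left hle2).eventually (gt_mem_nhds (by norm_num : (0 : ℝ) < 1 / 8)),
      ((hD x hxI).mono_left hle).eventually (gt_mem_nhds one_pos)]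
      with z hz hzI hzx hzn hzf
    refine lt_of_le_of_lt ?_ hz
    have hzx' : 0 < z - x := sub_pos.2 hzx
    have e1 := hΦle z hzI x hxI hzn.le
    rw [slope_def_field, div_le_iff₀ hzx']
    have hinv : 0 ≤ (1 - ‖γ z - γ x‖ ^ 2)⁻¹ := by
      have : 0 ≤ 1 - ‖γ z - γ x‖ ^ 2 := by nlinarith [norm_nonneg (γ z - γ x)]
      positivity
    have hfs : frameNorm q (slope γ x z) < ∞ := by
      have e1 : frameNorm q (slope γ x z) ≤ frameNorm q (slope γ x z - γ' x) + frameNorm q (γ' x) := by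
        simpa using frameNorm_add_le (x := slope γ x z - γ' x) (y := γ' x) hq1
      exact e1.trans_lt (ENNReal.add_lt_top.2 ⟨hzf.trans ENNReal.one_lt_top, hfin x hxI⟩)
    have e2 := frameNorm_sub_le_slope (A := γ) (s := x) hq0 z
    have e3 := ENNReal.toReal_mono (ENNReal.mul_lt_top (by simp [enorm]) hfs).ne e2
    rw [ENNReal.toReal_mul, toReal_enorm, Real.norm_of_nonneg hzx'.le] at e3
    have e4 := mul_le_mul_of_nonneg_left e3 hinv
    linarith
  -- Extending the speed continuously to the whole line makes its primitive differentiable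
  -- everywhere.
  set N' : ℝ → ℝ := IccExtend hab.le ((Icc a b).domRestrict N) with hN'
  have hN'c : Continuous N' := (continuousOn_iff_continuous_domRestrict.1 hNc).Icc_extend'
  have hN'eq : ∀ t ∈ Icc a b, N' t = N t := fun t ht => IccExtend_of_mem _ _ ht
  -- The term ε(b - a) supplies the strict inequality of slopes that the comparison principle
  -- demands.
  have hfence : ∀ ε : ℝ, 0 < ε → Φ b ≤ Φ a + (∫ t in a..b, N' t) + ε * (b - a) := by
    intro ε hε
    have hB : ∀ t, HasDerivAt (fun t => Φ a + (∫ s in a..t, N' s) + ε * (t - a)) (N' t + ε) t := by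
      intro t
      have h1 := (hN'c.integral_hasStrictDerivAt a t).hasDerivAt
      have h2 := ((hasDerivAt_id' t).sub_const a).const_mul ε
      have h3 := (h1.const_add (Φ a)).add h2
      rwa [mul_one] at h3
    exact image_le_of_liminf_slope_right_lt_deriv_boundary hΦc hslope (by simp) hB
      (fun x hx _ => by rw [hN'eq x (Ico_subset_Icc_self hx)]; linarith) (right_mem_Icc.2 hab.le)
  have hfinal : Φ b ≤ Φ a + ∫ t in a..b, N' t := by
    refine le_of_forall_pos_le_add fun ε hε => ?_
    have hba : 0 < b - a := sub_pos.2 hab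
    have := hfence (ε / (b - a)) (by positivity)
    rwa [div_mul_cancel₀ _ hba.ne'] at this
  have hint : ENNReal.ofReal (∫ t in a..b, N' t) = ∫⁻ t in Ioc a b, frameNorm q (deriv γ t) := by
    rw [intervalIntegral.integral_of_le hab.le, MeasureTheory.ofReal_integral_eq_lintegral_ofReal
      ((hN'c.continuousOn.integrableOn_Icc).mono_set Ioc_subset_Icc_self)
      (MeasureTheory.ae_restrict_of_forall_mem measurableSet_Ioc fun t ht => by
        rw [hN'eq t (Ioc_subset_Icc_self ht)]; exact ENNReal.toReal_nonneg),
      MeasureTheory.restrict_Ioo_eq_restrict_Ioc.symm]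
    -- Only inside the interval does the one-sided derivative γ' determine `deriv γ`; the end points
    -- form a null set.
    refine MeasureTheory.setLIntegral_congr_fun measurableSet_Ioo fun t ht => ?_
    have htI := Ioo_subset_Icc_self ht
    have hd : HasDerivAt γ (γ' t) t :=
      ((hD t htI).hasDerivWithinAt hq0).hasDerivAt (Icc_mem_nhds ht.1 ht.2)
    change ENNReal.ofReal (N' t) = frameNorm q (deriv γ t)
    rw [hN'eq t htI, hd.deriv, hN, ENNReal.ofReal_toReal (hfin t htI).ne]
  rw [← hint]
  exact (ENNReal.ofReal_le_ofReal hfinal).trans ENNReal.ofReal_add_le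

end Length

/-! ### The rectifiable distance -/

section Distance

universe u

variable {H : Type u} [NormedAddCommGroup H] [InnerProductSpace ℂ H] [CompleteSpace H]

variable {p : ℕ} {u v : H →L[ℂ] H}

theorem truncAngle_one {q c : ℝ} (hq : 0 < q) (hc : 0 ≤ c) :
    truncAngle q c (1 : H →L[ℂ] H) = 0 := by
  have h0 : ‖(1 : H →L[ℂ] H) - 1‖ < 2 := by simp
  unfold truncAngle
  rw [if_pos h0, ← frameNorm_unitaryLog hq (one_mem _) h0, unitaryLog_one, frameNorm_zero hq]
  simpa using hc

theorem IsSchattenCurve.ofReal_truncAngle_le (hp : Even p) (hp2 : 2 ≤ p) {c : ℝ} (hc0 : 0 ≤ c)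
    (hc : c < Real.pi / 2) (hu : u ∈ frameUnitary (p : ℝ)) {γ : ℝ → H →L[ℂ] H} {a b : ℝ}
    (hγ : IsSchattenCurve p γ a b) (ha : γ a = u) :
    ENNReal.ofReal (truncAngle p c (star u * γ b)) ≤ ∫⁻ t in Ioc a b, eSchattenNorm p (deriv γ t) := by
  obtain ⟨hab, hmem, n, τ, hτ, h0, hn, hs⟩ := hγ
  rw [schattenUnitary_eq hp (by omega)] at hmem
  have hτI : ∀ i, τ i ∈ Icc a b := fun i =>
    ⟨h0 ▸ hτ.monotone (Fin.zero_le i), hn ▸ hτ.monotone (Fin.le_last i)⟩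
  have key : ∀ i : Fin (n + 1), ENNReal.ofReal (truncAngle p c (star u * γ (τ i))) ≤
      ∫⁻ t in Ioc a (τ i), eSchattenNorm p (deriv γ t) := by
    intro i
    induction i using Fin.induction with
    | zero =>
      rw [h0, ha, (Unitary.mem_iff.1 hu.1).1, truncAngle_one (by positivity) hc0]
      simp
    | succ i ih =>
      have hlt : τ i.castSucc < τ i.succ := hτ Fin.castSucc_lt_succ
      have h1 := ofReal_truncAngle_le_of_smooth hp hp2 hc hu hlt
        (fun t ht => hmem t ⟨(hτI _).1.trans ht.1, ht.2.trans (hτI _).2⟩) (hs i)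
      refine h1.trans ?_
      rw [← Ioc_union_Ioc_eq_Ioc (hτI i.castSucc).1 hlt.le,
        MeasureTheory.lintegral_union measurableSet_Ioc (Ioc_disjoint_Ioc_of_le le_rfl)]
      gcongr
  have := key (Fin.last n)
  rwa [hn] at this

/-- With c strictly between the length and π/2, the truncated angle is at most the length, hence
below c. So the truncation is inactive and the end point lies in the domain of the logarithm. -/
theorem IsSchattenCurve.frameNorm_unitaryArg_le (hp : Even p) (hp2 : 2 ≤ p)
    (hu : u ∈ frameUnitary (p : ℝ)) {γ : ℝ → H →L[ℂ] H} {a b : ℝ}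
    (hγ : IsSchattenCurve p γ a b) (ha : γ a = u)
    (hlen : schattenLength p γ a b < ENNReal.ofReal (Real.pi / 2)) :
    ‖star u * γ b - 1‖ < 2 ∧ frameNorm p (unitaryArg (star u * γ b)) ≤ schattenLength p γ a b := by
  have hpi := Real.pi_pos
  have hlen' : (schattenLength p γ a b).toReal < Real.pi / 2 :=
    (ENNReal.lt_ofReal_iff_toReal_lt hlen.ne_top).1 hlen
  obtain ⟨c, hc1, hc2⟩ := exists_between hlen'
  have hc0 : 0 < c := ENNReal.toReal_nonneg.trans_lt hc1
  have h1 := hγ.ofReal_truncAngle_le hp hp2 hc0.le hc2 hu ha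
  have h2 : ∫⁻ t in Ioc a b, eSchattenNorm p (deriv γ t) = schattenLength p γ a b := by
    rw [schattenLength, MeasureTheory.restrict_Ioc_eq_restrict_Icc]
  rw [h2] at h1
  have h3 : truncAngle p c (star u * γ b) ≤ (schattenLength p γ a b).toReal :=
    (ENNReal.ofReal_le_iff_le_toReal hlen.ne_top).1 h1
  obtain ⟨h4, h5⟩ := truncAngle_of_lt (h3.trans_lt hc1)
  refine ⟨h4, ?_⟩
  have hmem : star u * γ b ∈ frameUnitary (p : ℝ) := by
    have := hγ.2.1 b (right_mem_Icc.2 hγ.1.le)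
    rw [schattenUnitary_eq hp (by omega)] at this
    exact star_mul_mem_frameUnitary (by exact_mod_cast (by omega : 1 ≤ p)) hu this
  have hfin := frameNorm_unitaryArg_lt_top (by exact_mod_cast (by omega : 1 ≤ p)) hmem h4
  rw [h5] at h1
  rwa [ENNReal.ofReal_toReal hfin.ne] at h1

theorem exp_smul_mem_unitary {w : H →L[ℂ] H} (hw : star w = -w) (t : ℝ) :
    NormedSpace.exp (t • w) ∈ unitary (H →L[ℂ] H) := by
  let := NormedAlgebra.restrictScalars ℚ ℂ (H →L[ℂ] H)
  refine NormedSpace.exp_mem_unitary_of_mem_skewAdjoint (skewAdjoint.mem_iff.2 ?_)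
  rw [star_smul, hw]; simp

theorem exp_smul_mem_frameUnitary {q : ℝ} (hq : 1 ≤ q) {w : H →L[ℂ] H} (hw : star w = -w)
    (hf : frameNorm q w < ∞) (t : ℝ) : NormedSpace.exp (t • w) ∈ frameUnitary q := by
  have hq0 : 0 < q := by linarith
  refine ⟨exp_smul_mem_unitary hw t, ?_⟩
  have h1 : ∀ x, ‖(NormedSpace.exp (t • w) - 1 - t • w) x‖ ≤ 2 * |t| * ‖w x‖ := fun x => by
    -- The constant 2 is the trivial bound for the difference of two unitaries.
    have := norm_exp_smul_slope_apply_le w x (s := 0) (t := t) (ε := 2) fun τ _ => by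
      have e1 := (exp_smul_mem_unitary hw τ)
      have e2 := (exp_smul_mem_unitary hw 0)
      have e3 : ∀ v ∈ unitary (H →L[ℂ] H), ‖v‖ ≤ 1 := fun v hv =>
        ContinuousLinearMap.opNorm_le_bound _ zero_le_one fun x => by
          rw [norm_unitary_apply hv, one_mul]
      exact (norm_sub_le _ _).trans (by linarith [e3 _ e1, e3 _ e2])
    simp only [zero_smul, NormedSpace.exp_zero, sub_zero, one_mul] at this
    linarith
  have h2 : NormedSpace.exp (t • w) - 1 = (NormedSpace.exp (t • w) - 1 - t • w) + t • w := by abel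
  rw [h2]
  refine (frameNorm_add_le hq).trans_lt (ENNReal.add_lt_top.2 ⟨?_, ?_⟩)
  · exact (frameNorm_le_of_norm_le hq0 (by positivity) h1).trans_lt
      (ENNReal.mul_lt_top ENNReal.ofReal_lt_top hf)
  · exact (frameNorm_real_smul_le hq0 t).trans_lt (ENNReal.mul_lt_top (by simp [enorm]) hf)

theorem mul_mem_frameUnitary {q : ℝ} (hq : 1 ≤ q) (hu : u ∈ frameUnitary q)
    (hv : v ∈ frameUnitary q) : u * v ∈ frameUnitary q := by
  refine ⟨mul_mem hu.1 hv.1, ?_⟩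
  have : u * v - 1 = u * (v - 1) + (u - 1) := by rw [mul_sub, mul_one]; abel
  rw [this]
  refine (frameNorm_add_le hq).trans_lt (ENNReal.add_lt_top.2 ⟨?_, hu.2⟩)
  rw [frameNorm_unitary_mul (by linarith) hu.1]
  exact hv.2

/-- The curve t ↦ u e^{tw} has constant speed ‖w‖_p. The condition w ≠ 0 is needed because smooth
curves must have nonvanishing velocity. -/
theorem eSchattenDist_mul_exp_le (hp : Even p) (hp2 : 2 ≤ p) (hu : u ∈ frameUnitary (p : ℝ))
    {w : H →L[ℂ] H} (hw : star w = -w) (hw0 : w ≠ 0) (hf : frameNorm p w < ∞) :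
    eSchattenDist p u (u * NormedSpace.exp w) ≤ frameNorm p w := by
  have hq1 : (1 : ℝ) ≤ p := by exact_mod_cast (by omega : 1 ≤ p)
  have hq0 : (0 : ℝ) < p := by linarith
  have hE : ∀ x : H →L[ℂ] H, eSchattenNorm p x = frameNorm p x :=
    eSchattenNorm_eq_frameNorm hp (by omega)
  set γ : ℝ → H →L[ℂ] H := fun t => u * NormedSpace.exp (t • w) with hγ
  have hD := fun s => hasFrameDerivWithin_mul_exp_smul hq0 u hf (Icc (0 : ℝ) 1) s
  have hmem : ∀ t : ℝ, NormedSpace.exp (t • w) ∈ frameUnitary (p : ℝ) :=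
    exp_smul_mem_frameUnitary hq1 hw hf
  have hsub : ∀ s t : ℝ, frameNorm p (u * NormedSpace.exp (s • w) * w -
      u * NormedSpace.exp (t • w) * w) ≤
      ‖NormedSpace.exp (s • w) - NormedSpace.exp (t • w)‖ₑ * frameNorm p w := fun s t => by
    rw [mul_assoc, mul_assoc, ← mul_sub, ← sub_mul, frameNorm_unitary_mul hq0 hu.1]
    exact frameNorm_mul_le hq0
  have hcurve : IsSchattenCurve p γ 0 1 := by
    refine ⟨zero_lt_one, fun t _ => ?_, 1, ![0, 1], ?_, rfl, rfl, fun i => ?_⟩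
    · rw [schattenUnitary_eq hp (by omega)]
      exact mul_mem_frameUnitary hq1 hu (hmem t)
    · rw [Fin.strictMono_iff_lt_succ]
      intro i
      fin_cases i
      simp
    · fin_cases i
      refine ⟨fun t => u * NormedSpace.exp (t • w) * w, fun t ht => ⟨?_, ?_, ?_⟩⟩
      · simp only [hE]
        exact hD t
      · simp only [hE]
        have h1 : Tendsto (fun s : ℝ => NormedSpace.exp (s • w) - NormedSpace.exp (t • w))
            (𝓝[Icc 0 1] t) (𝓝 0) := by
          have := ((continuous_exp_smul w).tendsto t).sub_const (NormedSpace.exp (t • w))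
          rw [sub_self] at this
          exact this.mono_left nhdsWithin_le_nhds
        have h2 := ENNReal.Tendsto.mul_const (b := frameNorm p w)
          (tendsto_zero_iff_enorm_tendsto_zero.1 h1) (Or.inr hf.ne)
        rw [zero_mul] at h2
        exact tendsto_of_tendsto_of_tendsto_of_le_of_le tendsto_const_nhds h2 (fun _ => bot_le)
          fun s => hsub s t
      · intro h0
        have h1 := mul_mem hu.1 (hmem t).1
        have h2 : star (u * NormedSpace.exp (t • w)) * (u * NormedSpace.exp (t • w) * w) = w := by
          rw [← mul_assoc, (Unitary.mem_iff.1 h1).1, one_mul]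
        have h0' : u * NormedSpace.exp (t • w) * w = 0 := h0
        rw [h0', mul_zero] at h2
        exact hw0 h2.symm
  have hlen : schattenLength p γ 0 1 = frameNorm p w := by
    have h1 : ∀ t : ℝ, eSchattenNorm p (deriv γ t) = frameNorm p w := fun t => by
      have h2 : HasDerivAt γ (u * (NormedSpace.exp (t • w) * w)) t :=
        (hasDerivAt_exp_smul_const (𝕂 := ℝ) w t).const_mul u
      rw [h2.deriv, hE, frameNorm_unitary_mul hq0 hu.1, frameNorm_unitary_mul hq0 (hmem t).1]
    simp only [schattenLength, h1]
    simp
  rw [← hlen]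
  refine iInf_le_of_le γ (iInf_le_of_le 0 (iInf_le_of_le 1 (iInf_le_of_le ⟨hcurve, ?_, ?_⟩ le_rfl)))
  · simp [hγ]
  · simp [hγ]

/-- The one-parameter curve generated by the logarithm gives the upper bound. Curves shorter than
π/2 are at least as long as the norm of the argument; longer ones exceed some curve shorter than
π/2, so they obey the same bound. -/
theorem eSchattenDist_eq (hp : Even p) (hp2 : 2 ≤ p) (hu : u ∈ frameUnitary (p : ℝ))
    (hv : v ∈ frameUnitary (p : ℝ)) (huv : u ≠ v)
    (hd : eSchattenDist p u v < ENNReal.ofReal (Real.pi / 2)) :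
    ‖star u * v - 1‖ < 2 ∧ eSchattenDist p u v = frameNorm p (unitaryArg (star u * v)) := by
  have hq1 : (1 : ℝ) ≤ p := by exact_mod_cast (by omega : 1 ≤ p)
  have hq0 : (0 : ℝ) < p := by linarith
  have hmem := star_mul_mem_frameUnitary hq1 hu hv
  have hex : ∃ (γ : ℝ → H →L[ℂ] H) (a b : ℝ), (IsSchattenCurve p γ a b ∧ γ a = u ∧ γ b = v) ∧
      schattenLength p γ a b < ENNReal.ofReal (Real.pi / 2) := by
    simpa only [eSchattenDist, iInf_lt_iff, exists_prop] using hd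
  obtain ⟨γ, a, b, ⟨hγ, ha, hb⟩, hl⟩ := hex
  obtain ⟨h2, h3⟩ := hγ.frameNorm_unitaryArg_le hp hp2 hu ha hl
  rw [hb] at h2 h3
  refine ⟨h2, le_antisymm ?_ ?_⟩
  · have hexp := exp_unitaryLog hmem.1 h2
    have hmul : u * (star u * v) = v := by
      rw [← mul_assoc, (Unitary.mem_iff.1 hu.1).2, one_mul]
    have h4 := eSchattenDist_mul_exp_le hp hp2 hu (star_unitaryLog hmem.1 h2) (fun h0 => huv (by
      rw [h0, NormedSpace.exp_zero] at hexp
      rw [← hexp, mul_one] at hmul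
      exact hmul)) (frameNorm_unitaryLog_lt_top hq1 hmem.1 h2 hmem.2)
    rwa [hexp, hmul, frameNorm_unitaryLog hq0 hmem.1 h2] at h4
  · refine le_iInf fun γ' => le_iInf fun a' => le_iInf fun b' => le_iInf fun h => ?_
    rcases lt_or_ge (schattenLength p γ' a' b') (ENNReal.ofReal (Real.pi / 2)) with hl' | hl'
    · have := (h.1.frameNorm_unitaryArg_le hp hp2 hu h.2.1 hl').2
      rwa [h.2.2] at this
    · exact (h3.trans hl.le).trans hl'

end Distance

/-! ### The derivative of the logarithm -/

section LogDeriv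

universe u

variable {H : Type u} [NormedAddCommGroup H] [InnerProductSpace ℂ H] [CompleteSpace H]

theorem segmentResolvent_sub_segmentResolvent {v v' : H →L[ℂ] H} (hv : v ∈ unitary (H →L[ℂ] H))
    (h2 : ‖v - 1‖ < 2) (hv' : v' ∈ unitary (H →L[ℂ] H)) (h2' : ‖v' - 1‖ < 2) {t : ℝ}
    (ht : t ∈ Icc (0 : ℝ) 1) :
    segmentResolvent v' t - segmentResolvent v t =
      -((t : ℂ) • (segmentResolvent v' t * (v' - v) * segmentResolvent v t)) := by
  have h3 := segmentResolvent_mul hv' h2' ht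
  have h4 := mul_segmentResolvent hv h2 ht
  calc segmentResolvent v' t - segmentResolvent v t
      = segmentResolvent v' t * ((1 + (t : ℂ) • (v - 1)) * segmentResolvent v t) -
        (segmentResolvent v' t * (1 + (t : ℂ) • (v' - 1))) * segmentResolvent v t := by
        rw [h3, h4, mul_one, one_mul]
    _ = segmentResolvent v' t * (-((t : ℂ) • (v' - v))) * segmentResolvent v t := by
        rw [mul_assoc, ← mul_sub, ← sub_mul, ← mul_assoc]
        congr 2
        simp only [smul_sub]; abel
    _ = _ := by rw [mul_neg, neg_mul, mul_smul_comm, smul_mul_assoc]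

/-- The derivative of `unitaryLog` at `v` in the direction `D`. -/
noncomputable def unitaryLogDeriv (v D : H →L[ℂ] H) : H →L[ℂ] H :=
  ∫ t in (0 : ℝ)..1, segmentResolvent v t * D * segmentResolvent v t

theorem frameNorm_mul_mul_le {q : ℝ} (hq : 2 ≤ q) (x y z : H →L[ℂ] H) :
    frameNorm q (x * y * z) ≤ ‖x‖ₑ * frameNorm q y * ‖z‖ₑ :=
  (frameNorm_mul_le' hq).trans (mul_le_mul_left (frameNorm_mul_le (by linarith)) _)

theorem frameNorm_unitaryLogDeriv_lt_top {q : ℝ} (hq : 2 ≤ q) {v D : H →L[ℂ] H}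
    (hv : v ∈ unitary (H →L[ℂ] H)) (h2 : ‖v - 1‖ < 2) (hD : frameNorm q D < ∞) :
    frameNorm q (unitaryLogDeriv v D) < ∞ := by
  have hR := continuousOn_segmentResolvent hv h2
  refine (frameNorm_integral_le (C := ENNReal.ofReal (segmentBound ‖v - 1‖) * frameNorm q D *
    ENNReal.ofReal (segmentBound ‖v - 1‖)) (by linarith) ((hR.mul continuousOn_const).mul hR)
    fun t ht => ?_).trans_lt (ENNReal.mul_lt_top (ENNReal.mul_lt_top ENNReal.ofReal_lt_top hD)
      ENNReal.ofReal_lt_top)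
  have hb : ‖segmentResolvent v t‖ₑ ≤ ENNReal.ofReal (segmentBound ‖v - 1‖) := by
    rw [← ofReal_norm]
    exact ENNReal.ofReal_le_ofReal (norm_segmentResolvent_le hv le_rfl h2 ht)
  refine (frameNorm_mul_mul_le hq _ _ _).trans ?_
  gcongr

/-- The slope of the logarithm is ∫ R_t (slope of V) R_s. Replacing the slope by D costs its
frame-norm error, and replacing R_t by R_s costs a multiple of ‖V t - V s‖. The common radius r < 2
bounds all resolvents uniformly. -/
theorem hasFrameDerivWithin_unitaryLog {q r : ℝ} (hq : 2 ≤ q) (hr : r < 2) {V : ℝ → H →L[ℂ] H}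
    {D : H →L[ℂ] H} {S : Set ℝ} {s : ℝ} (hs : s ∈ S)
    (hV : ∀ t ∈ S, V t ∈ unitary (H →L[ℂ] H) ∧ ‖V t - 1‖ ≤ r)
    (h : HasFrameDerivWithin q V D S s) (hD : frameNorm q D < ∞) :
    HasFrameDerivWithin q (fun t => unitaryLog (V t)) (unitaryLogDeriv (V s) D) S s := by
  have hq1 : 1 ≤ q := by linarith
  have hq0 : 0 < q := by linarith
  set C : ℝ≥0∞ := ENNReal.ofReal (segmentBound r) with hC
  have hb : ∀ t ∈ S, ∀ τ ∈ Icc (0 : ℝ) 1, ‖segmentResolvent (V t) τ‖ₑ ≤ C := fun t ht τ hτ => by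
    rw [← ofReal_norm]
    exact ENNReal.ofReal_le_ofReal (norm_segmentResolvent_le (hV t ht).1 (hV t ht).2 hr hτ)
  have hs2 := (hV s hs).2.trans_lt hr
  have hRs := continuousOn_segmentResolvent (hV s hs).1 hs2
  have key : ∀ t ∈ S, frameNorm q (slope (fun t => unitaryLog (V t)) s t -
      unitaryLogDeriv (V s) D) ≤ C * frameNorm q (slope V s t - D) * C +
        C * ‖V t - V s‖ₑ * C * frameNorm q D * C := by
    intro t ht
    have ht2 := (hV t ht).2.trans_lt hr
    have hRt := continuousOn_segmentResolvent (hV t ht).1 ht2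
    have e1 : slope (fun t => unitaryLog (V t)) s t =
        ∫ τ in (0 : ℝ)..1, segmentResolvent (V t) τ * slope V s t * segmentResolvent (V s) τ := by
      rw [slope_def_module, unitaryLog_sub_unitaryLog (hV s hs).1 hs2 (hV t ht).1 ht2,
        ← intervalIntegral.integral_smul]
      refine intervalIntegral.integral_congr fun τ _ => ?_
      simp only [slope_def_module, mul_smul_comm, smul_mul_assoc]
    have c1 : ContinuousOn (fun τ => segmentResolvent (V t) τ * slope V s t *
        segmentResolvent (V s) τ) (Icc 0 1) := (hRt.mul continuousOn_const).mul hRs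
    have c2 : ContinuousOn (fun τ => segmentResolvent (V s) τ * D *
        segmentResolvent (V s) τ) (Icc 0 1) := (hRs.mul continuousOn_const).mul hRs
    rw [e1, unitaryLogDeriv, ← intervalIntegral.integral_sub
      (c1.intervalIntegrable_of_Icc zero_le_one) (c2.intervalIntegrable_of_Icc zero_le_one)]
    refine frameNorm_integral_le hq1 (c1.sub c2) fun τ hτ => ?_
    have e2 : segmentResolvent (V t) τ * slope V s t * segmentResolvent (V s) τ -
        segmentResolvent (V s) τ * D * segmentResolvent (V s) τ =
        segmentResolvent (V t) τ * (slope V s t - D) * segmentResolvent (V s) τ +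
        (segmentResolvent (V t) τ - segmentResolvent (V s) τ) * D * segmentResolvent (V s) τ := by
      simp only [mul_sub, sub_mul]; abel
    rw [e2]
    refine (frameNorm_add_le hq1).trans (add_le_add ((frameNorm_mul_mul_le hq _ _ _).trans ?_)
      ((frameNorm_mul_mul_le hq _ _ _).trans ?_))
    · gcongr
      · exact hb t ht τ hτ
      · exact hb s hs τ hτ
    · have hsub : ‖segmentResolvent (V t) τ - segmentResolvent (V s) τ‖ₑ ≤
          C * ‖V t - V s‖ₑ * C := by
        rw [segmentResolvent_sub_segmentResolvent (hV s hs).1 hs2 (hV t ht).1 ht2 hτ, enorm_neg,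
          enorm_smul]
        have h1 : ‖(τ : ℂ)‖ₑ ≤ 1 := by
          rw [← ofReal_norm, Complex.norm_real, Real.norm_of_nonneg hτ.1]
          exact ENNReal.ofReal_le_one.2 hτ.2
        refine (mul_le_mul_left h1 _).trans ?_
        rw [one_mul]
        have hmul : ∀ x y : H →L[ℂ] H, ‖x * y‖ₑ ≤ ‖x‖ₑ * ‖y‖ₑ := fun x y => by
          rw [← ofReal_norm, ← ofReal_norm, ← ofReal_norm, ← ENNReal.ofReal_mul (norm_nonneg _)]
          exact ENNReal.ofReal_le_ofReal (norm_mul_le _ _)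
        refine (hmul _ _).trans ?_
        gcongr
        · refine (hmul _ _).trans ?_
          gcongr
          exact hb t ht τ hτ
        · exact hb s hs τ hτ
      gcongr
      exact hb s hs τ hτ
  have hCt : C ≠ ∞ := ENNReal.ofReal_ne_top
  have l1 : Tendsto (fun t => C * frameNorm q (slope V s t - D) * C) (𝓝[S \ {s}] s) (𝓝 0) := by
    have := ENNReal.Tendsto.mul_const (b := C)
      (ENNReal.Tendsto.const_mul (a := C) h (Or.inr hCt)) (Or.inr hCt)
    simpa using this
  have l2 : Tendsto (fun t => ‖V t - V s‖ₑ) (𝓝[S \ {s}] s) (𝓝 0) := by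
    have h1 := (h.tendsto_frameNorm_sub hq1 hD).mono_left
      (nhdsWithin_mono s (sdiff_subset (s := S) (t := {s})))
    exact tendsto_of_tendsto_of_tendsto_of_le_of_le tendsto_const_nhds h1 (fun _ => bot_le)
      fun t => enorm_le_frameNorm hq0
  have l3 : Tendsto (fun t => C * ‖V t - V s‖ₑ * C * frameNorm q D * C) (𝓝[S \ {s}] s) (𝓝 0) := by
    have := ENNReal.Tendsto.mul_const (b := C) (ENNReal.Tendsto.mul_const (b := frameNorm q D)
      (ENNReal.Tendsto.mul_const (b := C)
      (ENNReal.Tendsto.const_mul (a := C) l2 (Or.inr hCt)) (Or.inr hCt)) (Or.inr hD.ne))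
      (Or.inr hCt)
    simpa using this
  have l4 := l1.add l3
  rw [add_zero] at l4
  refine tendsto_of_tendsto_of_tendsto_of_le_of_le' tendsto_const_nhds l4
    (Eventually.of_forall fun _ => bot_le) ?_
  filter_upwards [self_mem_nhdsWithin] with t ht using key t ht.1

end LogDeriv

/-! ### The derivative of the logarithm as a Schur multiplier -/

section Matrix

universe u

variable {H : Type u} [NormedAddCommGroup H] [InnerProductSpace ℂ H] [CompleteSpace H]

theorem arg_exp_mul_I {x : ℝ} (hx : |x| < Real.pi) :
    Complex.log (Complex.exp (x * Complex.I)) = x * Complex.I := by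
  rw [abs_lt] at hx
  exact Complex.log_exp (by simpa using hx.1) (by simpa using hx.2.le)

theorem exp_mul_I_mem_slitPlane {x : ℝ} (hx : |x| < Real.pi) :
    Complex.exp (x * Complex.I) ∈ Complex.slitPlane := by
  rw [Complex.mem_slitPlane_iff_arg]
  refine ⟨?_, Complex.exp_ne_zero _⟩
  rw [abs_lt] at hx
  rw [Complex.arg_exp_mul_I, toIocMod_eq_self .. |>.2 ⟨hx.1, by linarith⟩]
  exact hx.2.ne

/-- Partial fractions reduce the integral Q to logarithms: Q(B - A) = i(b - a). For d = b - a ≠ 0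
this gives ρ = id/(e^{id} - 1), with real part (d/2) cot(d/2) ≥ 0 as |d| < π. For a = b the
antiderivative t/(1 + t(A-1)) gives ρ = 1. -/
theorem exists_integral_inv_mul_inv_eq {a b : ℝ} (ha : |a| < Real.pi / 2) (hb : |b| < Real.pi / 2) :
    ∃ ρ : ℂ, (∫ t in (0 : ℝ)..1, (1 + (t : ℂ) * (Complex.exp (a * Complex.I) - 1))⁻¹ *
      (1 + (t : ℂ) * (Complex.exp (b * Complex.I) - 1))⁻¹) * Complex.exp (a * Complex.I) = ρ ∧
      0 ≤ ρ.re ∧ (a = b → ρ = 1) := by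
  have hpi := Real.pi_pos
  have ha' : |a| < Real.pi := by linarith
  have hb' : |b| < Real.pi := by linarith
  set A := Complex.exp (a * Complex.I)
  set B := Complex.exp (b * Complex.I)
  set Q := ∫ t in (0 : ℝ)..1, (1 + (t : ℂ) * (A - 1))⁻¹ * (1 + (t : ℂ) * (B - 1))⁻¹
  have hne : ∀ {x : ℝ}, |x| < Real.pi → ∀ t ∈ uIcc (0 : ℝ) 1,
      1 + (t : ℂ) * (Complex.exp (x * Complex.I) - 1) ≠ 0 := fun hx t ht =>
    one_add_mul_ne_zero_of_mem_slitPlane (exp_mul_I_mem_slitPlane hx)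
      (by rwa [uIcc_of_le zero_le_one] at ht)
  have hcont : ∀ {x : ℝ}, |x| < Real.pi → ContinuousOn
      (fun t : ℝ => (1 + (t : ℂ) * (Complex.exp (x * Complex.I) - 1))⁻¹) (uIcc 0 1) := fun hx =>
    ContinuousOn.inv₀ (by fun_prop) (hne hx)
  have hlog : ∀ {x : ℝ}, |x| < Real.pi → ∫ t in (0 : ℝ)..1, (Complex.exp (x * Complex.I) - 1) *
      (1 + (t : ℂ) * (Complex.exp (x * Complex.I) - 1))⁻¹ = (x : ℂ) * Complex.I := by
    intro x hx
    have h3 := Complex.log_eq_integral (z := Complex.exp (x * Complex.I) - 1)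
      (by simpa using exp_mul_I_mem_slitPlane hx)
    rw [add_sub_cancel, arg_exp_mul_I hx] at h3
    rw [intervalIntegral.integral_const_mul]
    refine Eq.trans ?_ h3.symm
    simp
  have hQ : Q * (B - A) = ((b - a : ℝ) : ℂ) * Complex.I := by
    have e1 : ((b - a : ℝ) : ℂ) * Complex.I = (b : ℂ) * Complex.I - (a : ℂ) * Complex.I := by
      push_cast; ring
    have i1 : ∀ {x : ℝ}, |x| < Real.pi → IntervalIntegrable (fun t : ℝ =>
        (Complex.exp (x * Complex.I) - 1) * (1 + (t : ℂ) * (Complex.exp (x * Complex.I) - 1))⁻¹)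
        MeasureTheory.volume 0 1 := fun hx => (continuousOn_const.mul (hcont hx)).intervalIntegrable
    rw [e1, ← hlog hb', ← hlog ha', ← intervalIntegral.integral_sub (i1 hb') (i1 ha'),
      ← intervalIntegral.integral_mul_const]
    refine intervalIntegral.integral_congr fun t ht => ?_
    have h1 : 1 + (t : ℂ) * (A - 1) ≠ 0 := hne ha' t ht
    have h2 : 1 + (t : ℂ) * (B - 1) ≠ 0 := hne hb' t ht
    change (1 + (t : ℂ) * (A - 1))⁻¹ * (1 + (t : ℂ) * (B - 1))⁻¹ * (B - A) =
      (B - 1) * (1 + (t : ℂ) * (B - 1))⁻¹ - (A - 1) * (1 + (t : ℂ) * (A - 1))⁻¹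
    generalize B = B at *
    generalize A = A at *
    field_simp
    ring
  have hdiag : a = b → Q * A = 1 := by
    intro hab
    have hAB : B = A := by simp only [A, B, hab]
    have hd : ∀ t ∈ uIcc (0 : ℝ) 1, HasDerivAt (fun t : ℝ => (t : ℂ) * (1 + (t : ℂ) * (A - 1))⁻¹)
        ((1 + (t : ℂ) * (A - 1))⁻¹ * (1 + (t : ℂ) * (A - 1))⁻¹) t := by
      intro t ht
      have h0 : HasDerivAt (fun t : ℝ => (t : ℂ)) 1 t := Complex.ofRealCLM.hasDerivAt
      have h1 : HasDerivAt (fun t : ℝ => 1 + (t : ℂ) * (A - 1)) (1 * (A - 1)) t :=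
        (h0.mul_const _).const_add 1
      have h3 : 1 + (t : ℂ) * (A - 1) ≠ 0 := hne ha' t ht
      refine (h0.mul (h1.inv h3)).congr_deriv ?_
      change 1 * (1 + (t : ℂ) * (A - 1))⁻¹ + t * (-(1 * (A - 1)) / (1 + (t : ℂ) * (A - 1)) ^ 2) = _
      generalize A = A at *
      field_simp
      ring
    have h4 := intervalIntegral.integral_eq_sub_of_hasDerivAt hd
      ((hcont ha').mul (hcont ha')).intervalIntegrable
    have h5 : Q = A⁻¹ := by
      simp only [Q, hAB]
      rw [h4]; simp
    rw [h5, inv_mul_cancel₀ (Complex.exp_ne_zero _)]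
  refine ⟨_, rfl, ?_, hdiag⟩
  rcases eq_or_ne a b with hab | hab
  · rw [hdiag hab]; simp
  set d := b - a with hd
  have hBA : B = A * Complex.exp (d * Complex.I) := by
    simp only [A, B, ← Complex.exp_add, hd]
    congr 1
    push_cast
    ring
  have hρ : Q * A * (Complex.exp (d * Complex.I) - 1) = d * Complex.I := by
    refine Eq.trans ?_ hQ
    rw [hBA, mul_assoc, mul_sub, mul_one]
  rw [Complex.exp_mul_I, ← Complex.ofReal_cos, ← Complex.ofReal_sin] at hρ
  have hre := congrArg Complex.re hρ
  have him := congrArg Complex.im hρ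
  simp only [Complex.mul_re, Complex.mul_im, Complex.sub_re, Complex.sub_im, Complex.add_re,
    Complex.add_im, Complex.ofReal_re, Complex.ofReal_im, Complex.I_re, Complex.I_im,
    Complex.one_re, Complex.one_im] at hre him
  simp only [← Complex.mul_re, ← Complex.mul_im] at hre him
  set x := (Q * A).re with hx
  set y := (Q * A).im with hy
  have hd0 : d ≠ 0 := sub_ne_zero.2 (Ne.symm hab)
  have hsin : 0 ≤ d * Real.sin d := by
    rw [abs_lt] at ha hb
    rcases le_total 0 d with h | h
    · exact mul_nonneg h (Real.sin_nonneg_of_nonneg_of_le_pi h (by linarith))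
    · exact mul_nonneg_of_nonpos_of_nonpos h (Real.sin_nonpos_of_nonpos_of_neg_pi_le h (by linarith))
  have hC := Real.sin_sq_add_cos_sq d
  -- This is the real part of ρ(e^{id} - 1) = id multiplied by the conjugate of e^{id} - 1.
  have hx2 : x * (2 - 2 * Real.cos d) = d * Real.sin d := by
    linear_combination (Real.cos d - 1) * hre + Real.sin d * him - x * hC
  rcases (sub_nonneg.2 (Real.cos_le_one d)).lt_or_eq with hlt | heq
  · by_contra hneg
    nlinarith [mul_pos_of_neg_of_neg (not_le.1 hneg) (neg_lt_zero.2 hlt)]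
  · have h1 : Real.cos d = 1 := by linarith
    have h2 : Real.sin d = 0 := by
      rw [h1] at hC
      exact pow_eq_zero_iff two_ne_zero |>.1 (by linarith)
    rw [h1, h2] at him
    exact absurd (by linarith) hd0

variable {v : H →L[ℂ] H}

theorem segmentResolvent_apply_of_apply_eq_smul (hv : v ∈ unitary (H →L[ℂ] H)) (h2 : ‖v - 1‖ < 2)
    {t : ℝ} (ht : t ∈ Icc (0 : ℝ) 1) {μ : ℂ} {e : H} (he : v e = μ • e)
    (hμ : 1 + (t : ℂ) * (μ - 1) ≠ 0) :
    segmentResolvent v t e = (1 + (t : ℂ) * (μ - 1))⁻¹ • e := by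
  have h1 := congrArg (fun T : H →L[ℂ] H => T e) (segmentResolvent_mul hv h2 ht)
  have h3 : (1 + (t : ℂ) • (v - 1)) e = (1 + (t : ℂ) * (μ - 1)) • e := by
    simp [he, add_smul, mul_smul, sub_smul]
  simp only [mul_apply_eq_comp, h3, map_smul, one_apply_eq_self] at h1
  rw [← h1, smul_smul, inv_mul_cancel₀ hμ, h1, one_smul]

theorem inner_segmentResolvent_of_apply_eq_smul (hv : v ∈ unitary (H →L[ℂ] H)) (h2 : ‖v - 1‖ < 2)
    {t : ℝ} (ht : t ∈ Icc (0 : ℝ) 1) {μ : ℂ} {e : H} (he : ∀ x, inner ℂ e (v x) = μ * inner ℂ e x)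
    (hμ : 1 + (t : ℂ) * (μ - 1) ≠ 0) (x : H) :
    inner ℂ e (segmentResolvent v t x) = (1 + (t : ℂ) * (μ - 1))⁻¹ * inner ℂ e x := by
  have h1 := congrArg (fun T : H →L[ℂ] H => inner ℂ e (T x)) (mul_segmentResolvent hv h2 ht)
  simp only [mul_apply_eq_comp, add_apply, smul_apply, sub_apply, one_apply_eq_self, inner_add_right,
    inner_smul_right, inner_sub_right, he] at h1
  rw [← h1]
  field_simp

/-- In an eigenbasis of `unitaryArg v`, the derivative of the logarithm at `v` acts as a Schur
multiplier whose symbol has nonnegative real part. -/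
theorem exists_inner_unitaryLogDeriv_eq (hv : v ∈ unitary (H →L[ℂ] H)) (h2 : ‖v - 1‖ < 2)
    {e₁ e₂ : H} {l₁ l₂ : ℝ} (h₁ : v e₁ = Complex.exp (l₁ * Complex.I) • e₁)
    (h₂ : v e₂ = Complex.exp (l₂ * Complex.I) • e₂) (hl₁ : |l₁| < Real.pi / 2)
    (hl₂ : |l₂| < Real.pi / 2) (z : H →L[ℂ] H) :
    ∃ ρ : ℂ, inner ℂ e₁ (unitaryLogDeriv v (v * z) e₂) = ρ * inner ℂ e₁ (z e₂) ∧
      0 ≤ ρ.re ∧ (l₁ = l₂ → ρ = 1) := by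
  obtain ⟨ρ, hρ, hre, hdiag⟩ := exists_integral_inv_mul_inv_eq hl₁ hl₂
  refine ⟨ρ, ?_, hre, hdiag⟩
  have hpi := Real.pi_pos
  have hne : ∀ {x : ℝ}, |x| < Real.pi / 2 → ∀ t ∈ uIcc (0 : ℝ) 1,
      1 + (t : ℂ) * (Complex.exp (x * Complex.I) - 1) ≠ 0 := fun hx t ht =>
    one_add_mul_ne_zero_of_mem_slitPlane (exp_mul_I_mem_slitPlane (by linarith))
      (by rwa [uIcc_of_le zero_le_one] at ht)
  have hadj : ∀ x, inner ℂ e₁ (v x) = Complex.exp (l₁ * Complex.I) * inner ℂ e₁ x := by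
    intro x
    have e1 : star v e₁ = Complex.exp (-(l₁ * Complex.I)) • e₁ := by
      have e2 : star v (v e₁) = e₁ := by
        rw [← mul_apply_eq_comp, (Unitary.mem_iff.1 hv).1, one_apply_eq_self]
      rw [h₁, map_smul] at e2
      calc star v e₁ = Complex.exp (-(l₁ * Complex.I)) • Complex.exp (l₁ * Complex.I) • star v e₁ := by
            rw [smul_smul, ← Complex.exp_add]; simp
        _ = _ := by rw [e2]
    rw [← inner_star_apply_left, e1, inner_smul_left, ← Complex.exp_conj]
    simp
  have hR := continuousOn_segmentResolvent hv h2
  have hint : IntervalIntegrable (fun t => segmentResolvent v t * (v * z) * segmentResolvent v t)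
      MeasureTheory.volume 0 1 :=
    ((hR.mul continuousOn_const).mul hR).intervalIntegrable_of_Icc zero_le_one
  have h3 := ((innerSL ℂ e₁).comp (ContinuousLinearMap.apply ℂ H e₂)).intervalIntegral_comp_comm hint
  have h4 : inner ℂ e₁ (unitaryLogDeriv v (v * z) e₂) = ∫ t in (0 : ℝ)..1,
      inner ℂ e₁ ((segmentResolvent v t * (v * z) * segmentResolvent v t) e₂) := h3.symm
  -- The factor e^{il₁} in ρ comes from the v in the direction v z, moved onto the left eigenvector
  -- e₁.
  rw [h4, ← hρ, mul_assoc, ← hadj, ← intervalIntegral.integral_mul_const]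
  refine intervalIntegral.integral_congr fun t ht => ?_
  have ht' : t ∈ Icc (0 : ℝ) 1 := by rwa [uIcc_of_le zero_le_one] at ht
  simp only [mul_apply_eq_comp]
  rw [inner_segmentResolvent_of_apply_eq_smul hv h2 ht' hadj (hne hl₁ t ht),
    segmentResolvent_apply_of_apply_eq_smul hv h2 ht' h₂ (hne hl₂ t ht)]
  simp only [map_smul, inner_smul_right]
  ring

end Matrix

/-! ### Products and powers of differentiable curves -/

section FrameDerivMul

universe u

variable {H : Type u} [NormedAddCommGroup H] [InnerProductSpace ℂ H] [CompleteSpace H]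
  {A B : ℝ → H →L[ℂ] H} {A' B' : H →L[ℂ] H} {S : Set ℝ} {s : ℝ}

/-- The usual Leibniz decomposition of the slope, each term being estimated by Hölder's inequality.
-/
theorem HasFrameDerivWithin.mul {q₁ q₂ r : ℝ} (hr : 2 ≤ r) (hq₁ : 1 ≤ q₁) (hq₂ : 1 ≤ q₂)
    (h : r⁻¹ = q₁⁻¹ + q₂⁻¹) (hA : HasFrameDerivWithin q₁ A A' S s)
    (hB : HasFrameDerivWithin q₂ B B' S s) (hAs : frameNorm q₁ (A s) < ∞)
    (hA' : frameNorm q₁ A' < ∞) (hBs : frameNorm q₂ (B s) < ∞) (hB' : frameNorm q₂ B' < ∞) :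
    HasFrameDerivWithin r (fun t => A t * B t) (A s * B' + A' * B s) S s := by
  have hr1 : 1 ≤ r := by linarith
  have hq₁' : 0 < q₁ := by linarith
  have hq₂' : 0 < q₂ := by linarith
  have holder : ∀ {x y : H →L[ℂ] H}, frameNorm q₁ x < ∞ →
      frameNorm r (x * y) ≤ frameNorm q₁ x * frameNorm q₂ y := fun hx =>
    frameNorm_mul_le_mul hr hq₁' hq₂' h hx
  have hBt := (hB.tendsto_frameNorm_sub hq₂ hB').mono_left
    (nhdsWithin_mono s (sdiff_subset (s := S) (t := {s})))
  have hlim : Tendsto (fun t => frameNorm q₁ (slope A s t - A') *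
      (frameNorm q₂ (B t - B s) + frameNorm q₂ (B s)) + (frameNorm q₁ A' * frameNorm q₂ (B t - B s) +
      frameNorm q₁ (A s) * frameNorm q₂ (slope B s t - B'))) (𝓝[S \ {s}] s) (𝓝 0) := by
    have l1 := ENNReal.Tendsto.mul hA (Or.inr (by simpa using hBs.ne))
      (hBt.add_const (frameNorm q₂ (B s))) (Or.inr (by simp))
    have l2 := ENNReal.Tendsto.const_mul (a := frameNorm q₁ A') hBt (Or.inr hA'.ne)
    have l3 := ENNReal.Tendsto.const_mul (a := frameNorm q₁ (A s)) hB (Or.inr hAs.ne)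
    simpa using l1.add (l2.add l3)
  refine tendsto_of_tendsto_of_tendsto_of_le_of_le' tendsto_const_nhds hlim
    (Eventually.of_forall fun _ => bot_le) ?_
  -- Hölder's inequality requires a left factor of finite norm; near s the error of the slope of A
  -- has norm below 1.
  filter_upwards [hA.eventually (gt_mem_nhds one_pos)] with t ht
  have e : slope (fun t => A t * B t) s t - (A s * B' + A' * B s) =
      (slope A s t - A') * B t + (A' * (B t - B s) + A s * (slope B s t - B')) := by
    have e1 : slope (fun t => A t * B t) s t = slope A s t * B t + A s * slope B s t := by
      simp only [slope_def_module, smul_mul_assoc, mul_smul_comm, ← smul_add, sub_mul, mul_sub]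
      congr 1
      abel
    rw [e1]
    simp only [sub_mul, mul_sub]
    abel
  rw [e]
  refine (frameNorm_add_le hr1).trans (add_le_add ((holder (ht.trans ENNReal.one_lt_top)).trans ?_)
    ((frameNorm_add_le hr1).trans (add_le_add (holder hA') (holder hAs))))
  gcongr
  refine le_trans (le_of_eq ?_) (frameNorm_add_le hq₂)
  rw [sub_add_cancel]

theorem HasFrameDerivWithin.mul_const {q₁ q₂ r : ℝ} (hr : 2 ≤ r) (hq₁ : 1 ≤ q₁) (hq₂ : 1 ≤ q₂)
    (h : r⁻¹ = q₁⁻¹ + q₂⁻¹) (hA : HasFrameDerivWithin q₁ A A' S s) (hAs : frameNorm q₁ (A s) < ∞)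
    (hA' : frameNorm q₁ A' < ∞) {y : H →L[ℂ] H} (hy : frameNorm q₂ y < ∞) :
    HasFrameDerivWithin r (fun t => A t * y) (A' * y) S s := by
  have h0 : frameNorm q₂ (0 : H →L[ℂ] H) = 0 := frameNorm_zero (by linarith)
  have hB : HasFrameDerivWithin q₂ (fun _ => y) 0 S s := by
    have : (fun t : ℝ => frameNorm q₂ (slope (fun _ : ℝ => y) s t - 0)) = fun _ => 0 := by
      funext t; simp [slope_def_module, h0]
    rw [HasFrameDerivWithin, this]
    exact tendsto_const_nhds
  have := hA.mul hr hq₁ hq₂ h hB hAs hA' hy (by simp [h0])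
  simpa using this

/-- The derivative of `x ↦ x ^ k` at `x` in the direction `y`. -/
def powDeriv (x y : H →L[ℂ] H) : ℕ → H →L[ℂ] H
  | 0 => 0
  | k + 1 => x ^ k * y + powDeriv x y k * x

theorem frameNorm_mul_lt_top {q₁ q₂ r : ℝ} (hr : 2 ≤ r) (hq₁ : 0 < q₁) (hq₂ : 0 < q₂)
    (h : r⁻¹ = q₁⁻¹ + q₂⁻¹) {x y : H →L[ℂ] H} (hx : frameNorm q₁ x < ∞) (hy : frameNorm q₂ y < ∞) :
    frameNorm r (x * y) < ∞ :=
  (frameNorm_mul_le_mul hr hq₁ hq₂ h hx).trans_lt (ENNReal.mul_lt_top hx hy)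

theorem exponent_add_one {q : ℝ} {k : ℕ} : (q / (k + 1 : ℕ))⁻¹ = (q / k)⁻¹ + q⁻¹ := by
  rw [inv_div, inv_div]
  push_cast
  ring

theorem two_le_exponent {q : ℝ} {k : ℕ} (hk : 0 < k) (hkq : 2 * k ≤ q) : 2 ≤ q / k := by
  have : (0 : ℝ) < k := by exact_mod_cast hk
  rwa [le_div_iff₀ this]

theorem frameNorm_pow_lt_top {q : ℝ} {x : H →L[ℂ] H} (hx : frameNorm q x < ∞) {k : ℕ} (hk : 0 < k)
    (hkq : 2 * k ≤ q) : frameNorm (q / k) (x ^ k) < ∞ := by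
  induction k, hk using Nat.le_induction with
  | base => simpa using hx
  | succ k hk ih =>
    have hk' : (1 : ℝ) ≤ k := by exact_mod_cast hk
    have h2 := two_le_exponent (Nat.succ_pos k) hkq
    push_cast at hkq
    have h1 := two_le_exponent hk (by linarith : 2 * (k : ℝ) ≤ q)
    rw [pow_succ]
    exact frameNorm_mul_lt_top h2 (by linarith) (by linarith) exponent_add_one (ih (by linarith)) hx

theorem frameNorm_powDeriv_lt_top {q : ℝ} {x y : H →L[ℂ] H} (hx : frameNorm q x < ∞)
    (hy : frameNorm q y < ∞) {k : ℕ} (hk : 0 < k) (hkq : 2 * k ≤ q) :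
    frameNorm (q / k) (powDeriv x y k) < ∞ := by
  induction k, hk using Nat.le_induction with
  | base => simpa [powDeriv] using hy
  | succ k hk ih =>
    have hk' : (1 : ℝ) ≤ k := by exact_mod_cast hk
    have h2 := two_le_exponent (Nat.succ_pos k) hkq
    push_cast at hkq
    have h1 := two_le_exponent hk (by linarith : 2 * (k : ℝ) ≤ q)
    refine (frameNorm_add_le (by linarith)).trans_lt (ENNReal.add_lt_top.2 ⟨?_, ?_⟩)
    · exact frameNorm_mul_lt_top h2 (by linarith) (by linarith) exponent_add_one
        (frameNorm_pow_lt_top hx hk (by linarith)) hy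
    · exact frameNorm_mul_lt_top h2 (by linarith) (by linarith) exponent_add_one
        (ih (by linarith)) hx

/-- Each multiplication by A lowers the exponent from q/k to q/(k+1); the condition 2k ≤ q keeps it
at least 2, where Hölder's inequality is available. -/
theorem HasFrameDerivWithin.pow {q : ℝ} (hA : HasFrameDerivWithin q A A' S s)
    (hAs : frameNorm q (A s) < ∞) (hA' : frameNorm q A' < ∞) {k : ℕ} (hk : 0 < k)
    (hkq : 2 * k ≤ q) :
    HasFrameDerivWithin (q / k) (fun t => A t ^ k) (powDeriv (A s) A' k) S s := by
  induction k, hk using Nat.le_induction with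
  | base => simpa [powDeriv] using hA
  | succ k hk ih =>
    have hk' : (1 : ℝ) ≤ k := by exact_mod_cast hk
    have h2 := two_le_exponent (Nat.succ_pos k) hkq
    push_cast at hkq
    have hkq' : 2 * (k : ℝ) ≤ q := by linarith
    have h1 := two_le_exponent hk hkq'
    simp only [pow_succ]
    exact (ih hkq').mul h2 (by linarith) (by linarith) exponent_add_one hA
      (frameNorm_pow_lt_top hAs hk hkq') (frameNorm_powDeriv_lt_top hAs hA' hk hkq') hAs hA'

omit [CompleteSpace H] in
theorem pow_apply_of_apply_eq_smul {x : H →L[ℂ] H} {e : H} {l : ℝ} (h : x e = (l : ℂ) • e) (k : ℕ) :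
    (x ^ k) e = ((l ^ k : ℝ) : ℂ) • e := by
  induction k with
  | zero => simp
  | succ k ih =>
    rw [pow_succ, mul_apply_eq_comp, h, map_smul, ih, smul_smul, pow_succ']
    push_cast; rfl

theorem inner_pow_of_apply_eq_smul {x : H →L[ℂ] H} (hx : IsSelfAdjoint x) {e : H} {l : ℝ}
    (h : x e = (l : ℂ) • e) (k : ℕ) (v : H) :
    inner ℂ e ((x ^ k) v) = ((l ^ k : ℝ) : ℂ) * inner ℂ e v := by
  rw [← inner_star_apply_left, (hx.pow k).star_eq, pow_apply_of_apply_eq_smul h, inner_smul_left,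
    Complex.conj_ofReal]

/-- In an eigenbasis of `x`, the derivative of the power is a Schur multiplier. -/
theorem inner_powDeriv {x y : H →L[ℂ] H} (hx : IsSelfAdjoint x) {e₁ e₂ : H} {l₁ l₂ : ℝ}
    (h₁ : x e₁ = (l₁ : ℂ) • e₁) (h₂ : x e₂ = (l₂ : ℂ) • e₂) (k : ℕ) :
    inner ℂ e₁ (powDeriv x y k e₂) =
      ((∑ a ∈ Finset.range k, l₁ ^ a * l₂ ^ (k - 1 - a) : ℝ) : ℂ) * inner ℂ e₁ (y e₂) := by
  induction k with
  | zero => simp [powDeriv]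
  | succ k ih =>
    have h3 : ∑ a ∈ Finset.range (k + 1), l₁ ^ a * l₂ ^ (k + 1 - 1 - a) =
        l₁ ^ k + l₂ * ∑ a ∈ Finset.range k, l₁ ^ a * l₂ ^ (k - 1 - a) := by
      rw [Finset.sum_range_succ, Finset.mul_sum, add_comm]
      congr 1
      · simp
      · refine Finset.sum_congr rfl fun a ha => ?_
        have : k + 1 - 1 - a = (k - 1 - a) + 1 := by
          have := Finset.mem_range.1 ha
          omega
        rw [this, pow_succ]; ring
    rw [h3, powDeriv, add_apply, mul_apply_eq_comp, mul_apply_eq_comp, inner_add_right,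
      inner_pow_of_apply_eq_smul hx h₁, h₂, map_smul, inner_smul_right, ih]
    push_cast; ring

end FrameDerivMul

/-! ### The Hilbert–Schmidt pairing -/

section HilbertSchmidt

universe u

variable {H : Type u} [NormedAddCommGroup H] [InnerProductSpace ℂ H] [CompleteSpace H]
  {ι κ : Type*} {x y : H →L[ℂ] H}

theorem tsum_enorm_apply_sq_eq (b : HilbertBasis ι ℂ H) (c : HilbertBasis κ ℂ H) (x : H →L[ℂ] H) :
    ∑' i, ‖x (b i)‖ₑ ^ 2 = ∑' k, ‖star x (c k)‖ₑ ^ 2 := by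
  simp_rw [← fun i => c.tsum_enorm_inner_sq (x (b i)), ← fun k => b.tsum_enorm_inner_sq (star x (c k))]
  rw [ENNReal.tsum_comm]
  refine tsum_congr fun k => tsum_congr fun i => ?_
  rw [enorm_inner_comm, inner_star_apply_right]

/-- Parseval gives ∑ ‖x bᵢ‖² = ∑ ‖x⋆c_k‖² for any two Hilbert bases, so for exponent 2 every basis
gives the value attained at a singular one. -/
theorem frameSum_two_eq (b : HilbertBasis ι ℂ H) (hx : frameNorm 2 x < ∞) :
    frameSum 2 x = ∑' i, ‖x (b i)‖ₑ ^ 2 := by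
  obtain ⟨κ, c, hc⟩ := exists_singularBasis two_pos hx
  rw [hc.frameSum_eq le_rfl]
  simp only [ENNReal.rpow_ofNat]
  rw [tsum_enorm_apply_sq_eq c c, ← tsum_enorm_apply_sq_eq b c]

theorem memlp_apply (b : HilbertBasis ι ℂ H) (hx : frameNorm 2 x < ∞) :
    Memℓp (fun i => x (b i)) 2 := by
  rw [memℓp_gen_iff (by simp)]
  have h1 : ∑' i, ‖x (b i)‖ₑ ^ 2 ≠ ∞ := by
    rw [← frameSum_two_eq b hx]
    exact ((frameSum_lt_top_iff two_pos).2 hx).ne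
  have h2 := ENNReal.summable_toReal h1
  simpa using h2

open scoped Classical in
/-- The family `(x bᵢ)ᵢ` of a Hilbert–Schmidt operator as an element of `ℓ²`. -/
noncomputable def hsVec (b : HilbertBasis ι ℂ H) (x : H →L[ℂ] H) : lp (fun _ : ι => H) 2 :=
  if h : Memℓp (fun i => x (b i)) 2 then ⟨_, h⟩ else 0

variable {b : HilbertBasis ι ℂ H}

theorem hsVec_apply (hx : frameNorm 2 x < ∞) (i : ι) : hsVec b x i = x (b i) := by
  simp only [hsVec, dif_pos (memlp_apply b hx)]

theorem norm_hsVec_sq (hx : frameNorm 2 x < ∞) : ‖hsVec b x‖ ^ 2 = (frameSum 2 x).toReal := by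
  have h1 := lp.norm_rpow_eq_tsum (p := 2) (by simp) (hsVec b x)
  simp only [hsVec_apply hx, ENNReal.toReal_ofNat, Real.rpow_ofNat] at h1
  rw [h1, frameSum_two_eq b hx, ENNReal.tsum_toReal_eq fun i => by simp]
  simp

theorem norm_hsVec (hx : frameNorm 2 x < ∞) : ‖hsVec b x‖ = (frameNorm 2 x).toReal := by
  refine (sq_eq_sq₀ (norm_nonneg _) ENNReal.toReal_nonneg).1 ?_
  rw [norm_hsVec_sq hx, ← frameNorm_rpow two_pos]
  simp

theorem hsVec_add (hx : frameNorm 2 x < ∞) (hy : frameNorm 2 y < ∞) :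
    hsVec b (x + y) = hsVec b x + hsVec b y := by
  have h : frameNorm 2 (x + y) < ∞ :=
    (frameNorm_add_le one_le_two).trans_lt (ENNReal.add_lt_top.2 ⟨hx, hy⟩)
  ext i
  simp [hsVec_apply h, hsVec_apply hx, hsVec_apply hy]

omit [CompleteSpace H] in
theorem frameNorm_two_sub_lt_top (hx : frameNorm 2 x < ∞) (hy : frameNorm 2 y < ∞) :
    frameNorm 2 (x - y) < ∞ :=
  (frameNorm_sub_le one_le_two).trans_lt (ENNReal.add_lt_top.2 ⟨hx, hy⟩)

theorem hsVec_sub (hx : frameNorm 2 x < ∞) (hy : frameNorm 2 y < ∞) :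
    hsVec b (x - y) = hsVec b x - hsVec b y := by
  ext i
  simp [hsVec_apply (frameNorm_two_sub_lt_top hx hy), hsVec_apply hx, hsVec_apply hy]

theorem hsVec_real_smul (hx : frameNorm 2 x < ∞) (r : ℝ) :
    hsVec b (r • x) = r • hsVec b x := by
  have h : frameNorm 2 (r • x) < ∞ :=
    (frameNorm_real_smul_le two_pos r).trans_lt (ENNReal.mul_lt_top (by simp [enorm]) hx)
  ext i
  simp [hsVec_apply h, hsVec_apply hx]

/-- Hilbert–Schmidt operators embed isometrically in ℓ², so frame-norm derivatives become ordinary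
derivatives in a Hilbert space. -/
theorem HasFrameDerivWithin.hsVec {A : ℝ → H →L[ℂ] H} {A' : H →L[ℂ] H} {S : Set ℝ} {s : ℝ}
    (hA : HasFrameDerivWithin 2 A A' S s) (hfin : ∀ t ∈ S, frameNorm 2 (A t) < ∞) (hs : s ∈ S)
    (hA' : frameNorm 2 A' < ∞) (b : HilbertBasis ι ℂ H) :
    HasDerivWithinAt (fun t => hsVec b (A t)) (_root_.hsVec b A') S s := by
  rw [hasDerivWithinAt_iff_tendsto_slope, tendsto_iff_norm_sub_tendsto_zero]
  have h1 := (ENNReal.continuousAt_toReal ENNReal.zero_ne_top).tendsto.comp hA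
  rw [ENNReal.toReal_zero] at h1
  refine h1.congr' ?_
  filter_upwards [self_mem_nhdsWithin] with t ht
  have h2 := frameNorm_two_sub_lt_top (hfin t ht.1) (hfin s hs)
  have h3 : frameNorm 2 ((t - s)⁻¹ • (A t - A s)) < ∞ :=
    (frameNorm_real_smul_le two_pos _).trans_lt (ENNReal.mul_lt_top (by simp [enorm]) h2)
  simp only [Function.comp_apply, slope_def_module]
  rw [← hsVec_sub (hfin t ht.1) (hfin s hs), ← hsVec_real_smul h2, ← hsVec_sub h3 hA',
    norm_hsVec (frameNorm_two_sub_lt_top h3 hA')]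

/-- The real part of the Hilbert–Schmidt inner product. -/
noncomputable def hsRe (b : HilbertBasis ι ℂ H) (x y : H →L[ℂ] H) : ℝ :=
  (inner ℂ (hsVec b x) (hsVec b y)).re

omit [CompleteSpace H] in
theorem hsRe_comm (x y : H →L[ℂ] H) : hsRe b x y = hsRe b y x := inner_re_symm (𝕜 := ℂ) _ _

theorem hasSum_hsRe (hx : frameNorm 2 x < ∞) (hy : frameNorm 2 y < ∞) :
    HasSum (fun i => (inner ℂ (x (b i)) (y (b i))).re) (hsRe b x y) := by
  have h := (lp.hasSum_inner (𝕜 := ℂ) (hsVec b x) (hsVec b y)).mapL Complex.reCLM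
  simp only [hsVec_apply hx, hsVec_apply hy] at h
  exact h

theorem hsRe_self (hx : frameNorm 2 x < ∞) : hsRe b x x = (frameSum 2 x).toReal := by
  rw [← norm_hsVec_sq (b := b) hx]
  exact inner_self_eq_norm_sq (𝕜 := ℂ) _

theorem hsRe_eq_polarization (hx : frameNorm 2 x < ∞) (hy : frameNorm 2 y < ∞) :
    hsRe b x y = ((frameNorm 2 (x + y)).toReal * (frameNorm 2 (x + y)).toReal -
      (frameNorm 2 (x - y)).toReal * (frameNorm 2 (x - y)).toReal) / 4 := by
  have h1 : frameNorm 2 (x + y) < ∞ :=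
    (frameNorm_add_le one_le_two).trans_lt (ENNReal.add_lt_top.2 ⟨hx, hy⟩)
  rw [← norm_hsVec (b := b) h1, ← norm_hsVec (b := b) (frameNorm_two_sub_lt_top hx hy),
    hsVec_add hx hy, hsVec_sub hx hy]
  exact re_inner_eq_norm_add_mul_self_sub_norm_sub_mul_self_div_four (𝕜 := ℂ) _ _

/-- By polarization the pairing is determined by norms. This permits differentiating in a fixed
basis and evaluating in an eigenbasis that varies with the parameter. -/
theorem hsRe_eq (c : HilbertBasis κ ℂ H) (hx : frameNorm 2 x < ∞) (hy : frameNorm 2 y < ∞) :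
    hsRe b x y = hsRe c x y := by
  rw [hsRe_eq_polarization hx hy, hsRe_eq_polarization hx hy]

theorem HasFrameDerivWithin.hsRe {A B : ℝ → H →L[ℂ] H} {A' B' : H →L[ℂ] H} {S : Set ℝ} {s : ℝ}
    (hA : HasFrameDerivWithin 2 A A' S s) (hB : HasFrameDerivWithin 2 B B' S s)
    (hAfin : ∀ t ∈ S, frameNorm 2 (A t) < ∞) (hBfin : ∀ t ∈ S, frameNorm 2 (B t) < ∞) (hs : s ∈ S)
    (hA' : frameNorm 2 A' < ∞) (hB' : frameNorm 2 B' < ∞) (b : HilbertBasis ι ℂ H) :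
    HasDerivWithinAt (fun t => hsRe b (A t) (B t)) (_root_.hsRe b (A s) B' + _root_.hsRe b A' (B s))
      S s := by
  have h := (hA.hsVec hAfin hs hA' b).inner ℂ (hB.hsVec hBfin hs hB' b)
  exact (Complex.reCLM.hasFDerivAt.comp_hasDerivWithinAt s h)

end HilbertSchmidt

/-! ### Positivity of the second derivative and the Cauchy–Schwarz step -/

section Schur

universe u

variable {H : Type u} [NormedAddCommGroup H] [InnerProductSpace ℂ H] [CompleteSpace H]
  {ι : Type*} {x y x' : H →L[ℂ] H} {b : HilbertBasis ι ℂ H} {l : ι → ℝ} {m : ℕ}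

theorem sum_pow_mul_pow_self (m : ℕ) (a : ℝ) :
    ∑ i ∈ Finset.range m, a ^ i * a ^ (m - 1 - i) = m * a ^ (m - 1) := by
  rw [Finset.sum_congr rfl (g := fun _ => a ^ (m - 1)) fun i hi => by
    have := Finset.mem_range.1 hi
    rw [← pow_add]
    congr 1
    omega]
  simp

/-- The polynomial `∑ aⁱ b^(2m-2-i)`, in the form in which it arises as the symbol of the second
derivative. -/
noncomputable def secondSymbol (m : ℕ) (a b : ℝ) : ℝ :=
  a ^ (m - 1) * (∑ i ∈ Finset.range m, a ^ i * b ^ (m - 1 - i)) +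
    b ^ m * ∑ i ∈ Finset.range (m - 1), b ^ i * a ^ (m - 1 - 1 - i)

theorem secondSymbol_self (hm : 2 ≤ m) (a : ℝ) :
    secondSymbol m a a = (2 * m - 1) * (a ^ (m - 1)) ^ 2 := by
  obtain ⟨n, rfl⟩ : ∃ n, m = n + 2 := ⟨m - 2, by omega⟩
  rw [secondSymbol, sum_pow_mul_pow_self, sum_pow_mul_pow_self]
  have h1 : n + 2 - 1 = n + 1 := by omega
  simp only [h1, Nat.add_sub_cancel]
  push_cast
  ring

/-- Multiplied by a - b, the symbol telescopes to a^{2m-1} - b^{2m-1}, and odd powers are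
increasing. -/
theorem secondSymbol_nonneg (hm : 2 ≤ m) (a b : ℝ) : 0 ≤ secondSymbol m a b := by
  rcases eq_or_ne a b with rfl | hab
  · rw [secondSymbol_self hm]
    have : (2 : ℝ) ≤ m := by exact_mod_cast hm
    exact mul_nonneg (by linarith) (sq_nonneg _)
  obtain ⟨n, rfl⟩ : ∃ n, m = n + 1 := ⟨m - 1, by omega⟩
  have h1 := geom_sum₂_mul a b (n + 1)
  have h2 := geom_sum₂_mul b a n
  have h3 : secondSymbol (n + 1) a b * (a - b) = a ^ (2 * n + 1) - b ^ (2 * n + 1) := by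
    simp only [secondSymbol, Nat.add_sub_cancel] at h1 ⊢
    linear_combination a ^ n * h1 - b ^ (n + 1) * h2
  have hmono := (Odd.strictMono_pow (R := ℝ) (n := 2 * n + 1) ⟨n, rfl⟩)
  by_contra hneg
  rcases lt_or_gt_of_ne hab with h | h
  · have := hmono h
    simp only at this
    nlinarith [mul_pos_of_neg_of_neg (not_le.1 hneg) (sub_neg.2 h)]
  · have := hmono h
    simp only at this
    nlinarith [mul_neg_of_neg_of_pos (not_le.1 hneg) (sub_pos.2 h)]

omit [CompleteSpace H] in
theorem frameNorm_two_lt_top_of_div {q : ℝ} {k : ℕ} (hk : 0 < k) (hq : q = 2 * k)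
    (h : frameNorm (q / k) x < ∞) : frameNorm 2 x < ∞ := by
  have : (0 : ℝ) < k := by exact_mod_cast hk
  rwa [hq, mul_div_cancel_right₀ _ this.ne'] at h

theorem frameNorm_two_pow_lt_top (hm : 2 ≤ m) (hx : frameNorm (2 * m) x < ∞) :
    frameNorm 2 (x ^ m) < ∞ :=
  frameNorm_two_lt_top_of_div (by omega) rfl (frameNorm_pow_lt_top hx (by omega) le_rfl)

theorem frameNorm_two_powDeriv_lt_top (hm : 2 ≤ m) (hx : frameNorm (2 * m) x < ∞)
    (hx' : frameNorm (2 * m) x' < ∞) : frameNorm 2 (powDeriv x x' m) < ∞ :=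
  frameNorm_two_lt_top_of_div (by omega) rfl (frameNorm_powDeriv_lt_top hx hx' (by omega) le_rfl)

theorem exponent_sub_one (hm : 2 ≤ m) :
    (2 : ℝ)⁻¹ = (2 * m / (m - 1 : ℕ) : ℝ)⁻¹ + (2 * m : ℝ)⁻¹ := by
  have h0 : (2 : ℝ) ≤ m := by exact_mod_cast hm
  rw [Nat.cast_sub (by omega), inv_div]
  push_cast
  field_simp
  ring

theorem sub_one_exponent_le (m : ℕ) : 2 * ((m - 1 : ℕ) : ℝ) ≤ 2 * m := by
  have : ((m - 1 : ℕ) : ℝ) ≤ m := by exact_mod_cast Nat.sub_le m 1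
  linarith

theorem frameNorm_two_pow_mul_lt_top (hm : 2 ≤ m) (hx : frameNorm (2 * m) x < ∞)
    (hy : frameNorm (2 * m) y < ∞) : frameNorm 2 (x ^ (m - 1) * y) < ∞ := by
  have h0 : (2 : ℝ) ≤ m := by exact_mod_cast hm
  have h1 := two_le_exponent (k := m - 1) (by omega) (sub_one_exponent_le m)
  exact frameNorm_mul_lt_top le_rfl (by linarith) (by linarith) (exponent_sub_one hm)
    (frameNorm_pow_lt_top hx (by omega) (sub_one_exponent_le m)) hy

theorem frameNorm_two_powDeriv_mul_lt_top (hm : 2 ≤ m) (hx : frameNorm (2 * m) x < ∞)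
    (hx' : frameNorm (2 * m) x' < ∞) (hy : frameNorm (2 * m) y < ∞) :
    frameNorm 2 (powDeriv x x' (m - 1) * y) < ∞ := by
  have h0 : (2 : ℝ) ≤ m := by exact_mod_cast hm
  have h1 := two_le_exponent (k := m - 1) (by omega) (sub_one_exponent_le m)
  exact frameNorm_mul_lt_top le_rfl (by linarith) (by linarith) (exponent_sub_one hm)
    (frameNorm_powDeriv_lt_top hx hx' (by omega) (sub_one_exponent_le m)) hy

theorem inner_pow_apply_pow_apply (hx : IsSelfAdjoint x) {e : H} {l : ℝ} (h : x e = (l : ℂ) • e)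
    (m k : ℕ) (v : H) :
    inner ℂ ((x ^ m) e) ((x ^ k) v) = ((l ^ m * l ^ k : ℝ) : ℂ) * inner ℂ e v := by
  rw [pow_apply_of_apply_eq_smul h, inner_smul_left, inner_pow_of_apply_eq_smul hx h,
    Complex.conj_ofReal]
  push_cast; ring

/-- As x^m is diagonal in the basis b, the pairing sees only the diagonal of x', which agrees with
that of y. -/
theorem hsRe_pow_powDeriv (hm : 2 ≤ m) (hx : IsSelfAdjoint x) (hb : ∀ i, x (b i) = (l i : ℂ) • b i)
    (hxf : frameNorm (2 * m) x < ∞) (hxf' : frameNorm (2 * m) x' < ∞) (hyf : frameNorm (2 * m) y < ∞)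
    (hd : ∀ i, inner ℂ (b i) (x' (b i)) = inner ℂ (b i) (y (b i))) :
    hsRe b (x ^ m) (powDeriv x x' m) = m * hsRe b (x ^ m) (x ^ (m - 1) * y) := by
  have h1 := hasSum_hsRe (b := b) (frameNorm_two_pow_lt_top hm hxf)
    (frameNorm_two_powDeriv_lt_top hm hxf hxf')
  have h2 := (hasSum_hsRe (b := b) (frameNorm_two_pow_lt_top hm hxf)
    (frameNorm_two_pow_mul_lt_top hm hxf hyf)).mul_left (m : ℝ)
  have e : (fun i => (inner ℂ ((x ^ m) (b i)) (powDeriv x x' m (b i))).re) =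
      fun i => (m : ℝ) * (inner ℂ ((x ^ m) (b i)) ((x ^ (m - 1) * y) (b i))).re := funext fun i => ?_
  · rw [e] at h1
    exact h1.unique h2
  rw [mul_apply_eq_comp, inner_pow_apply_pow_apply hx (hb i), pow_apply_of_apply_eq_smul (hb i),
    inner_smul_left, Complex.conj_ofReal, inner_powDeriv hx (hb i) (hb i), sum_pow_mul_pow_self, hd,
    Complex.re_ofReal_mul, Complex.re_ofReal_mul, Complex.re_ofReal_mul]
  ring

/-- The Hilbert–Schmidt pairing which computes the second derivative of `‖x‖_{2m}^{2m}`, up to a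
factor. -/
noncomputable def hsSecond (b : HilbertBasis ι ℂ H) (m : ℕ) (x x' y : H →L[ℂ] H) : ℝ :=
  hsRe b (x ^ m) (powDeriv x x' (m - 1) * y) + hsRe b (powDeriv x x' m) (x ^ (m - 1) * y)

/-- In the eigenbasis the pairing is the double sum of `secondSymbol m (l j) (l i)` times
Re(ρ_ji)|y_ji|², all terms being nonnegative. Here t i is the inner sum over j, and keeping only j =
i gives its lower bound. -/
theorem exists_hasSum_hsSecond (hm : 2 ≤ m) (hx : IsSelfAdjoint x) (hx' : IsSelfAdjoint x')
    (hb : ∀ i, x (b i) = (l i : ℂ) • b i)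
    (hxf : frameNorm (2 * m) x < ∞) (hxf' : frameNorm (2 * m) x' < ∞) (hyf : frameNorm (2 * m) y < ∞)
    (hρ : ∀ i j, ∃ ρ : ℂ, inner ℂ (b i) (x' (b j)) = ρ * inner ℂ (b i) (y (b j)) ∧
      0 ≤ ρ.re ∧ (l i = l j → ρ = 1)) :
    ∃ t : ι → ℝ, HasSum t (hsSecond b m x x' y) ∧
      ∀ i, (2 * m - 1) * (l i ^ (m - 1) * (inner ℂ (b i) (y (b i))).re) ^ 2 ≤ t i := by
  refine ⟨_, (hasSum_hsRe (b := b) (frameNorm_two_pow_lt_top hm hxf)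
    (frameNorm_two_powDeriv_mul_lt_top hm hxf hxf' hyf)).add (hasSum_hsRe (b := b)
    (frameNorm_two_powDeriv_lt_top hm hxf hxf') (frameNorm_two_pow_mul_lt_top hm hxf hyf)),
    fun i => ?_⟩
  have s1 := b.hasSum_inner_mul_inner (powDeriv x x' m (b i)) ((x ^ (m - 1) * y) (b i))
  have s2 := (b.hasSum_inner_mul_inner (star (powDeriv x x' (m - 1)) (b i)) (y (b i))).mul_left
    ((l i ^ m : ℝ) : ℂ)
  have e1 : ((l i ^ m : ℝ) : ℂ) * inner ℂ (star (powDeriv x x' (m - 1)) (b i)) (y (b i)) =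
      inner ℂ ((x ^ m) (b i)) ((powDeriv x x' (m - 1) * y) (b i)) := by
    rw [inner_star_apply_left, pow_apply_of_apply_eq_smul (hb i), inner_smul_left,
      Complex.conj_ofReal, mul_apply_eq_comp]
  rw [e1] at s2
  have s3 := (s2.add s1).mapL Complex.reCLM
  set Z : ι → ℂ := fun j => (starRingEnd ℂ) (inner ℂ (b j) (x' (b i))) * inner ℂ (b j) (y (b i))
    with hZ
  have e2 : ∀ j, Complex.reCLM (((l i ^ m : ℝ) : ℂ) *
      (inner ℂ (star (powDeriv x x' (m - 1)) (b i)) (b j) * inner ℂ (b j) (y (b i))) +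
      inner ℂ (powDeriv x x' m (b i)) (b j) * inner ℂ (b j) ((x ^ (m - 1) * y) (b i))) =
      secondSymbol m (l j) (l i) * (Z j).re := by
    intro j
    have f1 : inner ℂ (b i) (x' (b j)) = (starRingEnd ℂ) (inner ℂ (b j) (x' (b i))) := by
      rw [← inner_star_apply_left, hx'.star_eq, inner_conj_symm]
    rw [inner_star_apply_left, inner_powDeriv hx (hb i) (hb j), f1,
      ← inner_conj_symm (powDeriv x x' m (b i)), inner_powDeriv hx (hb j) (hb i), map_mul,
      Complex.conj_ofReal, mul_apply_eq_comp, inner_pow_of_apply_eq_smul hx (hb j)]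
    rw [← Complex.re_ofReal_mul, Complex.reCLM_apply, secondSymbol]
    congr 1
    push_cast
    ring
  simp only [e2] at s3
  have hnn : ∀ j, 0 ≤ secondSymbol m (l j) (l i) * (Z j).re := fun j => by
    refine mul_nonneg (secondSymbol_nonneg hm _ _) ?_
    obtain ⟨ρ, h1, h2, -⟩ := hρ j i
    have : Z j = (starRingEnd ℂ) ρ * ((Complex.normSq (inner ℂ (b j) (y (b i))) : ℝ) : ℂ) := by
      simp only [hZ, h1, map_mul]
      rw [mul_assoc, mul_comm ((starRingEnd ℂ) (inner ℂ (b j) (y (b i)))), Complex.mul_conj]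
    rw [this, Complex.re_mul_ofReal, Complex.conj_re]
    exact mul_nonneg h2 (Complex.normSq_nonneg _)
  refine le_trans ?_ (le_hasSum s3 i fun j _ => hnn j)
  obtain ⟨ρ, h1, -, h3⟩ := hρ i i
  rw [h3 rfl, one_mul] at h1
  have : (Z i).re = Complex.normSq (inner ℂ (b i) (y (b i))) := by
    simp only [hZ, h1]
    rw [mul_comm, Complex.mul_conj, Complex.ofReal_re]
  -- The diagonal term carries |y_ii|²; its imaginary part is discarded.
  rw [secondSymbol_self hm, this, Complex.normSq_apply, mul_pow, ← mul_assoc]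
  have : (2 : ℝ) ≤ m := by exact_mod_cast hm
  have h4 : 0 ≤ (2 * (m : ℝ) - 1) * (l i ^ (m - 1)) ^ 2 := mul_nonneg (by linarith) (sq_nonneg _)
  nlinarith [mul_nonneg h4 (mul_self_nonneg (inner ℂ (b i) (y (b i))).im)]

/-- Cauchy–Schwarz in discriminant form: the squares (l_i^m - r c_i)² are summed after replacing
(2m-1) c_i² by the larger t i, and the resulting quadratic in r is nonnegative. The series ∑ c_i² is
never formed. -/
theorem hsRe_sq_le (hm : 2 ≤ m) (hx : IsSelfAdjoint x) (hx' : IsSelfAdjoint x')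
    (hb : ∀ i, x (b i) = (l i : ℂ) • b i)
    (hxf : frameNorm (2 * m) x < ∞) (hxf' : frameNorm (2 * m) x' < ∞) (hyf : frameNorm (2 * m) y < ∞)
    (hρ : ∀ i j, ∃ ρ : ℂ, inner ℂ (b i) (x' (b j)) = ρ * inner ℂ (b i) (y (b j)) ∧
      0 ≤ ρ.re ∧ (l i = l j → ρ = 1)) :
    0 ≤ hsSecond b m x x' y ∧ (2 * m - 1) * hsRe b (x ^ m) (x ^ (m - 1) * y) ^ 2 ≤
      hsRe b (x ^ m) (x ^ m) * hsSecond b m x x' y := by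
  obtain ⟨t, ht, htle⟩ := exists_hasSum_hsSecond hm hx hx' hb hxf hxf' hyf hρ
  have hm' : (2 : ℝ) ≤ m := by exact_mod_cast hm
  have hc : 0 < 2 * (m : ℝ) - 1 := by linarith
  set c : ι → ℝ := fun i => l i ^ (m - 1) * (inner ℂ (b i) (y (b i))).re with hcdef
  have hR : HasSum (fun i => l i ^ m * c i) (hsRe b (x ^ m) (x ^ (m - 1) * y)) := by
    convert hasSum_hsRe (b := b) (frameNorm_two_pow_lt_top hm hxf)
      (frameNorm_two_pow_mul_lt_top hm hxf hyf) using 2 with i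
    rw [mul_apply_eq_comp, inner_pow_apply_pow_apply hx (hb i), Complex.re_ofReal_mul, hcdef,
      mul_assoc]
  have hF : HasSum (fun i => l i ^ m * l i ^ m) (hsRe b (x ^ m) (x ^ m)) := by
    convert hasSum_hsRe (b := b) (frameNorm_two_pow_lt_top hm hxf)
      (frameNorm_two_pow_lt_top hm hxf) using 2 with i
    rw [inner_pow_apply_pow_apply hx (hb i), Complex.re_ofReal_mul]
    simp [b.orthonormal.1 i]
  have ht0 : ∀ i, 0 ≤ t i := fun i => (mul_nonneg hc.le (sq_nonneg (c i))).trans (htle i)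
  refine ⟨ht.nonneg ht0, ?_⟩
  have hquad : ∀ r : ℝ, 0 ≤ hsSecond b m x x' y * (r * r) +
      (-2 * (2 * m - 1) * hsRe b (x ^ m) (x ^ (m - 1) * y)) * r +
      (2 * m - 1) * hsRe b (x ^ m) (x ^ m) := by
    intro r
    have h := ((ht.mul_right (r * r)).add ((hR.mul_left (-2 * (2 * (m : ℝ) - 1))).mul_right r)).add
      (hF.mul_left (2 * (m : ℝ) - 1))
    refine h.nonneg fun i => ?_
    have h1 := mul_le_mul_of_nonneg_right (htle i) (mul_self_nonneg r)
    have h2 := mul_nonneg hc.le (sq_nonneg (l i ^ m - r * c i))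
    have h3 : (2 * (m : ℝ) - 1) * (l i ^ (m - 1) * (inner ℂ (b i) (y (b i))).re) ^ 2 =
      (2 * (m : ℝ) - 1) * c i ^ 2 := rfl
    rw [h3] at h1
    linear_combination h1 + h2
  have hdisc := discrim_le_zero hquad
  rw [discrim] at hdisc
  have h5 : (2 * (m : ℝ) - 1) * ((2 * m - 1) * hsRe b (x ^ m) (x ^ (m - 1) * y) ^ 2) ≤
      (2 * m - 1) * (hsRe b (x ^ m) (x ^ m) * hsSecond b m x x' y) := by
    linear_combination hdisc / 4
  exact le_of_mul_le_mul_left h5 hc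

end Schur

/-! ### The second derivative of the Schatten norm along a curve of logarithms -/

section SchattenPower

universe u

variable {H : Type u} [NormedAddCommGroup H] [InnerProductSpace ℂ H] [CompleteSpace H]
  {ι : Type*} {m : ℕ}

/-- For self-adjoint x this is ‖x‖_{2m}^{2m} = ‖x^m‖_2², read off in an eigenbasis. It turns the
power of the norm into a differentiable quadratic expression. -/
theorem toReal_frameNorm_pow_eq_hsRe (hm : 2 ≤ m) {x : H →L[ℂ] H} (hx : IsSelfAdjoint x)
    (hxf : frameNorm (2 * m) x < ∞) (c : HilbertBasis ι ℂ H) :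
    (frameNorm (2 * m) x).toReal ^ (2 * m) = hsRe c (x ^ m) (x ^ m) := by
  have hm' : (2 : ℝ) ≤ m := by exact_mod_cast hm
  have hq : (0 : ℝ) < 2 * m := by linarith
  obtain ⟨κ, b, l, hb⟩ := hx.exists_eigenbasis (isCompactOperator_of_frameNorm_lt_top hq hxf)
  have h2 := frameNorm_two_pow_lt_top hm hxf
  rw [hsRe_self h2, frameSum_two_eq b h2, ← ENNReal.toReal_pow]
  congr 1
  have h3 := frameNorm_rpow (x := x) hq
  rw [(hx.isSingularBasis hb).frameSum_eq (by linarith)] at h3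
  have h4 : frameNorm (2 * m) x ^ (2 * m) = frameNorm (2 * m) x ^ (2 * m : ℝ) := by
    rw [← ENNReal.rpow_natCast]; push_cast; rfl
  rw [h4, h3]
  refine tsum_congr fun i => ?_
  have h5 : ‖(x ^ m) (b i)‖ₑ = ‖x (b i)‖ₑ ^ m := by
    rw [pow_apply_of_apply_eq_smul (hb i), hb i, enorm_smul, enorm_smul]
    have : ‖b i‖ₑ = 1 := by rw [← ofReal_norm, b.orthonormal.1 i, ENNReal.ofReal_one]
    rw [this, mul_one, mul_one, Complex.ofReal_pow, enorm_pow]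
  rw [h5, ← pow_mul, ← ENNReal.rpow_natCast]
  congr 1
  push_cast; ring

/-- `x'` is, in some eigenbasis of `x`, the image of `y` under a Schur multiplier whose symbol has
nonnegative real part, and is `1` on the diagonal. -/
def IsAccretiveSchur (x x' y : H →L[ℂ] H) : Prop :=
  ∃ (ι : Type u) (b : HilbertBasis ι ℂ H) (l : ι → ℝ), (∀ i, x (b i) = (l i : ℂ) • b i) ∧
    ∀ i j, ∃ ρ : ℂ, inner ℂ (b i) (x' (b j)) = ρ * inner ℂ (b i) (y (b j)) ∧
      0 ≤ ρ.re ∧ (l i = l j → ρ = 1)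

theorem IsAccretiveSchur.hsRe_pow_powDeriv {x x' y : H →L[ℂ] H} (h : IsAccretiveSchur x x' y)
    (hm : 2 ≤ m) (hx : IsSelfAdjoint x)
    (hxf : frameNorm (2 * m) x < ∞) (hxf' : frameNorm (2 * m) x' < ∞) (hyf : frameNorm (2 * m) y < ∞)
    (c : HilbertBasis ι ℂ H) :
    hsRe c (x ^ m) (powDeriv x x' m) = m * hsRe c (x ^ m) (x ^ (m - 1) * y) := by
  obtain ⟨κ, b, l, hb, hρ⟩ := h
  have h1 := frameNorm_two_pow_lt_top hm hxf
  rw [hsRe_eq b h1 (frameNorm_two_powDeriv_lt_top hm hxf hxf'),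
    hsRe_eq b h1 (frameNorm_two_pow_mul_lt_top hm hxf hyf)]
  refine _root_.hsRe_pow_powDeriv hm hx hb hxf hxf' hyf fun i => ?_
  obtain ⟨ρ, h1, -, h3⟩ := hρ i i
  rwa [h3 rfl, one_mul] at h1

theorem IsAccretiveSchur.hsRe_sq_le {x x' y : H →L[ℂ] H} (h : IsAccretiveSchur x x' y)
    (hm : 2 ≤ m) (hx : IsSelfAdjoint x) (hx' : IsSelfAdjoint x')
    (hxf : frameNorm (2 * m) x < ∞) (hxf' : frameNorm (2 * m) x' < ∞) (hyf : frameNorm (2 * m) y < ∞)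
    (c : HilbertBasis ι ℂ H) :
    0 ≤ hsSecond c m x x' y ∧ (2 * m - 1) * hsRe c (x ^ m) (x ^ (m - 1) * y) ^ 2 ≤
      hsRe c (x ^ m) (x ^ m) * hsSecond c m x x' y := by
  obtain ⟨κ, b, l, hb, hρ⟩ := h
  have h1 := frameNorm_two_pow_lt_top hm hxf
  have h2 := frameNorm_two_pow_mul_lt_top hm hxf hyf
  rw [hsSecond, hsRe_eq b h1 h2, hsRe_eq b h1 h1,
    hsRe_eq b h1 (frameNorm_two_powDeriv_mul_lt_top hm hxf hxf' hyf),
    hsRe_eq b (frameNorm_two_powDeriv_lt_top hm hxf hxf') h2]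
  exact _root_.hsRe_sq_le hm hx hx' hb hxf hxf' hyf hρ

omit [CompleteSpace H] in
theorem hasFrameDerivWithin_two_of_div {q : ℝ} {k : ℕ} (hk : 0 < k) (hq : q = 2 * k)
    {A : ℝ → H →L[ℂ] H} {A' : H →L[ℂ] H} {S : Set ℝ} {s : ℝ}
    (h : HasFrameDerivWithin (q / k) A A' S s) : HasFrameDerivWithin 2 A A' S s := by
  have : (0 : ℝ) < k := by exact_mod_cast hk
  rwa [hq, mul_div_cancel_right₀ _ this.ne'] at h

variable {h h' : ℝ → H →L[ℂ] H} {y : H →L[ℂ] H} {S : Set ℝ} {s : ℝ}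

/-- The derivative 2⟨h^m, (h^m)'⟩ equals 2m⟨h^m, h^{m-1} y⟩, since only the diagonal of h' enters.
Having y in place of h' spares a second derivative of the logarithm later. -/
theorem hasDerivWithinAt_toReal_frameNorm_pow (hm : 2 ≤ m) (hsa : ∀ t ∈ S, IsSelfAdjoint (h t))
    (hfin : ∀ t ∈ S, frameNorm (2 * m) (h t) < ∞) (hs : s ∈ S)
    (hd : HasFrameDerivWithin (2 * m) h (h' s) S s) (hfin' : frameNorm (2 * m) (h' s) < ∞)
    (hyf : frameNorm (2 * m) y < ∞) (hschur : IsAccretiveSchur (h s) (h' s) y)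
    (c : HilbertBasis ι ℂ H) :
    HasDerivWithinAt (fun t => (frameNorm (2 * m) (h t)).toReal ^ (2 * m))
      (2 * m * hsRe c (h s ^ m) (h s ^ (m - 1) * y)) S s := by
  have h1 := hasFrameDerivWithin_two_of_div (by omega) rfl
    (hd.pow (hfin s hs) hfin' (k := m) (by omega) le_rfl)
  have hf2 : ∀ t ∈ S, frameNorm 2 (h t ^ m) < ∞ := fun t ht => frameNorm_two_pow_lt_top hm (hfin t ht)
  have hf3 := frameNorm_two_powDeriv_lt_top hm (hfin s hs) hfin'
  have h2 := h1.hsRe h1 hf2 hf2 hs hf3 hf3 c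
  rw [hsRe_comm (powDeriv _ _ _),
    hschur.hsRe_pow_powDeriv hm (hsa s hs) (hfin s hs) hfin' hyf c] at h2
  refine (h2.congr_deriv (by ring)).congr_of_mem (fun t ht => ?_) hs
  exact toReal_frameNorm_pow_eq_hsRe hm (hsa t ht) (hfin t ht) c

theorem hasDerivWithinAt_hsRe_pow_mul (hm : 2 ≤ m)
    (hfin : ∀ t ∈ S, frameNorm (2 * m) (h t) < ∞) (hs : s ∈ S)
    (hd : HasFrameDerivWithin (2 * m) h (h' s) S s) (hfin' : frameNorm (2 * m) (h' s) < ∞)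
    (hyf : frameNorm (2 * m) y < ∞) (c : HilbertBasis ι ℂ H) :
    HasDerivWithinAt (fun t => hsRe c (h t ^ m) (h t ^ (m - 1) * y)) (hsSecond c m (h s) (h' s) y)
      S s := by
  have h0 : (2 : ℝ) ≤ m := by exact_mod_cast hm
  have h1 := hasFrameDerivWithin_two_of_div (by omega) rfl
    (hd.pow (hfin s hs) hfin' (k := m) (by omega) le_rfl)
  have hle := sub_one_exponent_le m
  have h2 := (hd.pow (hfin s hs) hfin' (k := m - 1) (by omega) hle).mul_const le_rfl
    (by linarith [two_le_exponent (k := m - 1) (by omega) hle]) (by linarith) (exponent_sub_one hm)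
    (frameNorm_pow_lt_top (hfin s hs) (by omega) hle)
    (frameNorm_powDeriv_lt_top (hfin s hs) hfin' (by omega) hle) hyf
  exact h1.hsRe h2 (fun t ht => frameNorm_two_pow_lt_top hm (hfin t ht))
    (fun t ht => frameNorm_two_pow_mul_lt_top hm (hfin t ht) hyf) hs
    (frameNorm_two_powDeriv_lt_top hm (hfin s hs) hfin')
    (frameNorm_two_powDeriv_mul_lt_top hm (hfin s hs) hfin' hyf) c

end SchattenPower

/-! ### The argument along a curve of unitaries -/

section LogCurve

universe u

variable {H : Type u} [NormedAddCommGroup H] [InnerProductSpace ℂ H] [CompleteSpace H]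
  {V : ℝ → H →L[ℂ] H} {S : Set ℝ} {s : ℝ} {q r : ℝ}

/-- The derivative of `unitaryArg` at `v` in the direction `D`. -/
noncomputable def unitaryArgDeriv (v D : H →L[ℂ] H) : H →L[ℂ] H :=
  -Complex.I • unitaryLogDeriv v D

theorem unitaryArg_eq {v : H →L[ℂ] H} (hv : v ∈ unitary (H →L[ℂ] H)) (h2 : ‖v - 1‖ < 2) :
    unitaryArg v = -Complex.I • unitaryLog v := by
  rw [unitaryLog_eq_I_smul hv h2, smul_smul]
  simp

omit [CompleteSpace H] in
theorem frameNorm_neg_I_smul (hq : 0 < q) (x : H →L[ℂ] H) :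
    frameNorm q (-Complex.I • x) = frameNorm q x :=
  frameNorm_congr hq fun v => by simp [norm_smul]

theorem hasFrameDerivWithin_unitaryArg (hq : 2 ≤ q) (hr : r < 2) {D : H →L[ℂ] H} (hs : s ∈ S)
    (hV : ∀ t ∈ S, V t ∈ unitary (H →L[ℂ] H) ∧ ‖V t - 1‖ ≤ r)
    (h : HasFrameDerivWithin q V D S s) (hD : frameNorm q D < ∞) :
    HasFrameDerivWithin q (fun t => unitaryArg (V t)) (unitaryArgDeriv (V s) D) S s := by
  refine (hasFrameDerivWithin_unitaryLog hq hr hs hV h hD).congr' ?_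
  filter_upwards [self_mem_nhdsWithin] with t ht
  have e : slope (fun t => unitaryArg (V t)) s t - unitaryArgDeriv (V s) D =
      -Complex.I • (slope (fun t => unitaryLog (V t)) s t - unitaryLogDeriv (V s) D) := by
    simp only [slope_def_module, unitaryArgDeriv]
    rw [unitaryArg_eq (hV t ht.1).1 ((hV t ht.1).2.trans_lt hr),
      unitaryArg_eq (hV s hs).1 ((hV s hs).2.trans_lt hr), smul_sub, smul_sub,
      smul_sub, smul_sub, smul_comm, smul_comm (t - s)⁻¹ (-Complex.I) (unitaryLog (V s))]
  rw [e, frameNorm_neg_I_smul (by linarith)]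

theorem isSelfAdjoint_of_hasDerivWithinAt {A : ℝ → H →L[ℂ] H} {A' : H →L[ℂ] H}
    (hA : ∀ t, IsSelfAdjoint (A t)) (hS : UniqueDiffWithinAt ℝ S s)
    (h : HasDerivWithinAt A A' S s) : IsSelfAdjoint A' := by
  have h1 := h.star
  simp only [(hA _).star_eq] at h1
  exact hS.eq_deriv _ h1 h

theorem isAccretiveSchur_unitaryArgDeriv (hq : 1 ≤ q) {v z : H →L[ℂ] H}
    (hv : v ∈ unitary (H →L[ℂ] H)) (h2 : ‖v - 1‖ < 2) (hf : frameNorm q (v - 1) < ∞)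
    (hpi : ‖unitaryArg v‖ < Real.pi / 2) :
    IsAccretiveSchur (unitaryArg v) (unitaryArgDeriv v (v * z)) (-Complex.I • z) := by
  obtain ⟨ι, b, l, hb, hvb, hl⟩ := exists_eigenbasis_unitaryArg hq hv h2 hf
  refine ⟨ι, b, l, hb, fun i j => ?_⟩
  obtain ⟨ρ, h1, h3⟩ := exists_inner_unitaryLogDeriv_eq hv h2 (hvb i) (hvb j)
    ((hl i).trans_lt hpi) ((hl j).trans_lt hpi) z
  refine ⟨ρ, ?_, h3⟩
  simp only [unitaryArgDeriv, smul_apply, inner_smul_right, h1]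
  ring

end LogCurve

/-! ### The sinc factor and the radius of the ball -/

theorem sinc_lt_sinc_of_pos {x y : ℝ} (hx : 0 < x) (hxy : x < y) (hy : y ≤ Real.pi) :
    Real.sinc y < Real.sinc x := by
  have h := strictConcaveOn_sin_Icc.slope_anti_adjacent (x := 0) (y := x) (z := y)
    ⟨le_rfl, Real.pi_pos.le⟩ ⟨by linarith, hy⟩ hx hxy
  rw [Real.sin_zero, sub_zero, sub_zero, div_lt_div_iff₀ (by linarith) hx] at h
  rw [Real.sinc_of_ne_zero hx.ne', Real.sinc_of_ne_zero (by linarith),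
    div_lt_div_iff₀ (by linarith) hx]
  linarith

/-- The intermediate value theorem provides a preimage of 1/(p-1), so the inverse function takes its
intended value; it is not π because sinc π = 0. -/
theorem schattenRadius_spec {p : ℕ} (hp : 4 ≤ p) :
    2 * schattenRadius p < Real.pi ∧ Real.sinc (2 * schattenRadius p) = 1 / ((p : ℝ) - 1) := by
  have hp' : (4 : ℝ) ≤ p := by exact_mod_cast hp
  have hpos : 0 < 1 / ((p : ℝ) - 1) := by
    apply one_div_pos.2; linarith
  have hlt : 1 / ((p : ℝ) - 1) < 1 := by
    rw [div_lt_one (by linarith)]; linarith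
  have hpi : Real.sinc Real.pi = 0 := by
    rw [Real.sinc_of_ne_zero Real.pi_ne_zero, Real.sin_pi, zero_div]
  have hex : ∃ x ∈ Icc 0 Real.pi, Real.sinc x = 1 / ((p : ℝ) - 1) := by
    have h := intermediate_value_Icc' Real.pi_pos.le Real.continuous_sinc.continuousOn
    rw [hpi, Real.sinc_zero] at h
    exact h ⟨hpos.le, hlt.le⟩
  have hmem := Function.invFunOn_mem hex
  have heq := Function.invFunOn_eq hex
  have h2 : 2 * schattenRadius p =
      Function.invFunOn Real.sinc (Icc 0 Real.pi) (1 / ((p : ℝ) - 1)) := by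
    rw [schattenRadius]; ring
  rw [← h2] at hmem heq
  refine ⟨lt_of_le_of_ne hmem.2 fun h => ?_, heq⟩
  rw [h, hpi] at heq
  linarith

/-- Since sinc decreases strictly on (0, π], its value at 2N lies above 1/(p-1), its value at 2r_p.
-/
theorem one_div_sinc_bounds {p : ℕ} (hp : 4 ≤ p) {N : ℝ} (hN : 0 < N) (hNr : N < schattenRadius p) :
    1 ≤ 1 / Real.sinc (2 * N) ∧ 1 / Real.sinc (2 * N) < (p : ℝ) - 1 := by
  obtain ⟨h2, h3⟩ := schattenRadius_spec hp
  have hp' : (4 : ℝ) ≤ p := by exact_mod_cast hp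
  have h4 := sinc_lt_sinc_of_pos (x := 2 * N) (by linarith) (by linarith) h2.le
  rw [h3] at h4
  have hpos : 0 < 1 / ((p : ℝ) - 1) := by
    apply one_div_pos.2; linarith
  refine ⟨(one_le_div (hpos.trans h4)).2 (Real.sinc_le_one _), ?_⟩
  have := one_div_lt_one_div_of_lt hpos h4
  rwa [one_div_one_div] at this

/-! ### The convexity inequality along geodesics, and the theorem -/

section Final

universe u

variable {H : Type u} [NormedAddCommGroup H] [InnerProductSpace ℂ H] [CompleteSpace H]
  {p : ℕ} {u v z : H →L[ℂ] H}

theorem unitaryArg_ne_zero {v : H →L[ℂ] H} (hv : v ∈ unitary (H →L[ℂ] H)) (h2 : ‖v - 1‖ < 2)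
    (h1 : v ≠ 1) : unitaryArg v ≠ 0 := fun h0 => h1 <| by
  rw [← exp_unitaryLog hv h2, unitaryLog_eq_I_smul hv h2, h0, smul_zero, NormedSpace.exp_zero]

/-- Along a geodesic `s ↦ V s = v e^{sz}` of unitary operators near `1`, the `2m`-th power `F` of
the `2m`-norm of the logarithm has two derivatives with `(2m - 1) F'² ≤ 2m F F''`. -/
theorem exists_hasDerivWithinAt_toReal_frameNorm_unitaryArg {m : ℕ} (hm : 2 ≤ m) {S : Set ℝ}
    (hS : UniqueDiffOn ℝ S) (hv : v ∈ frameUnitary (2 * m : ℝ)) (hz : star z = -z)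
    (hzf : frameNorm (2 * m) z < ∞)
    (hV : ∀ s ∈ S, ‖v * NormedSpace.exp (s • z) - 1‖ < 2 ∧
      (frameNorm (2 * m) (unitaryArg (v * NormedSpace.exp (s • z)))).toReal < Real.pi / 2) :
    ∃ F' F'' : ℝ → ℝ, ∀ s ∈ S,
      HasDerivWithinAt (fun t => (frameNorm (2 * m)
        (unitaryArg (v * NormedSpace.exp (t • z)))).toReal ^ (2 * m)) (F' s) S s ∧
      HasDerivWithinAt F' (F'' s) S s ∧ 0 ≤ F'' s ∧
      (2 * m - 1) * F' s ^ 2 ≤ 2 * m * (frameNorm (2 * m)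
        (unitaryArg (v * NormedSpace.exp (s • z)))).toReal ^ (2 * m) * F'' s := by
  have hm' : (2 : ℝ) ≤ m := by exact_mod_cast hm
  have hq1 : (1 : ℝ) ≤ 2 * m := by linarith
  have hq2 : (2 : ℝ) ≤ 2 * m := by linarith
  have hq0 : (0 : ℝ) < 2 * m := by linarith
  set V : ℝ → H →L[ℂ] H := fun t => v * NormedSpace.exp (t • z) with hVdef
  have hmem : ∀ t, V t ∈ frameUnitary (2 * m : ℝ) := fun t =>
    mul_mem_frameUnitary hq1 hv (exp_smul_mem_frameUnitary hq1 hz hzf t)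
  have hfin : ∀ t ∈ S, frameNorm (2 * m) (unitaryArg (V t)) < ∞ := fun t ht =>
    frameNorm_unitaryArg_lt_top hq1 (hmem t) (hV t ht).1
  have hnorm : ∀ t ∈ S, ‖unitaryArg (V t)‖ < Real.pi / 2 := fun t ht =>
    (norm_le_toReal_frameNorm hq0 (hfin t ht).ne).trans_lt (hV t ht).2
  have hV' : ∀ t ∈ S, V t ∈ unitary (H →L[ℂ] H) ∧ ‖V t - 1‖ ≤ Real.pi / 2 := fun t ht =>
    ⟨(hmem t).1, (norm_sub_one_le_norm_unitaryArg (hmem t).1 (hV t ht).1).trans (hnorm t ht).le⟩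
  -- π/2 serves as the common radius r < 2 for all V t, since ‖V t - 1‖ ≤ ‖arg V t‖ < π/2.
  have hpi : Real.pi / 2 < 2 := by linarith [Real.pi_lt_four]
  set h' : ℝ → H →L[ℂ] H := fun t => unitaryArgDeriv (V t) (V t * z) with hh'
  have hDf : ∀ t, frameNorm (2 * m) (V t * z) < ∞ := fun t => by
    rwa [frameNorm_unitary_mul hq0 (hmem t).1]
  have hd : ∀ s ∈ S, HasFrameDerivWithin (2 * m) (fun t => unitaryArg (V t)) (h' s) S s :=
    fun s hs => hasFrameDerivWithin_unitaryArg hq2 hpi hs hV'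
      (hasFrameDerivWithin_mul_exp_smul hq0 v hzf S s) (hDf s)
  have hfin' : ∀ s ∈ S, frameNorm (2 * m) (h' s) < ∞ := fun s hs => by
    rw [hh']
    simp only [unitaryArgDeriv]
    rw [frameNorm_neg_I_smul hq0]
    exact frameNorm_unitaryLogDeriv_lt_top hq2 (hmem s).1 (hV s hs).1 (hDf s)
  have hsa : ∀ t, IsSelfAdjoint (unitaryArg (V t)) := fun t => isSelfAdjoint_unitaryArg _
  have hsa' : ∀ s ∈ S, IsSelfAdjoint (h' s) := fun s hs =>
    isSelfAdjoint_of_hasDerivWithinAt hsa (hS s hs) ((hd s hs).hasDerivWithinAt hq0)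
  have hschur : ∀ s ∈ S, IsAccretiveSchur (unitaryArg (V s)) (h' s) (-Complex.I • z) := fun s hs =>
    isAccretiveSchur_unitaryArgDeriv hq1 (hmem s).1 (hV s hs).1 (hmem s).2 (hnorm s hs)
  have hyf : frameNorm (2 * m) (-Complex.I • z) < ∞ := by rwa [frameNorm_neg_I_smul hq0]
  obtain ⟨w, c, -⟩ := exists_hilbertBasis ℂ H
  refine ⟨fun s => 2 * m * hsRe c (unitaryArg (V s) ^ m) (unitaryArg (V s) ^ (m - 1) *
    (-Complex.I • z)), fun s => 2 * m * hsSecond c m (unitaryArg (V s)) (h' s) (-Complex.I • z),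
    fun s hs => ⟨?_, ?_, ?_⟩⟩
  · exact hasDerivWithinAt_toReal_frameNorm_pow hm (fun t _ => hsa t) hfin hs (hd s hs) (hfin' s hs)
      hyf (hschur s hs) c
  · exact (hasDerivWithinAt_hsRe_pow_mul hm hfin hs (hd s hs) (hfin' s hs) hyf c).const_mul _
  · obtain ⟨e1, e2⟩ := (hschur s hs).hsRe_sq_le hm (hsa s) (hsa' s hs) (hfin s hs) (hfin' s hs) hyf c
    refine ⟨by positivity, ?_⟩
    have e3 := toReal_frameNorm_pow_eq_hsRe hm (hsa s) (hfin s hs) c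
    -- Both derivatives carry a factor 2m, so the inequality between the pairings is scaled by
    -- (2m)².
    have e4 := mul_le_mul_of_nonneg_left e2 (by positivity : 0 ≤ (2 * (m : ℝ)) ^ 2)
    simp only [hVdef] at e3 e4 ⊢
    rw [e3]
    linarith [e4]

end Final

theorem theorem2p3 {H : Type*} [NormedAddCommGroup H] [InnerProductSpace ℂ H] [CompleteSpace H]
    (p : ℕ) (hp : Even p) (hp4 : 4 ≤ p)
    (u : H →L[ℂ] H) (hu : u ∈ schattenUnitary p)
    (β : ℝ → H →L[ℂ] H) (hβ : IsSchattenGeodesicOn p β (Icc 0 1))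
    (hβ_nonconst : ∃ s ∈ Icc (0 : ℝ) 1, ∃ t ∈ Icc (0 : ℝ) 1, β s ≠ β t)
    (hβ_ball : ∀ s ∈ Icc (0 : ℝ) 1, β s ∈ schattenBall p u (schattenRadius p))
    -- `u` lies on no prolongation of `β` (every prolongation is part of one defined on `ℝ`)
    (hu_prolong : ∀ γ : ℝ → H →L[ℂ] H, IsSchattenGeodesicOn p γ univ →
      EqOn γ β (Icc 0 1) → ∀ t, γ t ≠ u) :
    let f : ℝ → ℝ := fun s => schattenDist p u (β s) ^ p
    let f' : ℝ → ℝ := derivWithin f (Icc 0 1)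
    let f'' : ℝ → ℝ := derivWithin f' (Icc 0 1)
    let w : ℝ → H →L[ℂ] H := fun s => unitaryLog (star u * β s)
    DifferentiableOn ℝ f (Icc 0 1) ∧ DifferentiableOn ℝ f' (Icc 0 1) ∧
    ∀ s ∈ Icc (0 : ℝ) 1,
      (w s ∈ schattenClass p ∧ star (w s) = -w s ∧ NormedSpace.exp (w s) = star u * β s) ∧
      ((p : ℝ) - 1) * f' s ^ 2
        ≤ p * f s * f'' s * (1 / Real.sinc (2 * schattenNorm p (w s))) ∧
      p * f s * f'' s * (1 / Real.sinc (2 * schattenNorm p (w s)))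
        ≤ p * ((p : ℝ) - 1) * f s * f'' s ∧
      (p * f s * f'' s * (1 / Real.sinc (2 * schattenNorm p (w s)))
        = p * ((p : ℝ) - 1) * f s * f'' s ↔ f'' s = 0) := by
  intro f f' f'' w
  obtain ⟨v, hv, z, hzf, hz, hβv⟩ := hβ
  have hp0 : 0 < p := by omega
  have hq4 : (4 : ℝ) ≤ p := by exact_mod_cast hp4
  have hq1 : (1 : ℝ) ≤ p := by linarith
  have hq0 : (0 : ℝ) < p := by linarith
  have hE : ∀ x : H →L[ℂ] H, eSchattenNorm p x = frameNorm p x :=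
    eSchattenNorm_eq_frameNorm hp hp0
  -- The formula v e^{tz} prolongs β to the whole line, so the prolongation hypothesis excludes u
  -- from β itself.
  have hne : ∀ s ∈ Icc (0 : ℝ) 1, u ≠ β s := fun s hs h =>
    hu_prolong (fun t => v * NormedSpace.exp (t • z)) ⟨v, hv, z, hzf, hz, fun _ _ => rfl⟩
      (fun t ht => (hβv t ht).symm) s ((hβv s hs).symm.trans h.symm)
  have hzf' : frameNorm p z < ∞ := by rw [← hE]; exact hzf
  rw [schattenUnitary_eq hp hp0] at hu hv
  obtain ⟨hrpi, -⟩ := schattenRadius_spec hp4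
  have hβmem : ∀ s ∈ Icc (0 : ℝ) 1, star u * β s ∈ frameUnitary (p : ℝ) := fun s hs => by
    have := (hβ_ball s hs).1
    rw [schattenUnitary_eq hp hp0] at this
    exact star_mul_mem_frameUnitary hq1 hu this
  have hdist : ∀ s ∈ Icc (0 : ℝ) 1, ‖star u * β s - 1‖ < 2 ∧
      eSchattenDist p u (β s) = frameNorm p (unitaryArg (star u * β s)) := fun s hs => by
    have hb := hβ_ball s hs
    have hmem := hb.1
    rw [schattenUnitary_eq hp hp0] at hmem
    exact eSchattenDist_eq hp (by omega) hu hmem (hne s hs)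
      (hb.2.trans_le (ENNReal.ofReal_le_ofReal (by linarith)))
  have hN : ∀ s ∈ Icc (0 : ℝ) 1, 0 < (frameNorm p (unitaryArg (star u * β s))).toReal ∧
      (frameNorm p (unitaryArg (star u * β s))).toReal < schattenRadius p := fun s hs => by
    have hfin := frameNorm_unitaryArg_lt_top hq1 (hβmem s hs) (hdist s hs).1
    constructor
    · refine lt_of_lt_of_le (norm_pos_iff.2 (unitaryArg_ne_zero (hβmem s hs).1 (hdist s hs).1
        fun h1 => hne s hs ?_)) (norm_le_toReal_frameNorm hq0 hfin.ne)
      calc u = u * (star u * β s) := by rw [h1, mul_one]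
        _ = β s := by rw [← mul_assoc, (Unitary.mem_iff.1 hu.1).2, one_mul]
    · have := (hβ_ball s hs).2
      rw [(hdist s hs).2] at this
      exact (ENNReal.lt_ofReal_iff_toReal_lt hfin.ne).1 this
  have hVβ : ∀ s ∈ Icc (0 : ℝ) 1, star u * β s = star u * v * NormedSpace.exp (s • z) :=
    fun s hs => by rw [hβv s hs, mul_assoc]
  have hfeq : ∀ s ∈ Icc (0 : ℝ) 1,
      f s = (frameNorm p (unitaryArg (star u * v * NormedSpace.exp (s • z)))).toReal ^ p :=
    fun s hs => by
      simp only [f, schattenDist]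
      rw [(hdist s hs).2, hVβ s hs]
  have hderiv : ∃ F' F'' : ℝ → ℝ, ∀ s ∈ Icc (0 : ℝ) 1, HasDerivWithinAt f (F' s) (Icc 0 1) s ∧
      HasDerivWithinAt F' (F'' s) (Icc 0 1) s ∧ 0 ≤ F'' s ∧
      ((p : ℝ) - 1) * F' s ^ 2 ≤ p * f s * F'' s := by
    obtain ⟨m, hm⟩ := hp.two_dvd
    have hpm : (p : ℝ) = 2 * m := by rw [hm]; push_cast; ring
    have hv0 := star_mul_mem_frameUnitary hq1 hu hv
    rw [hpm] at hv0 hzf'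
    obtain ⟨F', F'', hF⟩ := exists_hasDerivWithinAt_toReal_frameNorm_unitaryArg (m := m) (by omega)
      (uniqueDiffOn_Icc zero_lt_one) hv0 hz hzf' fun s hs => by
        rw [← hVβ s hs, ← hpm]
        exact ⟨(hdist s hs).1, by linarith [(hN s hs).2]⟩
    refine ⟨F', F'', fun s hs => ?_⟩
    obtain ⟨h1, h2, h3, h4⟩ := hF s hs
    rw [← hpm, ← hm] at h4
    refine ⟨h1.congr_of_mem (fun t ht => ?_) hs, h2, h3, ?_⟩
    · rw [hfeq t ht, ← hpm, ← hm]
    · rwa [hfeq s hs]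
  obtain ⟨F', F'', hF⟩ := hderiv
  have hud : UniqueDiffOn ℝ (Icc (0 : ℝ) 1) := uniqueDiffOn_Icc zero_lt_one
  have hf' : ∀ s ∈ Icc (0 : ℝ) 1, f' s = F' s := fun s hs => (hF s hs).1.derivWithin (hud s hs)
  have hdf' : ∀ s ∈ Icc (0 : ℝ) 1, HasDerivWithinAt f' (F'' s) (Icc 0 1) s := fun s hs =>
    (hF s hs).2.1.congr_of_mem hf' hs
  have hf'' : ∀ s ∈ Icc (0 : ℝ) 1, f'' s = F'' s := fun s hs => (hdf' s hs).derivWithin (hud s hs)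
  refine ⟨fun s hs => (hF s hs).1.differentiableWithinAt,
    fun s hs => (hdf' s hs).differentiableWithinAt, fun s hs => ?_⟩
  obtain ⟨-, -, h0, hle⟩ := hF s hs
  rw [← hf' s hs, ← hf'' s hs] at hle
  rw [← hf'' s hs] at h0
  have hu2 := (hdist s hs).1
  have hmem := hβmem s hs
  refine ⟨⟨?_, star_unitaryLog hmem.1 hu2, exp_unitaryLog hmem.1 hu2⟩, ?_⟩
  · change eSchattenNorm p (w s) < ∞
    rw [hE]
    exact frameNorm_unitaryLog_lt_top hq1 hmem.1 hu2 hmem.2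
  have hnorm : schattenNorm p (w s) = (frameNorm p (unitaryArg (star u * β s))).toReal := by
    rw [schattenNorm, hE]
    exact congrArg _ (frameNorm_unitaryLog hq0 hmem.1 hu2)
  obtain ⟨hb1, hb2⟩ := one_div_sinc_bounds hp4 (hN s hs).1 (hN s hs).2
  rw [hnorm]
  set N := (frameNorm p (unitaryArg (star u * β s))).toReal
  set g := 1 / Real.sinc (2 * N)
  have hfpos : 0 < f s := by
    have : f s = N ^ p := by rw [hfeq s hs, ← hVβ s hs]
    rw [this]
    exact pow_pos (hN s hs).1 p
  have hpf : 0 < p * f s := mul_pos hq0 hfpos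
  have hpff : 0 ≤ p * f s * f'' s := mul_nonneg hpf.le h0
  have e1 : (p : ℝ) * (p - 1) * f s * f'' s = p * f s * f'' s * (p - 1) := by ring
  rw [e1]
  -- The inequality `hle` has no sinc factor; inserting g ≥ 1 only enlarges the right side, as f'' ≥
  -- 0, and g < p - 1 gives the second bound.
  refine ⟨hle.trans (le_mul_of_one_le_right hpff hb1), mul_le_mul_of_nonneg_left hb2.le hpff,
    fun h => ?_, fun h => by rw [h]; ring⟩
  -- As g < p - 1 strictly, the two products can agree only if the common factor vanishes; since f >
  -- 0, this means f'' = 0.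
  have h2 : p * f s * f'' s = 0 := by
    by_contra hne0
    exact hb2.ne (mul_left_cancel₀ hne0 h)
  exact (mul_eq_zero.1 h2).resolve_left hpf.ne'
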